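/- **Theorem 7.5.** For $n\ge 1$ let $S_n$ be the symmetric group with simple transpositions $s_i=(i,i+1)$, $1\le i\le n-1$, and let $\ell(w)$ be the least $k$ such that $w$ is a product of $k$ simple transpositions. Let $0<\theta\le 1$, and let $$\pi(w)=\frac{\theta^{-\ell(w)}}{\sum_{v\in S_n}\theta^{-\ell(v)}}\qquad(w\in S_n).$$ Let $K_i$ be the Markov chain on $S_n$ which moves from $x$ to $s_ix$ with probability $1$ if $\ell(s_ix)>\ell(x)$ and, if $\ell(s_ix)<\ell(x)$, moves to $s_ix$ with probability $\theta$ and stays at $x$ with probability $1-\theta$. Let $$K=K_1K_2\cdots K_{n-1}K_{n-1}\cdots K_2K_1$$ be the short systematic scan and $K_x^\ell(y)=K^\ell(x,y)$, so that $K_1^\ell$ denotes the law after $\ell$ scans started from the identity. Write $\|f\|_2^2=\sum_{x}f(x)^2\pi(x)$ and $\|\mu-\nu\|_{TV}=\max_{A\subseteq S_n}|\mu(A)-\nu(A)|$. For a partition $\lambda$ of $n$ and a box $b$ of $\lambda$ in row $i$ and column $j$ let $c(b)=j-i$ be its content and $h_b$ its hook length. Put $n(\lambda)=\sum_i(i-1)\lambda_i$,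 $[k]_q=1+q+\cdots+q^{k-1}$, $[k]_q!=[k]_q\cdots[1]_q$ and, with $q=\theta^{-1}$, $$d_\lambda=\frac{n!}{\prod_{b\in\lambda}h_b},\qquad t_\lambda=q^{n(\lambda)}\frac{[n]_q!}{\prod_{b\in\lambda}[h_b]_q}.$$ Below, $S$ runs over the standard tableaux of shape $\lambda$, and $S(n)$ is the box of $S$ containing $n$. (a) For all integers $n\ge1$ and $\ell\ge0$, $$\|K_1^\ell/\pi-1\|_2^2=\sum_{\lambda\ne(n)}t_\lambda\sum_S\theta^{2\ell(n-1-c(S(n)))}.$$ (a′) Let $\theta<1$. If $n\ge1$ and the non-negative integer $\ell$ equals $n/2-(\log n)/(\log\theta)+c$ with $c>0$, then $$\|K_1^\ell-\pi\|_{TV}^2\le\left(e^{\theta^{2c+1}}-1\right)+n!\,\theta^{\,n^2/8-n(\log n)/(\log\theta)+n(c+1/4)}.$$ Conversely, for fixed $0<\theta\le1$, if $(\ell_n)$ is a sequence of non-negative integers with $\ell_n\le n/4$ for all large $n$, then $\|K_1^{\ell_n}-\pi\|_{TV}\to1$ as $n\to\infty$ (the distance being taken on $S_n$). (b) For all integers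 $n\ge1$ and $\ell\ge0$, $$\sum_{x\in S_n}\pi(x)\,\|K_x^\ell/\pi-1\|_2^2=\sum_{\lambda\ne(n)}d_\lambda\sum_S\theta^{2\ell(n-1-c(S(n)))}.$$ (b′) Let $\theta<1$. If $n\ge1$ and the non-negative integer $\ell$ equals $-(\log n)/(\log\theta)+c$ with $c>0$, then $$\sum_{x\in S_n}\pi(x)\,\|K_x^\ell/\pi-1\|_2^2\le\left(e^{\theta^{2c}}-1\right)+\left(\frac{\theta^c}{e}\right)^{n}e^{1/12}\sqrt{2\pi n},$$ where in $\sqrt{2\pi n}$ the symbol $\pi$ is the number $3.14159\ldots$ -/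

import Mathlib

open Filter Topology

namespace MallowsScan

/-! ### The symmetric group, its length function, and the Mallows distribution -/

/-- The simple transposition of `Fin n` exchanging the adjacent letters `i` and `i + 1`
(letters are numbered from `0`, so that there are `n - 1` of these). -/
def simpleRefl (n : ℕ) (i : Fin (n - 1)) : Equiv.Perm (Fin n) :=
  Equiv.swap ⟨i, by omega⟩ ⟨i + 1, by omega⟩

/-- The length `ℓ(w)`: the smallest `k` such that `w` is a product of `k` simple
transpositions. -/
noncomputable def length {n : ℕ} (w : Equiv.Perm (Fin n)) : ℕ :=
  sInf {k : ℕ | ∃ l : List (Fin (n - 1)), l.length = k ∧ (l.map (simpleRefl n)).prod = w}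

/-- The Mallows distribution `π(w) = θ^{-ℓ(w)} / ∑_v θ^{-ℓ(v)}` on the symmetric group. -/
noncomputable def mallows (n : ℕ) (θ : ℝ) (w : Equiv.Perm (Fin n)) : ℝ :=
  θ ^ (-(length w : ℤ)) / ∑ v : Equiv.Perm (Fin n), θ ^ (-(length v : ℤ))

/-! ### The Metropolis chains and the short systematic scan -/

/-- The Metropolis chain `K_i`: from `x`, go to `s_i x` if this increases the length; if it
decreases the length, go to `s_i x` with probability `θ` and stay at `x` with
probability `1 - θ`. -/
noncomputable def metropolis (n : ℕ) (θ : ℝ) (i : Fin (n - 1)) :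
    Matrix (Equiv.Perm (Fin n)) (Equiv.Perm (Fin n)) ℝ :=
  Matrix.of fun x y =>
    if y = simpleRefl n i * x ∧ length x < length y then 1
    else if y = simpleRefl n i * x ∧ length y < length x then θ
    else if y = x ∧ length (simpleRefl n i * x) < length x then 1 - θ
    else 0

/-- The short systematic scan `K = K_1 K_2 ⋯ K_{n-1} K_{n-1} ⋯ K_2 K_1` on `S_n`, a
transition matrix; `(shortScan n θ ^ ℓ) x y` is the chance of going from `x` to `y` in `ℓ`
scans. -/
noncomputable def shortScan (n : ℕ) (θ : ℝ) :
    Matrix (Equiv.Perm (Fin n)) (Equiv.Perm (Fin n)) ℝ :=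
  (List.ofFn (metropolis n θ)).prod * (List.ofFn (metropolis n θ)).reverse.prod

/-! ### Distances -/

/-- Total variation distance `max_{A ⊆ X} |∑_{y ∈ A} (μ(y) - ν(y))|` on a finite set. -/
noncomputable def tvDist {X : Type*} [Fintype X] (μ ν : X → ℝ) : ℝ :=
  ⨆ A : Finset X, |∑ y ∈ A, (μ y - ν y)|

/-- The squared norm `‖f‖₂² = ∑_x f(x)² p(x)` of `L²(p)`. -/
def l2NormSq {X : Type*} [Fintype X] (p f : X → ℝ) : ℝ :=
  ∑ x, f x * f x * p x

/-- `‖K_x^ℓ/π - 1‖₂²` in `L²(π)`, for the short systematic scan started at `x`. -/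
noncomputable def scanL2 (n : ℕ) (θ : ℝ) (ℓ : ℕ) (x : Equiv.Perm (Fin n)) : ℝ :=
  l2NormSq (mallows n θ) (fun y => (shortScan n θ ^ ℓ) x y / mallows n θ y - 1)

/-- `‖K_1^ℓ - π‖_TV`, for the short systematic scan started at the identity. -/
noncomputable def scanTV (n : ℕ) (θ : ℝ) (ℓ : ℕ) : ℝ :=
  tvDist (fun y => (shortScan n θ ^ ℓ) 1 y) (mallows n θ)

/-! ### Partitions, standard tableaux, and the constants `d_λ` and `t_λ` -/

/-- Partitions of `n`, as Young diagrams with `n` boxes (rows and columns numbered from `0`,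
as for matrices). -/
abbrev Shape (n : ℕ) : Type := {μ : YoungDiagram // μ.card = n}

theorem finite_shape (n : ℕ) : Finite (Shape n) := by
  let f : Shape n → (Finset.range n ×ˢ Finset.range n).powerset := fun μ =>
    ⟨μ.1.cells, by
      rw [Finset.mem_powerset]
      rintro ⟨i, j⟩ hij
      have hm : (i, j) ∈ μ.1 := hij
      have hr : μ.1.rowLen i ≤ n := by
        rw [YoungDiagram.rowLen_eq_card]
        exact (Finset.card_le_card (Finset.filter_subset _ _)).trans μ.2.le
      have hc : μ.1.colLen j ≤ n := by
        rw [YoungDiagram.colLen_eq_card]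
        exact (Finset.card_le_card (Finset.filter_subset _ _)).trans μ.2.le
      have h1 := YoungDiagram.mem_iff_lt_rowLen.mp hm
      have h2 := YoungDiagram.mem_iff_lt_colLen.mp hm
      simp only [Finset.mem_product, Finset.mem_range]
      omega⟩
  refine Finite.of_injective f fun μ ν h => ?_
  exact Subtype.ext (YoungDiagram.ext (congrArg Subtype.val h))

noncomputable instance instFintypeShape (n : ℕ) : Fintype (Shape n) :=
  have := finite_shape n
  Fintype.ofFinite _

/-- The content `c(b) = j - i` of the box `b` in row `i` and column `j`. -/
def content (b : ℕ × ℕ) : ℤ := (b.2 : ℤ) - (b.1 : ℤ)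

/-- The hook length of a box of `μ`: with rows and columns numbered from `0` it is
`(μ_i - i) + (μ'_j - j) - 1`. -/
def hookLength (μ : YoungDiagram) (b : ℕ × ℕ) : ℕ :=
  (μ.rowLen b.1 - b.2) + (μ.colLen b.2 - b.1) - 1

/-- The `q`-integer `[k]_q = (q^k - 1)/(q - 1) = 1 + q + ⋯ + q^{k-1}`, in the form that is
also correct at `q = 1`. -/
noncomputable def qInt (q : ℝ) (k : ℕ) : ℝ := ∑ i ∈ Finset.range k, q ^ i

/-- `[k]_q! = [k]_q [k-1]_q ⋯ [1]_q`. -/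
noncomputable def qFactorial (q : ℝ) (k : ℕ) : ℝ := ∏ i ∈ Finset.Icc 1 k, qInt q i

/-- `n(λ) = ∑_i (i - 1) λ_i` (here with rows numbered from `0`). -/
def nStat (μ : YoungDiagram) : ℕ := ∑ i ∈ Finset.range (μ.colLen 0), i * μ.rowLen i

/-- `d_λ = n! / ∏_b h_b`. -/
noncomputable def dimConst {n : ℕ} (μ : Shape n) : ℝ :=
  (n.factorial : ℝ) / ∏ b ∈ μ.1.cells, (hookLength μ.1 b : ℝ)

/-- The generic degree `t_λ = q^{n(λ)} [n]_q! / ∏_b [h_b]_q`. -/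
noncomputable def genericDegree (q : ℝ) {n : ℕ} (μ : Shape n) : ℝ :=
  q ^ nStat μ.1 * qFactorial q n / ∏ b ∈ μ.1.cells, qInt q (hookLength μ.1 b)

/-- Standard tableaux of shape `μ`: fillings of the boxes with `1, …, n`, each used once,
increasing along the rows and down the columns. -/
abbrev StandardTableau {n : ℕ} (μ : Shape n) : Type :=
  {S : μ.1.cells ≃ Finset.Icc 1 n //
    (∀ b b' : μ.1.cells, b.1.1 = b'.1.1 → b.1.2 < b'.1.2 → (S b : ℕ) < S b') ∧
    (∀ b b' : μ.1.cells, b.1.2 = b'.1.2 → b.1.1 < b'.1.1 → (S b : ℕ) < S b')}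

noncomputable instance instFintypeStandardTableau {n : ℕ} (μ : Shape n) :
    Fintype (StandardTableau μ) :=
  Fintype.ofFinite _

/-- The box `S(n)` of the standard tableau `S` that contains `n`. -/
def lastBox {n : ℕ} (hn : 1 ≤ n) {μ : Shape n} (S : StandardTableau μ) : ℕ × ℕ :=
  (S.1.symm ⟨n, Finset.mem_Icc.mpr ⟨hn, le_rfl⟩⟩ : μ.1.cells)

/-- `∑_S θ^{2ℓ(n-1-c(S(n)))}`, the sum over the standard tableaux `S` of shape `μ`. -/
noncomputable def tableauSum {n : ℕ} (hn : 1 ≤ n) (θ : ℝ) (ℓ : ℕ) (μ : Shape n) : ℝ :=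
  ∑ S : StandardTableau μ, θ ^ (2 * (ℓ : ℤ) * ((n : ℤ) - 1 - content (lastBox hn S)))

end MallowsScan

open MallowsScan

/-! The chains `metropolis n θ i` satisfy the relations of the type A Hecke algebra, normalized so
that the generators have eigenvalues 1 and -θ. With the generators numbered backwards as t_0, …,
t_{n-2}, the scan is θ^(n-1) times the Jucys–Murphy element J_{n-1}, where J_k = θ^(-k) t_{k-1}⋯t_0
t_0⋯t_{k-1}. Both exact formulas follow from the law of J_{n-1} under two functionals: the entry at
the identity, for (a), and the matrix trace, for (b).

The entry at the identity kills a t_k b for a, b in the algebra generated by t_0, …, t_{k-1}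
(`entryOne_mul_gen_mul`), so the moments of J_k can be computed conditionally on J_0, …, J_{k-1}. A
resolvent identity gives their generating series 1 + Γ_k in the variable u: Γ_0 = u/(1-u) and
Γ_{k+1} = Γ_k (1-uJ_k)²/((1-θuJ_k)(1-θ⁻¹uJ_k)) (`HeckeRel.geom_sub_moment_mem`). If the J's take the
values q^c at the contents c of the boxes of a diagram μ, the product telescopes along the rows. In
its partial fractions the addable boxes are the only surviving poles, and the residues are the
ratios w(ν)/w(μ) of the hook weights w(μ) = q^{n(μ)}/∏[h_b]_q (`shapeWeight_addBox`,
`sum_covers_pow`). By induction every standard tableau of shape μ carries mass w(μ), with J_k equal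
to q to the content of the box of k+1 (`HeckeRel.trace_eval`). No representation theory of the Hecke
algebra is used. Reversibility turns the L² distance from x into K^{2ℓ}(x,x)/π(x) - 1, and π(1) =
1/[n]_q! turns w(λ) into t_λ.

For the trace, write K = 1 + (θ-1)D. The eigenvalues [j]_θ of D remain distinct up to θ = 1, so its
spectral projections are continuous in θ on (0,1]. Their traces are integers for θ < 1, hence
constant. At θ = 1 everything is invariant under right translation, and the trace is n! times the
entry at the identity (`trace_scanProj`). The weights are therefore d_λ for every θ.

The upper bounds group the shapes by j = n - λ_1. Deleting the first row bounds the contribution of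
λ by Y^j/j! times the mass of the remaining diagram, where Y = n² q^{n-1} θ^{2ℓ} (with q = 1 in the
averaged case). The masses of the diagrams with j boxes add up to 1, so the total is at most e^Y - 1
(`sum_weights_tableauSum_le`).

For the lower bound, one scan carries at most one letter of the lower half, net, into the right half
of the positions (`displaced_palindrome_le`). After n/4 scans the permutation still has a quadratic
number of non-inversions, and such permutations have negligible Mallows mass when θ < 1. At θ = 1
the scan is the identity. -/

namespace MallowsScan

/-! ### Evaluating polynomials at commuting elements -/

/-- The subalgebra generated by commuting elements is commutative, so the universal property of the
polynomial ring applies inside it although `A` is not commutative. -/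
theorem exists_aeval_of_commute {A : Type*} [Ring A] [Algebra ℝ A] (y : ℕ → A)
    (hy : ∀ i j, Commute (y i) (y j)) :
    ∃ φ : MvPolynomial ℕ ℝ →ₐ[ℝ] A, ∀ k, φ (MvPolynomial.X k) = y k := by
  have hc : ∀ a ∈ Set.range y, ∀ b ∈ Set.range y, a * b = b * a := by
    rintro _ ⟨i, rfl⟩ _ ⟨j, rfl⟩
    exact hy i j
  let B := Algebra.adjoin ℝ (Set.range y)
  have hB : IsMulCommutative B := Algebra.isMulCommutative_adjoin ℝ hc
  let _ : CommRing B := { (inferInstance : Ring B) with mul_comm := hB.is_comm.comm }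
  let y' : ℕ → B := fun k => ⟨y k, Algebra.subset_adjoin ⟨k, rfl⟩⟩
  refine ⟨B.val.comp (MvPolynomial.aeval y'), fun k => ?_⟩
  simp [y']

/-! ### Power series with coefficients in a subspace -/

section PowerSeries
open PowerSeries

variable {A : Type*} [Ring A] [Algebra ℝ A]

/-- All coefficients of the power series lie in the subspace `W`. -/
def CoeffsIn (W : Submodule ℝ A) (f : A⟦X⟧) : Prop := ∀ m, coeff m f ∈ W

theorem CoeffsIn.add {W : Submodule ℝ A} {f g : A⟦X⟧} (hf : CoeffsIn W f) (hg : CoeffsIn W g) :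
    CoeffsIn W (f + g) := fun m => by
  rw [map_add]; exact W.add_mem (hf m) (hg m)

theorem CoeffsIn.sub {W : Submodule ℝ A} {f g : A⟦X⟧} (hf : CoeffsIn W f) (hg : CoeffsIn W g) :
    CoeffsIn W (f - g) := fun m => by
  rw [map_sub]; exact W.sub_mem (hf m) (hg m)

theorem CoeffsIn.smul {W : Submodule ℝ A} {f : A⟦X⟧} (c : ℝ) (hf : CoeffsIn W f) :
    CoeffsIn W (c • f) := fun m => by
  have : coeff m (c • f) = c • coeff m f := rfl
  rw [this]; exact W.smul_mem c (hf m)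

theorem CoeffsIn.mul {W₁ W₂ W₃ : Submodule ℝ A} (h : ∀ a ∈ W₁, ∀ b ∈ W₂, a * b ∈ W₃)
    {f g : A⟦X⟧} (hf : CoeffsIn W₁ f) (hg : CoeffsIn W₂ g) : CoeffsIn W₃ (f * g) := fun m => by
  rw [coeff_mul]
  exact Submodule.sum_mem _ fun x _ => h _ (hf _) _ (hg _)

theorem CoeffsIn.mul_alg {H : Subalgebra ℝ A} {f g : A⟦X⟧}
    (hf : CoeffsIn H.toSubmodule f) (hg : CoeffsIn H.toSubmodule g) :
    CoeffsIn H.toSubmodule (f * g) :=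
  hf.mul (fun _ ha _ hb => H.mul_mem ha hb) hg

theorem CoeffsIn.C {W : Submodule ℝ A} {a : A} (ha : a ∈ W) : CoeffsIn W (C a : A⟦X⟧) :=
  fun m => by
    rw [coeff_C]
    split_ifs
    exacts [ha, W.zero_mem]

theorem CoeffsIn.one {H : Subalgebra ℝ A} : CoeffsIn H.toSubmodule (1 : A⟦X⟧) := fun m => by
  rw [coeff_one]
  split_ifs
  exacts [H.one_mem, H.zero_mem]

theorem CoeffsIn.X_mul {W : Submodule ℝ A} {f : A⟦X⟧} (hf : CoeffsIn W f) :
    CoeffsIn W (X * f) := fun m => by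
  cases m with
  | zero => simp
  | succ m => rw [coeff_succ_X_mul]; exact hf m

/-- The geometric series `∑ yᵐ uᵐ`. -/
noncomputable def geom {R : Type*} [Semiring R] (y : R) : R⟦X⟧ := PowerSeries.mk fun m => y ^ m

theorem coeff_geom {R : Type*} [Semiring R] (y : R) (m : ℕ) : coeff m (geom y) = y ^ m := by
  simp [geom]

theorem one_sub_mul_geom {R : Type*} [Ring R] (y : R) :
    (1 - X * C y) * geom y = 1 := by
  ext m
  rw [sub_mul, one_mul, mul_assoc, map_sub, coeff_geom]
  cases m with
  | zero => simp
  | succ m => simp [coeff_succ_X_mul, coeff_C_mul, coeff_geom, pow_succ', coeff_one]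

theorem commute_C_geom {R : Type*} [Ring R] {x y : R} (h : Commute x y) :
    Commute (C x) (geom y) := by
  ext m
  rw [coeff_C_mul, coeff_mul_C, coeff_geom]
  exact (h.pow_right m).eq

theorem commute_X_left {R : Type*} [Ring R] (f : R⟦X⟧) : Commute X f :=
  (PowerSeries.commute_X f).symm

theorem geom_mul_one_sub {R : Type*} [Ring R] (y : R) :
    geom y * (1 - X * C y) = 1 := by
  have h : Commute (1 - X * C y) (geom y) :=
    (Commute.one_left _).sub_left
      ((commute_X_left _).mul_left (commute_C_geom (Commute.refl y)))
  rw [← h.eq, one_sub_mul_geom]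

theorem CoeffsIn.geom {H : Subalgebra ℝ A} {a : A} (ha : a ∈ H) :
    CoeffsIn H.toSubmodule (geom a) := fun m => by
  rw [coeff_geom]; exact H.pow_mem ha m

theorem map_geom {R S : Type*} [Ring R] [Ring S] (φ : R →+* S) (y : R) :
    PowerSeries.map φ (geom y) = geom (φ y) := by
  ext m
  simp [coeff_geom]

end PowerSeries

/-! ### The resolvent identity in a quadratic algebra -/

/-- In the application `a` and `a'` are u times two consecutive Jucys–Murphy elements, and `h1`,
`h2` encode a' = p⁻¹ t a t. Pushing `t` through the resolvents leaves on the right, besides terms in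
`r'`, only terms with a single factor `t`. These will be discarded, so that `r'` is determined by `t
* r * t`. -/
theorem resolvent_identity {R : Type*} [Ring R] [Algebra ℝ R] (p : ℝ) {t a a' r r' : R}
    (ht : t * t = (1 - p) • t + p • 1)
    (h1 : t * a = a' * t - (1 - p) • a') (h2 : a * t = t * a' - (1 - p) • a')
    (haa : a * a' = a' * a)
    (hr : (1 - a) * r = 1) (hr' : r * (1 - a) = 1)
    (hs : (1 - a') * r' = 1) (hs' : r' * (1 - a') = 1) :
    t * r * t = p • r' + (1 - p) • (t * r) - (1 - p) • (r * t * (a * r))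
      - ((1 - p) ^ 2) • (a' * r' * (a * (r * r))) := by
  set β := 1 - p
  have car : a * r = r * a := by
    have e1 : r - a * r = 1 := by rw [← hr]; noncomm_ring
    have e2 : r - r * a = 1 := by rw [← hr']; noncomm_ring
    have : a * r = r - 1 := by rw [← e1]; abel
    rw [this, ← e2]; abel
  have comm_of : ∀ x y z : R, (1 - y) * z = 1 → z * (1 - y) = 1 → x * y = y * x →
      x * z = z * x := by
    intro x y z hz hz' hxy
    have e : x * (1 - y) = (1 - y) * x := by rw [mul_sub, sub_mul, hxy]; simp
    calc x * z = z * (1 - y) * (x * z) := by rw [hz', one_mul]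
      _ = z * ((1 - y) * x) * z := by noncomm_ring
      _ = z * (x * (1 - y)) * z := by rw [e]
      _ = z * x * ((1 - y) * z) := by noncomm_ring
      _ = z * x := by rw [hz, mul_one]
  have ca'r : a' * r = r * a' := comm_of a' a r hr hr' haa.symm
  have ca'r' : a' * r' = r' * a' := comm_of a' a' r' hs hs' rfl
  have car' : a * r' = r' * a := comm_of a a' r' hs hs' haa
  have crr' : r * r' = r' * r := comm_of r a' r' hs hs' ca'r.symm
  -- `k1` and `k2` move `t` across a resolvent. Since `t` has a linear term in its quadratic
  -- relation, this exchanges `r` and `r'` only up to a correction with the factor β = 1 - p.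
  have k1 : r' * t = t * r + β • (r' * a' * r) := by
    have e : t * (1 - a) = (1 - a') * t + β • a' := by
      rw [mul_sub, h1, sub_mul]; simp only [mul_one, one_mul]; abel
    calc r' * t = r' * t * ((1 - a) * r) := by rw [hr, mul_one]
      _ = r' * (t * (1 - a)) * r := by noncomm_ring
      _ = r' * (1 - a') * t * r + β • (r' * a' * r) := by
        rw [e, mul_add, add_mul, mul_smul_comm, smul_mul_assoc]; simp only [mul_assoc]
      _ = _ := by rw [hs', one_mul]
  have k2 : t * r' = r * t + β • (r * a' * r') := by
    have e : (1 - a) * t = t * (1 - a') + β • a' := by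
      rw [sub_mul, h2, mul_sub]; simp only [mul_one, one_mul]; abel
    calc t * r' = r * (1 - a) * (t * r') := by rw [hr', one_mul]
      _ = r * ((1 - a) * t) * r' := by noncomm_ring
      _ = r * t * ((1 - a') * r') + β • (r * a' * r') := by
        rw [e, mul_add, add_mul, mul_smul_comm, smul_mul_assoc]; simp only [mul_assoc]
      _ = _ := by rw [hs, mul_one]
  have m1 : t * r * t = r' * (t * t) - β • (r' * a' * r * t) := by
    have : t * r = r' * t - β • (r' * a' * r) := by rw [k1]; abel
    rw [this, sub_mul, smul_mul_assoc]; simp only [mul_assoc]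
  have m2 : r * t = t * r' - β • (r * a' * r') := by rw [k2]; abel
  have m3 : r' * a' * r * t = r' * a' * t * r' - β • (r' * a' * r * a' * r') := by
    rw [mul_assoc _ r t, m2, mul_sub, mul_smul_comm]; simp only [mul_assoc]
  have m4 : r' * a' * t = t * a * r + β • (a' * r) + β • (a' * r' * a' * r) := by
    have ha't : a' * t = t * a + β • a' := by rw [h1]; abel
    rw [← ca'r', mul_assoc, k1, mul_add, ← mul_assoc, ha't, add_mul, smul_mul_assoc,
      mul_smul_comm]
    simp only [mul_assoc]
  have m5 : r' * a' * r * a' * r' = a' * r' * a' * r * r' := by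
    rw [← ca'r', mul_assoc (a' * r') r a', ← ca'r]; simp only [mul_assoc]
  have m6 : t * r * t = p • r' + β • (t * r) - β • (t * a * r * r') := by
    have e1 : r' * a' * r = a' * r * r' := by
      rw [← ca'r', mul_assoc, mul_assoc, crr']
    rw [m1, ht, mul_add, mul_smul_comm, mul_smul_comm, mul_one, k1, m3, m4, m5, e1]
    simp only [add_mul, smul_mul_assoc, smul_add, smul_sub]
    abel
  have m7 : t * a * r * r' = r * t * (a * r) + β • (a' * r' * (a * (r * r))) := by
    have e : t * a * r * r' = t * r' * (a * r) := by
      rw [mul_assoc t a r, mul_assoc t _ r', mul_assoc a r r', crr', ← mul_assoc a r' r, car',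
        mul_assoc r' a r, ← mul_assoc]
    have e3 : a' * r' * (a * (r * r)) = r * a' * r' * (a * r) := by
      rw [← mul_assoc a r r, car, mul_assoc r a r, ← mul_assoc (a' * r') r, mul_assoc a' r' r,
        ← crr', ← mul_assoc a' r r', ca'r, car]
    rw [e, k2, add_mul, smul_mul_assoc, e3]
  rw [m6, m7, smul_add, smul_smul, pow_two]
  abel

/-! ### Jucys–Murphy elements of a Hecke algebra -/

section Tower

variable {A : Type*} [Ring A] [Algebra ℝ A]

/-- The elements `t 0, …, t (M - 1)` satisfy the relations of the Hecke algebra of type `A`,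
normalized so that the eigenvalues of the generators are `1` and `-p`. -/
structure HeckeRel (p : ℝ) (M : ℕ) (t : ℕ → A) : Prop where
  quad : ∀ k < M, t k * t k = (1 - p) • t k + p • 1
  braid : ∀ k, k + 1 < M → t k * t (k + 1) * t k = t (k + 1) * t k * t (k + 1)
  comm : ∀ j k, j + 1 < k → k < M → Commute (t j) (t k)

/-- `t_{k-1} ⋯ t_1 t_0 t_0 t_1 ⋯ t_{k-1}`. -/
def palindrome (t : ℕ → A) : ℕ → A
  | 0 => 1
  | k + 1 => t k * palindrome t k * t k

/-- The multiplicative Jucys–Murphy element. -/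
noncomputable def jucysMurphy (p : ℝ) (t : ℕ → A) (k : ℕ) : A := (p ^ k)⁻¹ • palindrome t k

/-- The subalgebra generated by the first `k` generators. -/
def parabolic (t : ℕ → A) (k : ℕ) : Subalgebra ℝ A := Algebra.adjoin ℝ (t '' Set.Iio k)

theorem parabolic_mono (t : ℕ → A) {j k : ℕ} (h : j ≤ k) : parabolic t j ≤ parabolic t k :=
  Algebra.adjoin_mono (Set.image_mono (Set.Iio_subset_Iio h))

theorem gen_mem_parabolic (t : ℕ → A) {j k : ℕ} (h : j < k) : t j ∈ parabolic t k :=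
  Algebra.subset_adjoin ⟨j, h, rfl⟩

theorem palindrome_mem (t : ℕ → A) (k : ℕ) : palindrome t k ∈ parabolic t k := by
  induction k with
  | zero => exact one_mem _
  | succ k ih =>
    have ht := gen_mem_parabolic t (Nat.lt_succ_self k)
    exact mul_mem (mul_mem ht (parabolic_mono t (Nat.le_succ k) ih)) ht

theorem jucysMurphy_mem (p : ℝ) (t : ℕ → A) (k : ℕ) : jucysMurphy p t k ∈ parabolic t k :=
  Subalgebra.smul_mem _ (palindrome_mem t k) _

theorem jucysMurphy_succ (p : ℝ) (t : ℕ → A) (k : ℕ) :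
    jucysMurphy p t (k + 1) = p⁻¹ • (t k * jucysMurphy p t k * t k) := by
  simp only [jucysMurphy, palindrome, mul_smul_comm, smul_mul_assoc, smul_smul, pow_succ,
    mul_inv, mul_comm]

theorem commute_of_mem_adjoin {s : Set A} {x a : A} (h : ∀ y ∈ s, Commute x y)
    (ha : a ∈ Algebra.adjoin ℝ s) : Commute x a := by
  induction ha using Algebra.adjoin_induction with
  | mem y hy => exact h y hy
  | algebraMap c => exact (Algebra.commutes c x).symm
  | add a b _ _ ha hb => exact ha.add_right hb
  | mul a b _ _ ha hb => exact ha.mul_right hb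

variable {p : ℝ} {M : ℕ} {t : ℕ → A}

theorem HeckeRel.commute_gen_parabolic (h : HeckeRel p M t) {j k : ℕ} (hk : k < j) (hj : j < M)
    {a : A} (ha : a ∈ parabolic t k) : Commute (t j) a := by
  refine commute_of_mem_adjoin ?_ ha
  rintro _ ⟨i, hi, rfl⟩
  have : i < k := hi
  exact (h.comm i j (by omega) hj).symm

/-- Far generators commute with `t j`, which reduces the claim to palindromes of length `j + 2`.
There one braid move on the left and one on the right carry `t j` through `t (j + 1) * t j * ⋯ * t j
* t (j + 1)`. -/
theorem HeckeRel.commute_gen_palindrome (h : HeckeRel p M t) :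
    ∀ k ≤ M, ∀ j, j + 1 < k → Commute (t j) (palindrome t k) := by
  intro k
  induction k with
  | zero => intro _ j hj; omega
  | succ k ih =>
    intro hk j hj
    rcases Nat.lt_or_ge (j + 1) k with hjk | hjk
    · have c := h.comm j k hjk (by omega)
      exact (c.mul_right (ih (by omega) j hjk)).mul_right c
    · obtain rfl : k = j + 1 := by omega
      have b := h.braid j (by omega)
      have c : t (j + 1) * palindrome t j = palindrome t j * t (j + 1) :=
        h.commute_gen_parabolic (Nat.lt_succ_self j) (by omega) (palindrome_mem t j)
      change t j * (t (j + 1) * (t j * palindrome t j * t j) * t (j + 1)) =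
        t (j + 1) * (t j * palindrome t j * t j) * t (j + 1) * t j
      calc t j * (t (j + 1) * (t j * palindrome t j * t j) * t (j + 1))
          = t j * t (j + 1) * t j * palindrome t j * t j * t (j + 1) := by
            simp only [mul_assoc]
        _ = t (j + 1) * t j * (t (j + 1) * palindrome t j) * t j * t (j + 1) := by
            rw [b]; simp only [mul_assoc]
        _ = t (j + 1) * t j * palindrome t j * (t (j + 1) * t j * t (j + 1)) := by
            rw [c]; simp only [mul_assoc]
        _ = _ := by rw [← b]; simp only [mul_assoc]

theorem HeckeRel.commute_palindrome (h : HeckeRel p M t) {i j : ℕ} (hi : i ≤ M) (hj : j ≤ M) :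
    Commute (palindrome t i) (palindrome t j) := by
  have key : ∀ i j, i < j → j ≤ M → Commute (palindrome t i) (palindrome t j) := by
    intro i j hij hj
    refine (commute_of_mem_adjoin ?_ (palindrome_mem t i)).symm
    rintro _ ⟨l, hl, rfl⟩
    have : l < i := hl
    exact (h.commute_gen_palindrome j hj l (by omega)).symm
  rcases lt_trichotomy i j with hij | rfl | hij
  · exact key i j hij hj
  · exact Commute.refl _
  · exact (key j i hij hi).symm

theorem HeckeRel.commute_jucysMurphy (h : HeckeRel p M t) {i j : ℕ} (hi : i ≤ M) (hj : j ≤ M) :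
    Commute (jucysMurphy p t i) (jucysMurphy p t j) :=
  ((h.commute_palindrome hi hj).smul_left _).smul_right _

theorem HeckeRel.exists_eval (h : HeckeRel p M t) :
    ∃ φ : MvPolynomial ℕ ℝ →ₐ[ℝ] A, ∀ k ≤ M, φ (MvPolynomial.X k) = jucysMurphy p t k := by
  obtain ⟨φ, hφ⟩ := exists_aeval_of_commute
    (fun k => if k ≤ M then jucysMurphy p t k else 1) (fun i j => by
      split_ifs with hi hj
      exacts [h.commute_jucysMurphy hi hj, Commute.one_right _, Commute.one_left _,
        Commute.one_left _])
  exact ⟨φ, fun k hk => by rw [hφ, if_pos hk]⟩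

/-- A bimodule complement to the `(k-1)`-st subalgebra in the `k`-th one. -/
def complement (t : ℕ → A) : ℕ → Submodule ℝ A
  | 0 => ⊥
  | k + 1 => Submodule.span ℝ {x | ∃ a ∈ parabolic t k, ∃ b ∈ parabolic t k, x = a * t k * b}

theorem mem_complement {t : ℕ → A} {k : ℕ} {a b : A} (ha : a ∈ parabolic t k)
    (hb : b ∈ parabolic t k) : a * t k * b ∈ complement t (k + 1) :=
  Submodule.subset_span ⟨a, ha, b, hb, rfl⟩

theorem complement_mul {t : ℕ → A} {k : ℕ} :
    ∀ w ∈ complement t (k + 1), ∀ b ∈ parabolic t k, w * b ∈ complement t (k + 1) := by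
  intro w hw b hb
  induction hw using Submodule.span_induction with
  | mem x hx =>
    obtain ⟨a, ha, c, hc, rfl⟩ := hx
    rw [mul_assoc]
    exact mem_complement ha (mul_mem hc hb)
  | zero => simp
  | add x y _ _ hx hy => rw [add_mul]; exact add_mem hx hy
  | smul c x _ hx => rw [smul_mul_assoc]; exact Submodule.smul_mem _ c hx

theorem mul_complement {t : ℕ → A} {k : ℕ} :
    ∀ w ∈ complement t (k + 1), ∀ b ∈ parabolic t k, b * w ∈ complement t (k + 1) := by
  intro w hw b hb
  induction hw using Submodule.span_induction with
  | mem x hx =>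
    obtain ⟨a, ha, c, hc, rfl⟩ := hx
    rw [← mul_assoc, ← mul_assoc]
    exact mem_complement (mul_mem hb ha) hc
  | zero => simp
  | add x y _ _ hx hy => rw [mul_add]; exact add_mem hx hy
  | smul c x _ hx => rw [mul_smul_comm]; exact Submodule.smul_mem _ c hx

/-- The outer generator commutes with the coefficients `a`, `b`, which lie two levels lower. The
braid relation then replaces t_{k+1} t_k t_{k+1} by t_k t_{k+1} t_k, which contains the new
generator only once. -/
theorem HeckeRel.conj_complement (h : HeckeRel p M t) {k : ℕ} (hk : k < M) :
    ∀ w ∈ complement t k, t k * w * t k ∈ complement t (k + 1) := by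
  intro w hw
  cases k with
  | zero =>
    have : w = 0 := by simpa [complement] using hw
    simp [this]
  | succ k =>
    induction hw using Submodule.span_induction with
    | mem x hx =>
      obtain ⟨a, ha, b, hb, rfl⟩ := hx
      have ca := h.commute_gen_parabolic (Nat.lt_succ_self k) hk ha
      have cb := h.commute_gen_parabolic (Nat.lt_succ_self k) hk hb
      have e : t (k + 1) * (a * t k * b) * t (k + 1) = (a * t k) * t (k + 1) * (t k * b) := by
        calc t (k + 1) * (a * t k * b) * t (k + 1)
            = (t (k + 1) * a) * t k * (b * t (k + 1)) := by simp only [mul_assoc]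
          _ = a * (t (k + 1) * t k * t (k + 1)) * b := by
            rw [ca.eq, ← cb.eq]; simp only [mul_assoc]
          _ = _ := by rw [← h.braid k hk]; simp only [mul_assoc]
      rw [e]
      have hm := parabolic_mono t (Nat.le_succ k)
      have hg := gen_mem_parabolic t (Nat.lt_succ_self k)
      exact mem_complement (mul_mem (hm ha) hg) (mul_mem hg (hm hb))
    | zero => simp
    | add x y _ _ hx hy => rw [mul_add, add_mul]; exact add_mem hx hy
    | smul c x _ hx =>
      rw [mul_smul_comm, smul_mul_assoc]; exact Submodule.smul_mem _ c hx

/-! ### The conditional moments of the Jucys–Murphy elements -/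

open PowerSeries

/-- The generating function of the conditional moments of the `k`-th Jucys–Murphy element
given the previous ones. -/
noncomputable def momentSeries (p : ℝ) : ℕ → (MvPolynomial ℕ ℝ)⟦X⟧
  | 0 => X * geom 1
  | k + 1 => momentSeries p k * (1 - X * C (MvPolynomial.X k)) ^ 2 *
      (geom (p • MvPolynomial.X k) * geom (p⁻¹ • MvPolynomial.X k))

/-- The polynomials in the first `k` variables. -/
noncomputable def polysUpTo (k : ℕ) : Subalgebra ℝ (MvPolynomial ℕ ℝ) :=
  Algebra.adjoin ℝ (MvPolynomial.X '' Set.Iio k)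

theorem polysUpTo_mono {j k : ℕ} (h : j ≤ k) : polysUpTo j ≤ polysUpTo k :=
  Algebra.adjoin_mono (Set.image_mono (Set.Iio_subset_Iio h))

theorem X_mem_polysUpTo {j k : ℕ} (h : j < k) : MvPolynomial.X j ∈ polysUpTo k :=
  Algebra.subset_adjoin ⟨j, h, rfl⟩

theorem momentSeries_mem (p : ℝ) (k : ℕ) :
    CoeffsIn (polysUpTo k).toSubmodule (momentSeries p k) := by
  induction k with
  | zero => exact (CoeffsIn.geom (one_mem _)).X_mul
  | succ k ih =>
    have hx := X_mem_polysUpTo (Nat.lt_succ_self k)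
    have h1 : CoeffsIn (polysUpTo (k + 1)).toSubmodule (momentSeries p k) :=
      fun m => polysUpTo_mono (Nat.le_succ k) (ih m)
    have h2 : CoeffsIn (polysUpTo (k + 1)).toSubmodule
        (1 - X * C (MvPolynomial.X k : MvPolynomial ℕ ℝ)) :=
      CoeffsIn.one.sub (CoeffsIn.C (W := (polysUpTo (k + 1)).toSubmodule) hx).X_mul
    rw [momentSeries, pow_two]
    exact (h1.mul_alg (h2.mul_alg h2)).mul_alg
      ((CoeffsIn.geom (Subalgebra.smul_mem _ hx _)).mul_alg
        (CoeffsIn.geom (Subalgebra.smul_mem _ hx _)))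

theorem momentSeries_succ_mul {p : ℝ} (k : ℕ) :
    momentSeries p (k + 1) * ((1 - X * C (p • MvPolynomial.X k)) *
      (1 - X * C (p⁻¹ • MvPolynomial.X k))) =
    momentSeries p k * (1 - X * C (MvPolynomial.X k)) ^ 2 := by
  rw [momentSeries]
  have h1 := geom_mul_one_sub (p • MvPolynomial.X k : MvPolynomial ℕ ℝ)
  have h2 := geom_mul_one_sub (p⁻¹ • MvPolynomial.X k : MvPolynomial ℕ ℝ)
  linear_combination (momentSeries p k * (1 - X * C (MvPolynomial.X k)) ^ 2 *
    (geom (p⁻¹ • MvPolynomial.X k) * (1 - X * C (p⁻¹ • MvPolynomial.X k)))) * h1 +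
    (momentSeries p k * (1 - X * C (MvPolynomial.X k)) ^ 2) * h2

/-- The index drops by one because J_j uses only the generators below j. This is what lets t_k
commute with the conditional moments of J_k, which are polynomials in J_0, …, J_{k-1}. -/
theorem map_polysUpTo_mem {φ : MvPolynomial ℕ ℝ →ₐ[ℝ] A}
    (hφ : ∀ k ≤ M, φ (MvPolynomial.X k) = jucysMurphy p t k) {k : ℕ} (hk : k ≤ M + 1)
    {f : MvPolynomial ℕ ℝ} (hf : f ∈ polysUpTo k) : φ f ∈ parabolic t (k - 1) := by
  induction hf using Algebra.adjoin_induction with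
  | mem y hy =>
    obtain ⟨j, hj, rfl⟩ := hy
    have : j < k := hj
    rw [hφ j (by omega)]
    exact parabolic_mono t (by omega) (jucysMurphy_mem p t j)
  | algebraMap c => rw [AlgHom.commutes]; exact algebraMap_mem _ c
  | add a b _ _ ha hb => rw [map_add]; exact add_mem ha hb
  | mul a b _ _ ha hb => rw [map_mul]; exact mul_mem ha hb

theorem C_smul_eq (c : ℝ) (a : A) : (C (c • a) : A⟦X⟧) = c • C a := by
  ext m
  have : coeff m (c • (C a : A⟦X⟧)) = c • coeff m (C a) := rfl
  rw [this, coeff_C, coeff_C]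
  split_ifs <;> simp

/-- Modulo the complement, the resolvent of J_k is 1 + γ by induction, and conjugation by t_k
respects complements. Since γ commutes with t_k, the left side of the resolvent identity becomes p(1
+ γ) modulo terms with a single t_k. What is left is a linear equation for the resolvent of J_{k+1},
stated here with denominators cleared. -/
theorem HeckeRel.resolvent_step (h : HeckeRel p M t) (hp : p ≠ 0) {k : ℕ} (hk : k < M)
    {γ : A⟦X⟧} (hγt : Commute (C (t k)) γ) (hγm : CoeffsIn (parabolic t k).toSubmodule γ)
    (ih : CoeffsIn (complement t k) (geom (jucysMurphy p t k) - 1 - γ)) :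
    CoeffsIn (complement t (k + 1)) ((geom (jucysMurphy p t (k + 1)) - 1) *
        ((1 - X * C (p • jucysMurphy p t k)) * (1 - X * C (p⁻¹ • jucysMurphy p t k))) -
      γ * (1 - X * C (jucysMurphy p t k)) ^ 2) := by
  set Y := jucysMurphy p t k with hY
  set Y' := jucysMurphy p t (k + 1) with hY'
  have hYm : Y ∈ parabolic t k := jucysMurphy_mem p t k
  have hYY : Commute Y Y' := h.commute_jucysMurphy hk.le hk
  have hYs : Y' = p⁻¹ • (t k * Y * t k) := jucysMurphy_succ p t k
  have e1 : t k * Y = Y' * t k - (1 - p) • Y' := by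
    have : Y' * t k = (1 - p) • Y' + t k * Y := by
      rw [hYs, smul_mul_assoc, mul_assoc, h.quad k hk, mul_add, mul_smul_comm, mul_smul_comm,
        mul_one, smul_add, smul_smul, smul_smul, smul_smul, mul_comm p⁻¹, inv_mul_cancel₀ hp,
        one_smul]
    rw [this]; abel
  have e2 : Y * t k = t k * Y' - (1 - p) • Y' := by
    have : t k * Y' = (1 - p) • Y' + Y * t k := by
      rw [hYs, mul_smul_comm, ← mul_assoc, ← mul_assoc, h.quad k hk, add_mul, add_mul,
        smul_mul_assoc, smul_mul_assoc, smul_mul_assoc, smul_mul_assoc, one_mul, smul_add,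
        smul_smul, smul_smul, smul_smul, mul_comm p⁻¹, inv_mul_cancel₀ hp, one_smul]
    rw [this]; abel
  set T : A⟦X⟧ := C (t k) with hT
  set a : A⟦X⟧ := X * C Y with ha
  set a' : A⟦X⟧ := X * C Y' with ha'
  have TX : ∀ f : A⟦X⟧, T * (X * f) = X * (T * f) := fun f => by
    rw [← mul_assoc, ← (commute_X_left T).eq, mul_assoc]
  have hTT : T * T = (1 - p) • T + p • 1 := by
    rw [hT, ← map_mul, h.quad k hk, map_add, C_smul_eq, C_smul_eq, map_one]
  have f1 : T * a = a' * T - (1 - p) • a' := by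
    rw [ha, ha', TX, hT, ← map_mul, e1, map_sub, C_smul_eq, mul_sub, map_mul, mul_smul_comm,
      mul_assoc]
  have f2 : a * T = T * a' - (1 - p) • a' := by
    rw [ha, ha', TX, hT, mul_assoc, ← map_mul, e2, map_sub, C_smul_eq, mul_sub, map_mul,
      mul_smul_comm]
  have haa : a * a' = a' * a :=
    ((commute_X_left _).mul_left (((commute_X_left _).symm).mul_right
      (hYY.map (C : A →+* A⟦X⟧)))).eq
  set r := geom Y with hr
  set r' := geom Y' with hr'
  have q1 : (1 - a) * r = 1 := one_sub_mul_geom Y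
  have q2 : r * (1 - a) = 1 := geom_mul_one_sub Y
  have q3 : (1 - a') * r' = 1 := one_sub_mul_geom Y'
  have q4 : r' * (1 - a') = 1 := geom_mul_one_sub Y'
  have key := resolvent_identity p hTT f1 f2 haa q1 q2 q3 q4
  have s' : a' * r' = r' - 1 := by rw [← q3]; noncomm_ring
  set W := complement t (k + 1) with hW
  set H := (parabolic t k).toSubmodule with hH
  have rH : CoeffsIn H r := CoeffsIn.geom hYm
  have aH : CoeffsIn H a := (CoeffsIn.C (W := H) hYm).X_mul
  have oneH : CoeffsIn H (1 : A⟦X⟧) := CoeffsIn.one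
  have tW : t k ∈ W := by
    have := mem_complement (t := t) (one_mem (parabolic t k)) (one_mem (parabolic t k))
    rwa [one_mul, mul_one] at this
  have TW : CoeffsIn W T := CoeffsIn.C tW
  have WH : ∀ {f g : A⟦X⟧}, CoeffsIn W f → CoeffsIn H g → CoeffsIn W (f * g) :=
    fun hf hg => hf.mul complement_mul hg
  have HW : ∀ {f g : A⟦X⟧}, CoeffsIn H g → CoeffsIn W f → CoeffsIn W (g * f) :=
    fun hg hf => hg.mul (fun a ha b hb => mul_complement b hb a ha) hf
  have conj : CoeffsIn W (T * (r - 1 - γ) * T) := fun m => by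
    rw [hT, coeff_mul_C, coeff_C_mul]
    exact h.conj_complement hk _ (ih m)
  have main : CoeffsIn W (p • (r' - 1) - ((1 - p) ^ 2) • ((r' - 1) * (a * (r * r))) - p • γ) := by
    have e : p • (r' - 1) - ((1 - p) ^ 2) • ((r' - 1) * (a * (r * r))) - p • γ =
        T * (r - 1 - γ) * T + (1 - p) • T + (1 - p) • (T * γ) - (1 - p) • (T * r)
          + (1 - p) • (r * T * (a * r)) := by
      have k1 : T * (r - 1 - γ) * T = T * r * T - T * T - T * T * γ := by
        have : T * γ * T = T * T * γ := by rw [mul_assoc, ← hγt.eq, mul_assoc]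
        rw [← this]; noncomm_ring
      rw [k1, key, ← s', hTT, add_mul, smul_mul_assoc, smul_mul_assoc, one_mul]
      rw [s', smul_sub]
      abel
    rw [e]
    exact ((((conj.add (TW.smul _)).add ((WH TW hγm).smul _)).sub
      ((WH TW rH).smul _)).add ((WH (HW rH TW) (aH.mul_alg rH)).smul _))
  have hb : CoeffsIn H ((1 - a) ^ 2) := by
    rw [pow_two]; exact (oneH.sub aH).mul_alg (oneH.sub aH)
  have main2 := (WH main hb).smul p⁻¹
  convert main2 using 1
  have c1 : (X * C (p • Y) : A⟦X⟧) = p • a := by rw [C_smul_eq, mul_smul_comm]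
  have c2 : (X * C (p⁻¹ • Y) : A⟦X⟧) = p⁻¹ • a := by rw [C_smul_eq, mul_smul_comm]
  rw [c1, c2]
  have arr : a * (r * r) * (1 - a) ^ 2 = a := by
    rw [pow_two, mul_assoc, mul_assoc r r, ← mul_assoc r (1 - a), q2, one_mul, q2, mul_one]
  -- The coefficient of r' - 1, after multiplication by (1-a)², is p(1-a)² - (1-p)²a. It splits into
  -- these two linear factors, which put the new poles at pJ_k and p⁻¹J_k.
  have fac : (1 - p • a) * (1 - p⁻¹ • a) =
      p⁻¹ • (p • (1 - a) ^ 2 - ((1 - p) ^ 2) • a) := by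
    simp only [pow_two, sub_mul, mul_sub, one_mul, mul_one, smul_mul_assoc, mul_smul_comm,
      smul_sub, smul_smul, inv_mul_cancel₀ hp, one_smul, sub_smul]
    rw [show p⁻¹ * (p * p) = p by field_simp]
    abel
  rw [fac]
  generalize r' - 1 = s
  rw [sub_mul, sub_mul, smul_mul_assoc, smul_mul_assoc, smul_mul_assoc, mul_assoc s,
    arr, mul_smul_comm, mul_sub, mul_smul_comm, mul_smul_comm, smul_sub, smul_sub, smul_sub,
    smul_smul p⁻¹ p (γ * _), inv_mul_cancel₀ hp, one_smul]

/-- The powers of a Jucys–Murphy element have the conditional moments given by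
`momentSeries`. -/
theorem HeckeRel.geom_sub_moment_mem (h : HeckeRel p M t) (hp : p ≠ 0)
    {φ : MvPolynomial ℕ ℝ →ₐ[ℝ] A} (hφ : ∀ k ≤ M, φ (MvPolynomial.X k) = jucysMurphy p t k) :
    ∀ k ≤ M, CoeffsIn (complement t k)
      (geom (jucysMurphy p t k) - 1 - PowerSeries.map (φ : MvPolynomial ℕ ℝ →+* A)
        (momentSeries p k)) := by
  intro k
  induction k with
  | zero =>
    intro _ m
    have hJ : jucysMurphy p t 0 = 1 := by simp [jucysMurphy, palindrome]
    have : geom (1 : A) - 1 - PowerSeries.map (φ : MvPolynomial ℕ ℝ →+* A)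
        (momentSeries p 0) = 0 := by
      have h1 := one_sub_mul_geom (1 : A)
      rw [map_one, mul_one, sub_mul, one_mul] at h1
      rw [momentSeries, map_mul, map_geom, PowerSeries.map_X, map_one]
      rw [sub_right_comm, h1, sub_self]
    rw [hJ, this, map_zero]
    exact zero_mem _
  | succ k ih =>
    intro hk
    have hφk := hφ k (by omega)
    set γ := PowerSeries.map (φ : MvPolynomial ℕ ℝ →+* A) (momentSeries p k) with hγ
    have hγm' : CoeffsIn (parabolic t (k - 1)).toSubmodule γ := fun m => by
      rw [hγ, coeff_map]
      exact map_polysUpTo_mem hφ (by omega) (momentSeries_mem p k m)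
    have hγm : CoeffsIn (parabolic t k).toSubmodule γ := fun m =>
      parabolic_mono t (by omega) (hγm' m)
    have hγt : Commute (C (t k)) γ := by
      ext m
      rw [coeff_C_mul, coeff_mul_C]
      -- For k = 0 the truncated index k - 1 leaves no room for far commutation; there the
      -- coefficients are scalars.
      rcases Nat.eq_zero_or_pos k with rfl | hk0
      · have : parabolic t 0 = ⊥ := by simp [parabolic]
        have hm := hγm m
        rw [this, Subalgebra.mem_toSubmodule, Algebra.mem_bot] at hm
        obtain ⟨c, hc⟩ := hm
        rw [← hc]
        exact (Algebra.commutes c _).symm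
      · exact (h.commute_gen_parabolic (by omega) (by omega) (hγm' m)).eq
    have step := h.resolvent_step hp (by omega : k < M) hγt hγm (ih (by omega))
    have hYm := jucysMurphy_mem p t k
    have g1 := one_sub_mul_geom (p • jucysMurphy p t k)
    have g2 := one_sub_mul_geom (p⁻¹ • jucysMurphy p t k)
    have hg : CoeffsIn (parabolic t k).toSubmodule
        (geom (p⁻¹ • jucysMurphy p t k) * geom (p • jucysMurphy p t k)) :=
      (CoeffsIn.geom (Subalgebra.smul_mem _ hYm _)).mul_alg
        (CoeffsIn.geom (Subalgebra.smul_mem _ hYm _))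
    have fin := step.mul complement_mul hg
    convert fin using 1
    have inv : (1 - X * C (p • jucysMurphy p t k)) * (1 - X * C (p⁻¹ • jucysMurphy p t k)) *
        (geom (p⁻¹ • jucysMurphy p t k) * geom (p • jucysMurphy p t k)) = 1 := by
      rw [mul_assoc, ← mul_assoc _ (geom (p⁻¹ • jucysMurphy p t k)), g2, one_mul, g1]
    rw [sub_mul, mul_assoc (geom _ - 1), inv, mul_one]
    congr 1
    rw [momentSeries, mul_comm (geom (p • MvPolynomial.X k)), map_mul, map_mul, map_mul, map_pow,
      map_geom, map_geom, map_sub, map_mul, PowerSeries.map_X, PowerSeries.map_C, map_one]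
    simp only [RingHom.coe_coe, map_smul, hφk]
    rfl

end Tower

/-! ### Rows, hooks and contents of Young diagrams -/

theorem lt_rowLen_iff_lt_colLen (μ : YoungDiagram) (i c : ℕ) :
    c < μ.rowLen i ↔ i < μ.colLen c := by
  rw [← YoungDiagram.mem_iff_lt_rowLen, ← YoungDiagram.mem_iff_lt_colLen]

theorem rowLen_eq_zero_of_le (μ : YoungDiagram) {m i : ℕ} (hm : μ.rowLen m = 0) (h : m ≤ i) :
    μ.rowLen i = 0 := by
  have := μ.rowLen_anti m i h
  omega

theorem rowLen_colLen_zero (μ : YoungDiagram) : μ.rowLen (μ.colLen 0) = 0 := by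
  by_contra h
  have := (lt_rowLen_iff_lt_colLen μ (μ.colLen 0) 0).mp (Nat.pos_of_ne_zero h)
  omega

theorem ext_rowLen {μ ν : YoungDiagram} (h : ∀ i, μ.rowLen i = ν.rowLen i) : μ = ν := by
  apply YoungDiagram.ext
  ext ⟨i, j⟩
  rw [YoungDiagram.mem_cells, YoungDiagram.mem_cells, YoungDiagram.mem_iff_lt_rowLen,
    YoungDiagram.mem_iff_lt_rowLen, h]

theorem prod_cells {R : Type*} [CommMonoid R] (μ : YoungDiagram) {L : ℕ} (hL : μ.rowLen L = 0)
    (F : ℕ × ℕ → R) :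
    ∏ b ∈ μ.cells, F b = ∏ i ∈ Finset.range L, ∏ c ∈ Finset.range (μ.rowLen i), F (i, c) := by
  apply Finset.prod_finset_product
  rintro ⟨i, c⟩
  rw [YoungDiagram.mem_cells, YoungDiagram.mem_iff_lt_rowLen, Finset.mem_range, Finset.mem_range]
  refine ⟨fun h => ⟨?_, h⟩, fun h => h.2⟩
  by_contra hi
  have h0 : μ.rowLen i = 0 := rowLen_eq_zero_of_le μ hL (not_lt.mp hi)
  omega

theorem sum_cells {R : Type*} [AddCommMonoid R] (μ : YoungDiagram) {L : ℕ} (hL : μ.rowLen L = 0)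
    (F : ℕ × ℕ → R) :
    ∑ b ∈ μ.cells, F b = ∑ i ∈ Finset.range L, ∑ c ∈ Finset.range (μ.rowLen i), F (i, c) :=
  prod_cells (R := Multiplicative R) μ hL F

theorem nStat_eq_sum_cells (μ : YoungDiagram) : nStat μ = ∑ b ∈ μ.cells, b.1 := by
  rw [sum_cells μ (rowLen_colLen_zero μ), nStat]
  simp [mul_comm]

theorem hookLength_pos {μ : YoungDiagram} {b : ℕ × ℕ} (hb : b ∈ μ) : 0 < hookLength μ b := by
  have h1 := YoungDiagram.mem_iff_lt_rowLen.mp (show (b.1, b.2) ∈ μ from hb)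
  have h2 := (lt_rowLen_iff_lt_colLen μ _ _).mp h1
  unfold hookLength
  omega

/-- The hook lengths in the `i`-th row and the differences of the `i`-th `β`-number and the later
ones are together the numbers up to the `i`-th `β`-number. -/
theorem prod_row_hooks {R : Type*} [CommMonoid R] (F : ℕ → R) (μ : YoungDiagram) {L i : ℕ}
    (hL : μ.rowLen L = 0) (hi : i < L) :
    (∏ c ∈ Finset.range (μ.rowLen i), F (hookLength μ (i, c))) *
      ∏ j ∈ Finset.Ioo i L, F (μ.rowLen i + j - i - μ.rowLen j) =
    ∏ k ∈ Finset.Icc 1 (μ.rowLen i + L - 1 - i), F k := by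
  have hcol : ∀ c, μ.colLen c ≤ L := fun c => by
    by_contra h
    have := (lt_rowLen_iff_lt_colLen μ L c).mpr (not_le.mp h)
    omega
  have hIJ : ∀ c, c < μ.rowLen i → i < μ.colLen c := fun c =>
    (lt_rowLen_iff_lt_colLen μ i c).mp
  have inj1 : Set.InjOn (fun c => hookLength μ (i, c)) (Finset.range (μ.rowLen i)) := by
    have key : ∀ c d, c < d → d < μ.rowLen i → hookLength μ (i, d) < hookLength μ (i, c) := by
      intro c d hcd hd
      have := μ.colLen_anti c d hcd.le
      have := hIJ d hd
      simp only [hookLength]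
      omega
    intro c hc d hd hcd
    simp only [Finset.coe_range, Set.mem_Iio] at hc hd
    dsimp only at hcd
    rcases lt_trichotomy c d with h | h | h
    · have := key c d h hd; omega
    · exact h
    · have := key d c h hc; omega
  have inj2 : Set.InjOn (fun j => μ.rowLen i + j - i - μ.rowLen j) (Finset.Ioo i L) := by
    have key : ∀ j k, i < j → j < k →
        μ.rowLen i + j - i - μ.rowLen j < μ.rowLen i + k - i - μ.rowLen k := by
      intro j k hj hjk
      have := μ.rowLen_anti i j hj.le
      have := μ.rowLen_anti j k hjk.le
      omega
    intro j hj k hk hjk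
    simp only [Finset.coe_Ioo, Set.mem_Ioo] at hj hk
    dsimp only at hjk
    rcases lt_trichotomy j k with h | h | h
    · have := key j k hj.1 h; omega
    · exact h
    · have := key k j hk.1 h; omega
  have disj : Disjoint ((Finset.range (μ.rowLen i)).image fun c => hookLength μ (i, c))
      ((Finset.Ioo i L).image fun j => μ.rowLen i + j - i - μ.rowLen j) := by
    rw [Finset.disjoint_left]
    intro x hx hx'
    obtain ⟨c, hc, rfl⟩ := Finset.mem_image.mp hx
    obtain ⟨j, hj, hj'⟩ := Finset.mem_image.mp hx'
    rw [Finset.mem_range] at hc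
    rw [Finset.mem_Ioo] at hj
    have h1 := hIJ c hc
    have h2 := lt_rowLen_iff_lt_colLen μ j c
    have := μ.rowLen_anti i j hj.1.le
    simp only [hookLength] at hj'
    by_cases h : c < μ.rowLen j
    · have := h2.mp h; omega
    · have : ¬ j < μ.colLen c := fun h' => h (h2.mpr h')
      omega
  have sub : ((Finset.range (μ.rowLen i)).image fun c => hookLength μ (i, c)) ∪
      ((Finset.Ioo i L).image fun j => μ.rowLen i + j - i - μ.rowLen j) ⊆
      Finset.Icc 1 (μ.rowLen i + L - 1 - i) := by
    intro x hx
    rw [Finset.mem_Icc]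
    rcases Finset.mem_union.mp hx with h | h
    · obtain ⟨c, hc, rfl⟩ := Finset.mem_image.mp h
      rw [Finset.mem_range] at hc
      have := hIJ c hc
      have := hcol c
      simp only [hookLength]
      omega
    · obtain ⟨j, hj, rfl⟩ := Finset.mem_image.mp h
      rw [Finset.mem_Ioo] at hj
      have := μ.rowLen_anti i j hj.1.le
      omega
  -- The two disjoint images have λ_i and L - 1 - i elements, together as many as the interval, so
  -- they fill it.
  have eq := Finset.eq_of_subset_of_card_le sub (by
    rw [Finset.card_union_of_disjoint disj, Finset.card_image_of_injOn inj1,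
      Finset.card_image_of_injOn inj2]
    simp only [Nat.card_Icc, Finset.card_range, Nat.card_Ioo]
    omega)
  rw [← eq, Finset.prod_union disj, Finset.prod_image inj1, Finset.prod_image inj2]

/-- The sum of the contents of all boxes. -/
def contentSum (μ : YoungDiagram) : ℤ := ∑ b ∈ μ.cells, content b

/-- `q^{n(μ)} / ∏ [h_b]_q`. -/
noncomputable def shapeWeight (q : ℝ) (μ : YoungDiagram) : ℝ :=
  q ^ nStat μ / ∏ b ∈ μ.cells, qInt q (hookLength μ b)

theorem genericDegree_eq (q : ℝ) {n : ℕ} (μ : Shape n) :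
    genericDegree q μ = qFactorial q n * shapeWeight q μ.1 := by
  rw [genericDegree, shapeWeight]; ring

theorem qInt_pos {q : ℝ} (hq : 0 < q) {k : ℕ} (hk : 0 < k) : 0 < qInt q k :=
  Finset.sum_pos (fun _ _ => by positivity) (by simpa using hk.ne')

theorem prod_qInt_hooks_pos {q : ℝ} (hq : 0 < q) (μ : YoungDiagram) :
    0 < ∏ b ∈ μ.cells, qInt q (hookLength μ b) :=
  Finset.prod_pos fun _ hb => qInt_pos hq (hookLength_pos hb)

theorem shapeWeight_pos {q : ℝ} (hq : 0 < q) (μ : YoungDiagram) : 0 < shapeWeight q μ :=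
  div_pos (by positivity) (prod_qInt_hooks_pos hq μ)

/-! ### Adding a box -/

/-- A box can be added to the `i`-th row. -/
def Addable (μ : YoungDiagram) (i : ℕ) : Prop := i = 0 ∨ μ.rowLen i < μ.rowLen (i - 1)

/-- The diagram with a box added to the `i`-th row. -/
def addBox (μ : YoungDiagram) (i : ℕ) (h : Addable μ i) : YoungDiagram where
  cells := insert (i, μ.rowLen i) μ.cells
  isLowerSet := by
    rintro ⟨a, b⟩ ⟨c, d⟩ hle hab
    obtain ⟨h1, h2⟩ : c ≤ a ∧ d ≤ b := hle
    simp only [Finset.coe_insert, Set.mem_insert_iff, Finset.mem_coe, YoungDiagram.mem_cells]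
      at hab ⊢
    rcases hab with hab | hab
    · obtain ⟨rfl, rfl⟩ := Prod.mk.inj hab
      rcases Nat.lt_or_ge c a with hca | hca
      · right
        rcases h with h | h
        · omega
        · rw [YoungDiagram.mem_iff_lt_rowLen]
          have := μ.rowLen_anti c (a - 1) (by omega)
          omega
      · obtain rfl : c = a := by omega
        rcases Nat.lt_or_ge d (μ.rowLen c) with hd | hd
        · right; rwa [YoungDiagram.mem_iff_lt_rowLen]
        · left; congr 1; omega
    · exact Or.inr (μ.up_left_mem h1 h2 hab)

theorem not_mem_end (μ : YoungDiagram) (i : ℕ) : (i, μ.rowLen i) ∉ μ.cells := by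
  rw [YoungDiagram.mem_cells, YoungDiagram.mem_iff_lt_rowLen]; exact lt_irrefl _

theorem rowLen_addBox (μ : YoungDiagram) (i : ℕ) (h : Addable μ i) (r : ℕ) :
    (addBox μ i h).rowLen r = μ.rowLen r + if r = i then 1 else 0 := by
  apply eq_of_forall_lt_iff
  intro c
  rw [← YoungDiagram.mem_iff_lt_rowLen, ← YoungDiagram.mem_cells]
  simp only [addBox, Finset.mem_insert, YoungDiagram.mem_cells, YoungDiagram.mem_iff_lt_rowLen,
    Prod.mk.injEq]
  split_ifs with hr
  · subst hr; omega
  · simp [hr]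

theorem card_addBox (μ : YoungDiagram) (i : ℕ) (h : Addable μ i) :
    (addBox μ i h).card = μ.card + 1 :=
  Finset.card_insert_of_notMem (not_mem_end μ i)

theorem le_addBox (μ : YoungDiagram) (i : ℕ) (h : Addable μ i) : μ ≤ addBox μ i h :=
  Finset.subset_insert _ _

theorem contentSum_addBox (μ : YoungDiagram) (i : ℕ) (h : Addable μ i) :
    contentSum (addBox μ i h) - contentSum μ = (μ.rowLen i : ℤ) - i := by
  simp only [contentSum, addBox, Finset.sum_insert (not_mem_end μ i), content]
  ring

theorem exists_addBox {μ ν : YoungDiagram} (hle : μ ≤ ν) (hcard : ν.card = μ.card + 1) :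
    ∃ i, ∃ h : Addable μ i, ν = addBox μ i h := by
  have hsub : μ.cells ⊆ ν.cells := hle
  obtain ⟨⟨i, c⟩, hic⟩ := Finset.card_eq_one.mp
    (show (ν.cells \ μ.cells).card = 1 by
      rw [Finset.card_sdiff_of_subset hsub]
      have : ν.cells.card = μ.cells.card + 1 := hcard
      omega)
  have hmem : ∀ b, b ∈ ν → b ∉ μ → b = (i, c) := fun b h1 h2 => by
    have : b ∈ ν.cells \ μ.cells := Finset.mem_sdiff.mpr ⟨h1, h2⟩
    rwa [hic, Finset.mem_singleton] at this
  have hin : (i, c) ∈ ν.cells \ μ.cells := by rw [hic]; exact Finset.mem_singleton_self _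
  obtain ⟨hin1, hin2⟩ := Finset.mem_sdiff.mp hin
  rw [YoungDiagram.mem_cells] at hin1 hin2
  have hc : c = μ.rowLen i := by
    have h1 : μ.rowLen i ≤ c := by
      rw [YoungDiagram.mem_iff_lt_rowLen] at hin2; omega
    have := hmem (i, μ.rowLen i) (ν.up_left_mem le_rfl h1 hin1) (not_mem_end μ i)
    exact ((Prod.mk.inj this).2).symm
  have hadd : Addable μ i := by
    rcases Nat.eq_zero_or_pos i with h0 | h0
    · exact Or.inl h0
    · right
      rw [← hc, ← YoungDiagram.mem_iff_lt_rowLen]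
      by_contra hn
      have := hmem (i - 1, c) (ν.up_left_mem (Nat.sub_le _ _) le_rfl hin1) hn
      have := (Prod.mk.inj this).1
      omega
  refine ⟨i, hadd, ?_⟩
  apply YoungDiagram.ext
  change ν.cells = insert (i, μ.rowLen i) μ.cells
  rw [← hc, ← Finset.sdiff_union_of_subset hsub, hic]
  rfl

theorem Addable.le_of_rowLen_eq_zero {μ : YoungDiagram} {i m : ℕ} (h : Addable μ i)
    (hm : μ.rowLen m = 0) : i ≤ m := by
  by_contra hi
  rcases h with h | h
  · omega
  · have := rowLen_eq_zero_of_le μ hm (show m ≤ i - 1 by omega)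
    omega

open Classical in
/-- Summing over the diagrams which cover `μ`. -/
theorem sum_covers {n : ℕ} (μ : Shape n) {m : ℕ} (hm : μ.1.rowLen m = 0)
    (f : YoungDiagram → ℝ) :
    ∑ ν : Shape (n + 1) with μ.1 ≤ ν.1, f ν.1 =
      ∑ i ∈ Finset.range (m + 1), if h : Addable μ.1 i then f (addBox μ.1 i h) else 0 := by
  rw [← Finset.sum_filter_add_sum_filter_not (Finset.range (m + 1)) (fun i => Addable μ.1 i)]
  rw [Finset.sum_eq_zero (s := {i ∈ Finset.range (m + 1) | ¬ Addable μ.1 i})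
    (fun i hi => dif_neg (Finset.mem_filter.mp hi).2), add_zero]
  symm
  refine Finset.sum_bij (fun i hi => ⟨addBox μ.1 i (Finset.mem_filter.mp hi).2,
    by rw [card_addBox, μ.2]⟩) ?_ ?_ ?_ ?_
  · intro i hi
    exact Finset.mem_filter.mpr ⟨Finset.mem_univ _, le_addBox _ _ (Finset.mem_filter.mp hi).2⟩
  · intro i hi j hj hij
    have h1 := congrArg (fun ν : Shape (n + 1) => ν.1.rowLen i) hij
    simp only [rowLen_addBox, if_true] at h1
    by_contra hne
    rw [if_neg hne] at h1
    omega
  · intro ν hν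
    obtain ⟨i, h, hi⟩ := exists_addBox (Finset.mem_filter.mp hν).2 (by rw [ν.2, μ.2])
    exact ⟨i, Finset.mem_filter.mpr ⟨Finset.mem_range.mpr
      (Nat.lt_succ_of_le (h.le_of_rowLen_eq_zero hm)), h⟩, Subtype.ext hi.symm⟩
  · intro i hi
    rw [dif_pos (Finset.mem_filter.mp hi).2]

/-! ### The transition probabilities of the growth of Young diagrams -/

section PartialFractions
open PowerSeries

/-- The residues of the transition generating function with nodes `x 0, …, x m`. -/
noncomputable def residue (q : ℝ) (m : ℕ) (x : ℕ → ℝ) (i : ℕ) : ℝ :=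
  (x i)⁻¹ * (∏ j ∈ Finset.range m, (1 - x j / (q * x i))) /
    ∏ j ∈ (Finset.range (m + 1)).erase i, (1 - x j / x i)

/-- Both sides have degree at most m: on the right the coefficients of degree m + 1 cancel exactly
because x_m = q^{-m}. They agree at the m + 1 points 1/x_i, where every term but the i-th vanishes
on the left and the first product vanishes on the right. -/
theorem polynomial_partial_fractions {q : ℝ} (hq : q ≠ 0) {m : ℕ} {x : ℕ → ℝ}
    (hx : ∀ i, x i ≠ 0) (hinj : Set.InjOn x (Finset.range (m + 1))) (hm : x m = (q ^ m)⁻¹) :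
    ∑ i ∈ Finset.range (m + 1), Polynomial.C (residue q m x i) *
        ∏ j ∈ (Finset.range (m + 1)).erase i, (1 - Polynomial.X * Polynomial.C (x j)) =
      ∏ i ∈ Finset.range (m + 1), (1 - Polynomial.X * Polynomial.C (x i)) +
        Polynomial.X * ∏ i ∈ Finset.range m, (1 - Polynomial.X * Polynomial.C (x i / q)) := by
  have hlin : ∀ y : ℝ, (1 - Polynomial.X * Polynomial.C y).natDegree ≤ 1 := fun y => by
    compute_degree
  have hprod : ∀ (s : Finset ℕ) (y : ℕ → ℝ),
      (∏ j ∈ s, (1 - Polynomial.X * Polynomial.C (y j))).natDegree ≤ s.card := fun s y => by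
    refine (Polynomial.natDegree_prod_le _ _).trans ?_
    calc _ ≤ ∑ _j ∈ s, 1 := Finset.sum_le_sum fun j _ => hlin (y j)
      _ = s.card := by simp
  have hcoef : ∀ (s : Finset ℕ) (y : ℕ → ℝ),
      (∏ j ∈ s, (1 - Polynomial.X * Polynomial.C (y j))).coeff s.card = ∏ j ∈ s, (-y j) :=
    fun s y => by
      have := Polynomial.coeff_prod_of_natDegree_le s
        (fun j => 1 - Polynomial.X * Polynomial.C (y j)) 1 (fun j _ => hlin (y j))
      rw [mul_one] at this
      rw [this]
      exact Finset.prod_congr rfl fun j _ => by simp [Polynomial.coeff_one]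
  have hdegL : (∑ i ∈ Finset.range (m + 1), Polynomial.C (residue q m x i) *
      ∏ j ∈ (Finset.range (m + 1)).erase i, (1 - Polynomial.X * Polynomial.C (x j))).degree <
        ((Finset.range (m + 1)).card : ℕ) := by
    refine lt_of_le_of_lt (Polynomial.degree_le_of_natDegree_le (n := m) ?_) (by
      rw [Finset.card_range]; exact_mod_cast Nat.lt_succ_self m)
    refine Polynomial.natDegree_sum_le_of_forall_le _ _ fun i hi => ?_
    refine (Polynomial.natDegree_C_mul_le _ _).trans ((hprod _ _).trans ?_)
    rw [Finset.card_erase_of_mem hi, Finset.card_range, Nat.add_sub_cancel]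
  have hdegR : (∏ i ∈ Finset.range (m + 1), (1 - Polynomial.X * Polynomial.C (x i)) +
        Polynomial.X * ∏ i ∈ Finset.range m, (1 - Polynomial.X * Polynomial.C (x i / q))).degree <
        ((Finset.range (m + 1)).card : ℕ) := by
    rw [Finset.card_range]
    have h1 := hprod (Finset.range (m + 1)) x
    have h2 := hprod (Finset.range m) (fun i => x i / q)
    have c1 := hcoef (Finset.range (m + 1)) x
    have c2 := hcoef (Finset.range m) (fun i => x i / q)
    rw [Finset.card_range] at h1 h2 c1 c2
    rw [Polynomial.degree_lt_iff_coeff_zero]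
    intro k hk
    rw [Polynomial.coeff_add]
    rcases Nat.lt_or_ge (m + 1) k with hk' | hk'
    · rw [Polynomial.coeff_eq_zero_of_natDegree_lt (h1.trans_lt hk'), zero_add]
      obtain ⟨k, rfl⟩ : ∃ l, k = l + 1 := ⟨k - 1, by omega⟩
      rw [Polynomial.coeff_X_mul]
      exact Polynomial.coeff_eq_zero_of_natDegree_lt (h2.trans_lt (by omega))
    · obtain rfl : k = m + 1 := le_antisymm hk' hk
      rw [Polynomial.coeff_X_mul, c1, c2, Finset.prod_range_succ, hm]
      have : ∏ j ∈ Finset.range m, (-(x j / q)) =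
          (∏ j ∈ Finset.range m, (-x j)) * (q ^ m)⁻¹ := by
        rw [← inv_pow, ← Finset.card_range m, ← Finset.prod_const, Finset.card_range,
          ← Finset.prod_mul_distrib]
        exact Finset.prod_congr rfl fun j _ => by ring
      rw [this]
      ring
  refine Polynomial.eq_of_degrees_lt_of_eval_index_eq (v := fun i => (x i)⁻¹)
    (Finset.range (m + 1)) ?_ hdegL hdegR ?_
  · intro i hi j hj hij
    exact hinj hi hj (inv_injective hij)
  · intro i hi
    rw [Polynomial.eval_finsetSum, Finset.sum_eq_single i]
    · have hz : ∏ j ∈ Finset.range (m + 1),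
          (1 - Polynomial.X * Polynomial.C (x j)).eval (x i)⁻¹ = 0 :=
        Finset.prod_eq_zero hi (by simp [mul_inv_cancel₀ (hx i)])
      have hne : ∏ j ∈ (Finset.range (m + 1)).erase i, (1 - x j / x i) ≠ 0 := by
        refine Finset.prod_ne_zero_iff.mpr fun j hj => ?_
        obtain ⟨hji, hj⟩ := Finset.mem_erase.mp hj
        intro h0
        have : x j = x i := by
          have := sub_eq_zero.mp h0
          field_simp [hx i] at this
          exact this.symm
        exact hji (hinj hj hi this)
      rw [Polynomial.eval_add, Polynomial.eval_prod, hz, zero_add, Polynomial.eval_mul,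
        Polynomial.eval_mul, Polynomial.eval_prod, Polynomial.eval_prod, Polynomial.eval_C,
        Polynomial.eval_X, residue]
      have e1 : ∏ j ∈ (Finset.range (m + 1)).erase i,
          (1 - Polynomial.X * Polynomial.C (x j)).eval (x i)⁻¹ =
          ∏ j ∈ (Finset.range (m + 1)).erase i, (1 - x j / x i) :=
        Finset.prod_congr rfl fun j _ => by simp; ring
      have e2 : ∏ j ∈ Finset.range m,
          (1 - Polynomial.X * Polynomial.C (x j / q)).eval (x i)⁻¹ =
          ∏ j ∈ Finset.range m, (1 - x j / (q * x i)) :=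
        Finset.prod_congr rfl fun j _ => by simp; field_simp
      rw [e1, e2, div_mul_cancel₀ _ hne]
    · intro j hj hji
      rw [Polynomial.eval_mul, Polynomial.eval_prod,
        Finset.prod_eq_zero (Finset.mem_erase.mpr ⟨hji.symm, hi⟩), mul_zero]
      simp [mul_inv_cancel₀ (hx i)]
    · intro h; exact absurd hi h

/-- The linear power series `1 - u x`. -/
noncomputable def lin (x : ℝ) : ℝ⟦X⟧ := 1 - X * C x

theorem lin_ne_zero (x : ℝ) : lin x ≠ 0 := by
  intro h
  have := congrArg (constantCoeff (R := ℝ)) h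
  simp [lin] at this

theorem lin_mul_geom (x : ℝ) : lin x * geom x = 1 := one_sub_mul_geom x

theorem sum_residue_geom {q : ℝ} (hq : q ≠ 0) {m : ℕ} {x : ℕ → ℝ}
    (hx : ∀ i, x i ≠ 0) (hinj : Set.InjOn x (Finset.range (m + 1))) (hm : x m = (q ^ m)⁻¹)
    {g : ℝ⟦X⟧} (hg : g * ∏ i ∈ Finset.range (m + 1), lin (x i) =
      X * ∏ i ∈ Finset.range m, lin (x i / q)) :
    1 + g = ∑ i ∈ Finset.range (m + 1), C (residue q m x i) * geom (x i) := by
  have hD : ∏ i ∈ Finset.range (m + 1), lin (x i) ≠ 0 :=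
    Finset.prod_ne_zero_iff.mpr fun i _ => lin_ne_zero _
  apply mul_right_cancel₀ hD
  have h := congrArg (fun P : Polynomial ℝ => (P : ℝ⟦X⟧))
    (polynomial_partial_fractions hq hx hinj hm)
  have hc : ∀ y : ℝ, ((1 - Polynomial.X * Polynomial.C y : Polynomial ℝ) : ℝ⟦X⟧) = lin y := by
    intro y
    simp only [lin, Polynomial.coe_sub, Polynomial.coe_mul, Polynomial.coe_one, Polynomial.coe_X,
      Polynomial.coe_C]
  have hp : ∀ (s : Finset ℕ) (y : ℕ → ℝ),
      ((∏ i ∈ s, (1 - Polynomial.X * Polynomial.C (y i)) : Polynomial ℝ) : ℝ⟦X⟧) =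
      ∏ i ∈ s, lin (y i) := by
    intro s y
    rw [← Polynomial.coeToPowerSeries.ringHom_apply, map_prod]
    exact Finset.prod_congr rfl fun i _ => hc (y i)
  have hs : ((∑ i ∈ Finset.range (m + 1), Polynomial.C (residue q m x i) *
        ∏ j ∈ (Finset.range (m + 1)).erase i, (1 - Polynomial.X * Polynomial.C (x j)) :
          Polynomial ℝ) : ℝ⟦X⟧) = ∑ i ∈ Finset.range (m + 1), C (residue q m x i) *
            ∏ j ∈ (Finset.range (m + 1)).erase i, lin (x j) := by
    rw [← Polynomial.coeToPowerSeries.ringHom_apply, map_sum]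
    refine Finset.sum_congr rfl fun i _ => ?_
    rw [Polynomial.coeToPowerSeries.ringHom_apply, Polynomial.coe_mul, hp, Polynomial.coe_C]
  rw [hs, Polynomial.coe_add, Polynomial.coe_mul, hp, hp _ (fun i => x i / q), Polynomial.coe_X]
    at h
  rw [add_mul, one_mul, hg, ← h, Finset.sum_mul]
  refine Finset.sum_congr rfl fun i hi => ?_
  rw [← Finset.mul_prod_erase _ _ hi, mul_assoc, ← mul_assoc (geom _), mul_comm (geom _),
    lin_mul_geom, one_mul]

end PartialFractions

/-! ### Telescoping over the rows -/

section Telescope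

variable {R : Type*} [CommMonoid R]

/-- Along a row the second-order ratio E(c-1)E(c+1)/E(c)² telescopes to its two ends. It is written
without division because `R` is only a monoid. -/
theorem telescope_row (E : ℤ → R) (i r : ℕ) :
    (∏ c ∈ Finset.range r, E ((c : ℤ) - i) ^ 2) * (E ((r : ℤ) - i) * E (-(i : ℤ) - 1)) =
    (∏ c ∈ Finset.range r, E ((c : ℤ) - i - 1) * E ((c : ℤ) - i + 1)) *
      (E ((r : ℤ) - i - 1) * E (-(i : ℤ))) := by
  induction r with
  | zero => simp [mul_comm]
  | succ r ih =>
    rw [Finset.prod_range_succ, Finset.prod_range_succ]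
    have e1 : ((r + 1 : ℕ) : ℤ) - i = (r : ℤ) - i + 1 := by push_cast; ring
    have e2 : ((r + 1 : ℕ) : ℤ) - i - 1 = (r : ℤ) - i := by push_cast; ring
    rw [e2, e1]
    calc _ = ((∏ c ∈ Finset.range r, E ((c : ℤ) - i) ^ 2) *
          (E ((r : ℤ) - i) * E (-(i : ℤ) - 1))) * (E ((r : ℤ) - i) * E ((r : ℤ) - i + 1)) := by
            rw [pow_two]; ac_rfl
      _ = _ := by rw [ih]; ac_rfl

theorem telescope_cells (E : ℤ → R) (μ : YoungDiagram) {m : ℕ} (hm : μ.rowLen m = 0) :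
    (∏ b ∈ μ.cells, E (content b) ^ 2) * ((∏ i ∈ Finset.range m, E ((μ.rowLen i : ℤ) - i)) *
      ∏ i ∈ Finset.range m, E (-(i : ℤ) - 1)) =
    (∏ b ∈ μ.cells, E (content b - 1) * E (content b + 1)) *
      ((∏ i ∈ Finset.range m, E ((μ.rowLen i : ℤ) - i - 1)) *
        ∏ i ∈ Finset.range m, E (-(i : ℤ))) := by
  rw [prod_cells μ hm, prod_cells μ hm]
  simp only [← Finset.prod_mul_distrib, content]
  exact Finset.prod_congr rfl fun i _ => telescope_row E i (μ.rowLen i)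

end Telescope

/-! ### The transition series of a diagram in terms of its rows -/

section Transition
open PowerSeries

/-- The transition generating function of a diagram, in terms of its row lengths. -/
theorem transition_mul {q : ℝ} {μ : YoungDiagram} {m : ℕ}
    (hm : μ.rowLen m = 0) {g : ℝ⟦X⟧}
    (hg : g * ((lin 1) * ∏ b ∈ μ.cells,
      (lin (q ^ (content b - 1)) * lin (q ^ (content b + 1)))) =
      X * ∏ b ∈ μ.cells, lin (q ^ content b) ^ 2) :
    g * ∏ i ∈ Finset.range (m + 1), lin (q ^ ((μ.rowLen i : ℤ) - i)) =
      X * ∏ i ∈ Finset.range m, lin (q ^ ((μ.rowLen i : ℤ) - i - 1)) := by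
  have ht := telescope_cells (fun c : ℤ => lin (q ^ c)) μ hm
  set A := ∏ b ∈ μ.cells, lin (q ^ content b) ^ 2
  set B := ∏ b ∈ μ.cells, (lin (q ^ (content b - 1)) * lin (q ^ (content b + 1)))
  set P := ∏ i ∈ Finset.range m, lin (q ^ ((μ.rowLen i : ℤ) - i))
  set Q := ∏ i ∈ Finset.range m, lin (q ^ ((μ.rowLen i : ℤ) - i - 1))
  set S := ∏ i ∈ Finset.range m, lin (q ^ (-(i : ℤ) - 1))
  set T := ∏ i ∈ Finset.range m, lin (q ^ (-(i : ℤ)))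
  -- `S` is `T` with the index shifted by one, so they differ only in their end factors, at the
  -- exponents 0 and -m.
  have hTS : T * lin (q ^ (-(m : ℤ))) = S * lin 1 := by
    have h1 := Finset.prod_range_succ (fun i : ℕ => lin (q ^ (-(i : ℤ)))) m
    have h2 := Finset.prod_range_succ' (fun i : ℕ => lin (q ^ (-(i : ℤ)))) m
    rw [← h1, h2]
    simp only [Nat.cast_zero, neg_zero, zpow_zero]
    congr 1
    exact Finset.prod_congr rfl fun i _ => by push_cast; congr 2; ring
  rw [Finset.prod_range_succ, hm]
  have e0 : ((0 : ℕ) : ℤ) - m = -(m : ℤ) := by simp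
  rw [e0]
  have hB : B ≠ 0 := Finset.prod_ne_zero_iff.mpr fun b _ =>
    mul_ne_zero (lin_ne_zero _) (lin_ne_zero _)
  have hS : S ≠ 0 := Finset.prod_ne_zero_iff.mpr fun b _ => lin_ne_zero _
  have h1 := lin_ne_zero (1 : ℝ)
  apply mul_right_cancel₀ (mul_ne_zero (mul_ne_zero hB hS) h1)
  calc g * (P * lin (q ^ (-(m : ℤ)))) * (B * S * lin 1)
      = (g * (lin 1 * B)) * (P * S * lin (q ^ (-(m : ℤ)))) := by ring
    _ = X * (A * (P * S)) * lin (q ^ (-(m : ℤ))) := by rw [hg]; ring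
    _ = X * (B * Q) * (T * lin (q ^ (-(m : ℤ)))) := by rw [ht]; ring
    _ = X * Q * (B * S * lin 1) := by rw [hTS]; ring

end Transition

/-! ### The weight of a diagram with an added box -/

section AddBoxWeight

/-- Adding a box raises only the i-th β-number, by one. By `prod_row_hooks` an earlier row therefore
trades a single difference of β-numbers, the i-th row shifts all its differences, and later rows
keep their hooks. Taking m + 1 rows lets the empty row m receive the box. -/
theorem prod_rows_addBox (F : ℕ → ℝ) (hF : ∀ k, 0 < k → F k ≠ 0) (μ : YoungDiagram) {m i : ℕ}
    (hm : μ.rowLen m = 0) (him : i ≤ m) (h : Addable μ i) :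
    (∏ b ∈ (addBox μ i h).cells, F (hookLength (addBox μ i h) b)) *
      ((∏ r ∈ Finset.range i, F (μ.rowLen r + i - r - μ.rowLen i - 1)) *
        ∏ j ∈ Finset.Ioo i (m + 1), F (μ.rowLen i + j - i - μ.rowLen j + 1)) =
    (∏ b ∈ μ.cells, F (hookLength μ b)) *
      ((∏ r ∈ Finset.range i, F (μ.rowLen r + i - r - μ.rowLen i)) *
        ∏ j ∈ Finset.Ioo i (m + 1), F (μ.rowLen i + j - i - μ.rowLen j)) *
      F (μ.rowLen i + m - i + 1) := by
  set ν := addBox μ i h with hν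
  have hr : ∀ r, ν.rowLen r = μ.rowLen r + if r = i then 1 else 0 := rowLen_addBox μ i h
  have hμL : μ.rowLen (m + 1) = 0 := rowLen_eq_zero_of_le μ hm (Nat.le_succ m)
  have hνL : ν.rowLen (m + 1) = 0 := by rw [hr, hμL, if_neg (by omega)]
  have anti : ∀ r, r < i → μ.rowLen i < μ.rowLen r := fun r hri => by
    rcases h with h | h
    · omega
    · have := μ.rowLen_anti r (i - 1) (by omega)
      omega
  rw [prod_cells ν hνL, prod_cells μ hμL]
  set rowν := fun r => ∏ c ∈ Finset.range (ν.rowLen r), F (hookLength ν (r, c)) with hrowν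
  set rowμ := fun r => ∏ c ∈ Finset.range (μ.rowLen r), F (hookLength μ (r, c)) with hrowμ
  have later : ∀ r ∈ Finset.Ioo i (m + 1), rowν r = rowμ r := by
    intro r hrI
    rw [Finset.mem_Ioo] at hrI
    have e1 := prod_row_hooks F ν hνL hrI.2
    have e2 := prod_row_hooks F μ hμL hrI.2
    have hrr : ν.rowLen r = μ.rowLen r := by rw [hr, if_neg (by omega), add_zero]
    have e3 : ∏ j ∈ Finset.Ioo r (m + 1), F (ν.rowLen r + j - r - ν.rowLen j) =
        ∏ j ∈ Finset.Ioo r (m + 1), F (μ.rowLen r + j - r - μ.rowLen j) := by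
      refine Finset.prod_congr rfl fun j hj => ?_
      rw [Finset.mem_Ioo] at hj
      rw [hrr, hr j, if_neg (by omega), add_zero]
    have hne : ∏ j ∈ Finset.Ioo r (m + 1), F (μ.rowLen r + j - r - μ.rowLen j) ≠ 0 := by
      refine Finset.prod_ne_zero_iff.mpr fun j hj => hF _ ?_
      rw [Finset.mem_Ioo] at hj
      have := μ.rowLen_anti r j hj.1.le
      omega
    apply mul_right_cancel₀ hne
    rw [hrowμ, e2, ← e3, hrowν, e1, hrr]
  have earlier : ∀ r ∈ Finset.range i, rowν r * F (μ.rowLen r + i - r - μ.rowLen i - 1) =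
      rowμ r * F (μ.rowLen r + i - r - μ.rowLen i) := by
    intro r hrI
    rw [Finset.mem_range] at hrI
    have e1 := prod_row_hooks F ν hνL (show r < m + 1 by omega)
    have e2 := prod_row_hooks F μ hμL (show r < m + 1 by omega)
    have hrr : ν.rowLen r = μ.rowLen r := by rw [hr, if_neg (by omega), add_zero]
    have hi : i ∈ Finset.Ioo r (m + 1) := Finset.mem_Ioo.mpr ⟨hrI, by omega⟩
    rw [← Finset.mul_prod_erase _ _ hi] at e1 e2
    have e3 : ∏ j ∈ (Finset.Ioo r (m + 1)).erase i, F (ν.rowLen r + j - r - ν.rowLen j) =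
        ∏ j ∈ (Finset.Ioo r (m + 1)).erase i, F (μ.rowLen r + j - r - μ.rowLen j) := by
      refine Finset.prod_congr rfl fun j hj => ?_
      rw [hrr, hr j, if_neg (Finset.ne_of_mem_erase hj), add_zero]
    have hne : ∏ j ∈ (Finset.Ioo r (m + 1)).erase i, F (μ.rowLen r + j - r - μ.rowLen j) ≠ 0 := by
      refine Finset.prod_ne_zero_iff.mpr fun j hj => hF _ ?_
      have hj := Finset.mem_Ioo.mp (Finset.mem_of_mem_erase hj)
      have := μ.rowLen_anti r j hj.1.le
      omega
    have e4 : ν.rowLen r + i - r - ν.rowLen i = μ.rowLen r + i - r - μ.rowLen i - 1 := by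
      rw [hrr, hr i, if_pos rfl]; omega
    rw [e3, e4, hrr, ← mul_assoc] at e1
    rw [← mul_assoc] at e2
    apply mul_right_cancel₀ hne
    simp only [hrowν, hrowμ, hrr]
    rw [e1, e2]
  have here : rowν i * ∏ j ∈ Finset.Ioo i (m + 1), F (μ.rowLen i + j - i - μ.rowLen j + 1) =
      rowμ i * (∏ j ∈ Finset.Ioo i (m + 1), F (μ.rowLen i + j - i - μ.rowLen j)) *
        F (μ.rowLen i + m - i + 1) := by
    have e1 := prod_row_hooks F ν hνL (show i < m + 1 by omega)
    have e2 := prod_row_hooks F μ hμL (show i < m + 1 by omega)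
    have hrr : ν.rowLen i = μ.rowLen i + 1 := by rw [hr, if_pos rfl]
    have e3 : ∏ j ∈ Finset.Ioo i (m + 1), F (ν.rowLen i + j - i - ν.rowLen j) =
        ∏ j ∈ Finset.Ioo i (m + 1), F (μ.rowLen i + j - i - μ.rowLen j + 1) := by
      refine Finset.prod_congr rfl fun j hj => ?_
      rw [Finset.mem_Ioo] at hj
      have := μ.rowLen_anti i j hj.1.le
      rw [hrr, hr j, if_neg (by omega), add_zero]
      congr 1
      omega
    have e4 : ν.rowLen i + (m + 1) - 1 - i = (μ.rowLen i + m - i) + 1 := by rw [hrr]; omega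
    have e5 : μ.rowLen i + (m + 1) - 1 - i = μ.rowLen i + m - i := by omega
    rw [e3, e4, Finset.prod_Icc_succ_top (by omega)] at e1
    rw [e5] at e2
    simp only [hrowν, hrowμ]
    rw [e1, e2]
  have split : ∀ f : ℕ → ℝ, ∏ r ∈ Finset.range (m + 1), f r =
      (∏ r ∈ Finset.range i, f r) * (f i * ∏ r ∈ Finset.Ioo i (m + 1), f r) := by
    intro f
    rw [← Finset.prod_range_mul_prod_Ico f (show i ≤ m + 1 by omega),
      ← Finset.Ioo_insert_left (show i < m + 1 by omega), Finset.prod_insert Finset.left_notMem_Ioo]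
  rw [split, split, Finset.prod_congr rfl later]
  have he := Finset.prod_congr (rfl : Finset.range i = Finset.range i) earlier
  rw [Finset.prod_mul_distrib, Finset.prod_mul_distrib] at he
  calc _ = ((∏ r ∈ Finset.range i, rowν r) *
        ∏ r ∈ Finset.range i, F (μ.rowLen r + i - r - μ.rowLen i - 1)) *
      (rowν i * ∏ j ∈ Finset.Ioo i (m + 1), F (μ.rowLen i + j - i - μ.rowLen j + 1)) *
      (∏ r ∈ Finset.Ioo i (m + 1), rowμ r) := by ring
    _ = _ := by rw [he, here]; ring

theorem nStat_addBox (μ : YoungDiagram) (i : ℕ) (h : Addable μ i) :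
    nStat (addBox μ i h) = nStat μ + i := by
  rw [nStat_eq_sum_cells, nStat_eq_sum_cells, addBox, Finset.sum_insert (not_mem_end μ i),
    add_comm]

/-- The node attached to the `i`-th row. -/
noncomputable def rowNode (q : ℝ) (μ : YoungDiagram) (i : ℕ) : ℝ := q ^ ((μ.rowLen i : ℤ) - i)

theorem qInt_mul_sub_one (q : ℝ) (k : ℕ) : qInt q k * (q - 1) = q ^ k - 1 :=
  geom_sum_mul q k

/-- Each power of q occurring in the hook quotient of an added box is a ratio of nodes, so the
residue consists of the same differences of β-numbers. This matches `prod_rows_addBox` for F(k) =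
q^k - 1. -/
theorem residue_mul {q : ℝ} (hq : 1 < q) (μ : YoungDiagram) {m i : ℕ}
    (hm : μ.rowLen m = 0) (him : i ≤ m) (h : Addable μ i) :
    q ^ i * (q - 1) * ((∏ r ∈ Finset.range i, (q ^ (μ.rowLen r + i - r - μ.rowLen i - 1) - 1)) *
        ∏ j ∈ Finset.Ioo i (m + 1), (q ^ (μ.rowLen i + j - i - μ.rowLen j + 1) - 1)) =
    residue q m (rowNode q μ) i * (((∏ r ∈ Finset.range i,
        (q ^ (μ.rowLen r + i - r - μ.rowLen i) - 1)) *
        ∏ j ∈ Finset.Ioo i (m + 1), (q ^ (μ.rowLen i + j - i - μ.rowLen j) - 1)) *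
      (q ^ (μ.rowLen i + m - i + 1) - 1)) := by
  have q0 : q ≠ 0 := by positivity
  have anti : ∀ r, r < i → μ.rowLen i < μ.rowLen r := fun r hri => by
    rcases h with h | h
    · omega
    · have := μ.rowLen_anti r (i - 1) (by omega)
      omega
  set x := rowNode q μ with hx
  have x0 : ∀ j, x j ≠ 0 := fun j => zpow_ne_zero _ q0
  have hdiv : ∀ a b, x a / x b = q ^ ((μ.rowLen a : ℤ) - a - (μ.rowLen b - b)) := fun a b => by
    rw [hx, rowNode, rowNode, ← zpow_sub₀ q0]
  have d1 : ∀ r ∈ Finset.range i, q ^ (μ.rowLen r + i - r - μ.rowLen i) = x r / x i := by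
    intro r hr
    rw [Finset.mem_range] at hr
    have := anti r hr
    rw [hdiv, ← zpow_natCast]
    congr 1
    omega
  have d2 : ∀ r ∈ Finset.range i,
      q ^ (μ.rowLen r + i - r - μ.rowLen i - 1) = x r / (q * x i) := by
    intro r hr
    have h1 := d1 r hr
    rw [Finset.mem_range] at hr
    have := anti r hr
    obtain ⟨d, hd⟩ : ∃ d, μ.rowLen r + i - r - μ.rowLen i = d + 1 :=
      ⟨μ.rowLen r + i - r - μ.rowLen i - 1, by omega⟩
    rw [hd] at h1 ⊢
    rw [Nat.add_sub_cancel, mul_comm q, ← div_div, ← h1, pow_succ]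
    field_simp
  have d3 : ∀ j ∈ Finset.Ioo i (m + 1), q ^ (μ.rowLen i + j - i - μ.rowLen j) = x i / x j := by
    intro j hj
    rw [Finset.mem_Ioo] at hj
    have := μ.rowLen_anti i j hj.1.le
    rw [hdiv, ← zpow_natCast]
    congr 1
    omega
  have d4 : q ^ (μ.rowLen i + m - i + 1) = q ^ (m + 1) * x i := by
    rw [hx, rowNode, ← zpow_natCast q (m + 1), ← zpow_add₀ q0, ← zpow_natCast]
    congr 1
    omega
  have xm : x m = (q ^ m)⁻¹ := by
    rw [hx, rowNode, hm, ← zpow_natCast, ← zpow_neg]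
    congr 1
    simp
  have D1 : ∏ r ∈ Finset.range i, (q ^ (μ.rowLen r + i - r - μ.rowLen i) - 1) =
      ∏ r ∈ Finset.range i, (x r / x i - 1) :=
    Finset.prod_congr rfl fun r hr => by rw [d1 r hr]
  have D2 : ∏ r ∈ Finset.range i, (q ^ (μ.rowLen r + i - r - μ.rowLen i - 1) - 1) =
      ∏ r ∈ Finset.range i, (x r / (q * x i) - 1) :=
    Finset.prod_congr rfl fun r hr => by rw [d2 r hr]
  have D3 : ∏ j ∈ Finset.Ioo i (m + 1), (q ^ (μ.rowLen i + j - i - μ.rowLen j) - 1) =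
      ∏ j ∈ Finset.Ioo i (m + 1), (x i / x j - 1) :=
    Finset.prod_congr rfl fun r hr => by rw [d3 r hr]
  have D4 : ∏ j ∈ Finset.Ioo i (m + 1), (q ^ (μ.rowLen i + j - i - μ.rowLen j + 1) - 1) =
      ∏ j ∈ Finset.Ioo i (m + 1), (q * x i / x j - 1) :=
    Finset.prod_congr rfl fun r hr => by rw [pow_succ, d3 r hr]; ring
  have n1 : ∀ r ∈ Finset.range i, x r / x i - 1 ≠ 0 := by
    intro r hr
    rw [← d1 r hr]
    rw [Finset.mem_range] at hr
    have := anti r hr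
    exact (sub_pos.mpr (one_lt_pow₀ hq (by omega))).ne'
  have n3 : ∀ j ∈ Finset.Ioo i (m + 1), x i / x j - 1 ≠ 0 := by
    intro j hj
    rw [← d3 j hj]
    rw [Finset.mem_Ioo] at hj
    have := μ.rowLen_anti i j hj.1.le
    exact (sub_pos.mpr (one_lt_pow₀ hq (by omega))).ne'
  have split : ∀ f : ℕ → ℝ, ∏ r ∈ (Finset.range (m + 1)).erase i, f r =
      (∏ r ∈ Finset.range i, f r) * ∏ r ∈ Finset.Ioo i (m + 1), f r := by
    intro f
    have e : (Finset.range (m + 1)).erase i = Finset.range i ∪ Finset.Ioo i (m + 1) := by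
      ext j
      simp only [Finset.mem_erase, Finset.mem_range, Finset.mem_union, Finset.mem_Ioo]
      omega
    rw [e, Finset.prod_union]
    rw [Finset.disjoint_left]
    intro j hj hj'
    rw [Finset.mem_range] at hj
    rw [Finset.mem_Ioo] at hj'
    omega
  rw [D1, D2, D3, D4, d4]
  -- The numerator of the residue runs over j < m and includes j = i, the denominator over j ≤ m
  -- without i. The factor j = m is added here and cancelled by `last`, and the factor j = i is 1 -
  -- q⁻¹.
  have full : (∏ j ∈ Finset.range m, (1 - x j / (q * x i))) * (1 - x m / (q * x i)) =
      (1 - q⁻¹) * ∏ j ∈ (Finset.range (m + 1)).erase i, (1 - x j / (q * x i)) := by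
    rw [← Finset.prod_range_succ (fun j => 1 - x j / (q * x i)),
      ← Finset.mul_prod_erase _ _ (Finset.mem_range.mpr (show i < m + 1 by omega))]
    congr 1
    have := x0 i
    field_simp
  have last : q ^ (m + 1) * x i - 1 = (1 - x m / (q * x i)) * (q ^ (m + 1) * x i) := by
    have := x0 i
    rw [xm]
    field_simp
    ring
  have E1 : (∏ r ∈ Finset.range i, (1 - x r / (q * x i))) *
      ∏ r ∈ Finset.range i, (x r / x i - 1) =
      (∏ r ∈ Finset.range i, (x r / (q * x i) - 1)) *
        ∏ r ∈ Finset.range i, (1 - x r / x i) := by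
    rw [← Finset.prod_mul_distrib, ← Finset.prod_mul_distrib]
    exact Finset.prod_congr rfl fun r _ => by ring
  have E2 : q ^ (m - i) * ((∏ r ∈ Finset.Ioo i (m + 1), (1 - x r / (q * x i))) *
      ∏ r ∈ Finset.Ioo i (m + 1), (x i / x r - 1)) =
      (∏ r ∈ Finset.Ioo i (m + 1), (q * x i / x r - 1)) *
        ∏ r ∈ Finset.Ioo i (m + 1), (1 - x r / x i) := by
    have : (Finset.Ioo i (m + 1)).card = m - i := by rw [Nat.card_Ioo]; omega
    rw [← this, ← Finset.prod_const, ← Finset.prod_mul_distrib, ← Finset.prod_mul_distrib,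
      ← Finset.prod_mul_distrib]
    refine Finset.prod_congr rfl fun r _ => ?_
    have := x0 i
    have := x0 r
    field_simp
  have N1 : ∏ r ∈ Finset.range i, (1 - x r / x i) ≠ 0 :=
    Finset.prod_ne_zero_iff.mpr fun r hr h0 => n1 r hr (by linarith)
  have N2 : ∏ r ∈ Finset.Ioo i (m + 1), (1 - x r / x i) ≠ 0 := by
    refine Finset.prod_ne_zero_iff.mpr fun r hr h0 => n3 r hr ?_
    have h1 := x0 i
    have h2 := x0 r
    field_simp at h0 ⊢
    linarith
  have hqi : q ^ m = q ^ (m - i) * q ^ i := by rw [← pow_add]; congr 1; omega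
  rw [residue, last, split]
  set a1 := ∏ r ∈ Finset.range i, (x r / (q * x i) - 1)
  set a2 := ∏ j ∈ Finset.Ioo i (m + 1), (q * x i / x j - 1)
  set b1 := ∏ r ∈ Finset.range i, (x r / x i - 1)
  set b2 := ∏ j ∈ Finset.Ioo i (m + 1), (x i / x j - 1)
  set c1 := ∏ r ∈ Finset.range i, (1 - x r / x i)
  set c2 := ∏ r ∈ Finset.Ioo i (m + 1), (1 - x r / x i)
  rw [split] at full
  set e1 := ∏ r ∈ Finset.range i, (1 - x r / (q * x i))
  set e2 := ∏ r ∈ Finset.Ioo i (m + 1), (1 - x r / (q * x i))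
  set f := ∏ j ∈ Finset.range m, (1 - x j / (q * x i))
  have xi := x0 i
  have : (x i)⁻¹ * f / (c1 * c2) * (b1 * b2 * ((1 - x m / (q * x i)) * (q ^ (m + 1) * x i))) =
      (f * (1 - x m / (q * x i))) * (b1 * b2) * q ^ (m + 1) / (c1 * c2) := by
    field_simp
  rw [this, full, eq_div_iff (mul_ne_zero N1 N2)]
  have hq1 : (1 - q⁻¹) * q ^ (m + 1) = (q - 1) * (q ^ (m - i) * q ^ i) := by
    rw [← hqi, pow_succ]; field_simp
  calc _ = q ^ i * (q - 1) * ((a1 * c1) * (a2 * c2)) := by ring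
    _ = (q - 1) * (q ^ (m - i) * q ^ i) * ((e1 * b1) * (e2 * b2)) := by rw [← E1, ← E2]; ring
    _ = _ := by rw [← hq1]; ring

theorem prod_hooks_pow (q : ℝ) (μ : YoungDiagram) :
    (∏ b ∈ μ.cells, qInt q (hookLength μ b)) * (q - 1) ^ μ.card =
      ∏ b ∈ μ.cells, (q ^ hookLength μ b - 1) := by
  rw [YoungDiagram.card, ← Finset.prod_const, ← Finset.prod_mul_distrib]
  exact Finset.prod_congr rfl fun b _ => qInt_mul_sub_one _ _

/-- The residue at row i is the transition probability of the growth of diagrams up to normalization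
by the number of tableaux: both the hook quotient and the residue have been expressed by the same
differences of β-numbers. The spare factor q - 1 comes from the one additional hook, and q^i from
the change of n(μ). -/
theorem shapeWeight_addBox {q : ℝ} (hq : 1 < q) (μ : YoungDiagram) {m i : ℕ}
    (hm : μ.rowLen m = 0) (him : i ≤ m) (h : Addable μ i) :
    shapeWeight q (addBox μ i h) = shapeWeight q μ * residue q m (rowNode q μ) i := by
  have hF : ∀ k, 0 < k → q ^ k - 1 ≠ 0 := fun k hk =>
    (sub_pos.mpr (one_lt_pow₀ hq hk.ne')).ne'
  have A := prod_rows_addBox (fun k => q ^ k - 1) hF μ hm him h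
  have B := residue_mul hq μ hm him h
  have hμ := prod_hooks_pow q μ
  have hν := prod_hooks_pow q (addBox μ i h)
  have q1 : q - 1 ≠ 0 := (sub_pos.mpr hq).ne'
  have pμ := (prod_qInt_hooks_pos (by positivity : 0 < q) μ).ne'
  have pν := (prod_qInt_hooks_pos (by positivity : 0 < q) (addBox μ i h)).ne'
  rw [shapeWeight, shapeWeight, nStat_addBox]
  rw [← hμ, ← hν, card_addBox] at A
  have nz : ((∏ r ∈ Finset.range i, (q ^ (μ.rowLen r + i - r - μ.rowLen i) - 1)) *
        ∏ j ∈ Finset.Ioo i (m + 1), (q ^ (μ.rowLen i + j - i - μ.rowLen j) - 1)) *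
      (q ^ (μ.rowLen i + m - i + 1) - 1) ≠ 0 := by
    refine mul_ne_zero (mul_ne_zero (Finset.prod_ne_zero_iff.mpr fun r hr => hF _ ?_)
      (Finset.prod_ne_zero_iff.mpr fun r hr => hF _ ?_)) (hF _ (Nat.succ_pos _))
    · rw [Finset.mem_range] at hr
      have := μ.rowLen_anti r i hr.le
      omega
    · rw [Finset.mem_Ioo] at hr
      have := μ.rowLen_anti i r hr.1.le
      omega
  set U := ∏ b ∈ (addBox μ i h).cells, qInt q (hookLength (addBox μ i h) b)
  set V := ∏ b ∈ μ.cells, qInt q (hookLength μ b)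
  set N := (∏ r ∈ Finset.range i, (q ^ (μ.rowLen r + i - r - μ.rowLen i - 1) - 1)) *
        ∏ j ∈ Finset.Ioo i (m + 1), (q ^ (μ.rowLen i + j - i - μ.rowLen j + 1) - 1)
  set D := (∏ r ∈ Finset.range i, (q ^ (μ.rowLen r + i - r - μ.rowLen i) - 1)) *
        ∏ j ∈ Finset.Ioo i (m + 1), (q ^ (μ.rowLen i + j - i - μ.rowLen j) - 1)
  set E := q ^ (μ.rowLen i + m - i + 1) - 1
  have A' : U * (q - 1) * N = V * (D * E) := by
    apply mul_right_cancel₀ (pow_ne_zero μ.card q1)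
    rw [pow_succ] at A
    linear_combination A
  rw [pow_add, div_mul_eq_mul_div, div_eq_div_iff pν pμ]
  apply mul_right_cancel₀ nz
  linear_combination (-(q ^ nStat μ) * q ^ i) * A' + (q ^ nStat μ * U) * B

/-- When rows i - 1 and i have equal length, x_{i-1} = q x_i and a factor of the numerator vanishes.
The partial fraction over all rows is thus a sum over addable boxes. -/
theorem residue_eq_zero {q : ℝ} (hq : 1 < q) (μ : YoungDiagram) {m i : ℕ} (him : i ≤ m)
    (h : ¬ Addable μ i) : residue q m (rowNode q μ) i = 0 := by
  have q0 : q ≠ 0 := by positivity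
  have h1 : i ≠ 0 := fun h0 => h (Or.inl h0)
  have h2 : μ.rowLen (i - 1) ≤ μ.rowLen i := not_lt.mp fun h0 => h (Or.inr h0)
  have h3 := μ.rowLen_anti (i - 1) i (Nat.sub_le _ _)
  have : rowNode q μ (i - 1) = q * rowNode q μ i := by
    rw [rowNode, rowNode, ← zpow_one_add₀ q0]
    congr 1
    omega
  rw [residue, Finset.prod_eq_zero (Finset.mem_range.mpr (show i - 1 < m by omega)), mul_zero,
    zero_div]
  have hx : rowNode q μ i ≠ 0 := zpow_ne_zero _ q0
  rw [this, div_self (mul_ne_zero q0 hx), sub_self]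

open PowerSeries in
open Classical in
/-- The moments of the transition distribution. -/
theorem sum_covers_pow {q : ℝ} (hq : 1 < q) {n : ℕ} (μ : Shape n) {g : ℝ⟦X⟧}
    (hg : g * ((lin 1) * ∏ b ∈ μ.1.cells,
      (lin (q ^ (content b - 1)) * lin (q ^ (content b + 1)))) =
      X * ∏ b ∈ μ.1.cells, lin (q ^ content b) ^ 2) (k : ℕ) :
    ∑ ν : Shape (n + 1) with μ.1 ≤ ν.1,
        shapeWeight q ν.1 * (q ^ (contentSum ν.1 - contentSum μ.1)) ^ k =
      shapeWeight q μ.1 * coeff k (1 + g) := by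
  have q0 : q ≠ 0 := by positivity
  have hm := rowLen_colLen_zero μ.1
  set m := μ.1.colLen 0
  have tm := transition_mul hm hg
  have anti : StrictAnti (rowNode q μ.1) := by
    intro a b hab
    have := μ.1.rowLen_anti a b hab.le
    exact zpow_lt_zpow_right₀ hq (by omega)
  have key := sum_residue_geom (q := q) q0 (m := m) (x := rowNode q μ.1) (g := g)
    (fun i => zpow_ne_zero _ q0) anti.injective.injOn
    (by rw [rowNode, hm, ← zpow_natCast, ← zpow_neg]; congr 1; simp)
    (by
      refine tm.trans (congrArg _ (Finset.prod_congr rfl fun i _ => ?_))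
      rw [rowNode, zpow_sub_one₀ q0, div_eq_mul_inv])
  rw [sum_covers μ hm
    (fun ν => shapeWeight q ν * (q ^ (contentSum ν - contentSum μ.1)) ^ k), key, map_sum,
    Finset.mul_sum]
  refine Finset.sum_congr rfl fun i hi => ?_
  have him : i ≤ m := Nat.lt_succ_iff.mp (Finset.mem_range.mp hi)
  rw [coeff_C_mul, coeff_geom]
  split_ifs with h
  · rw [shapeWeight_addBox hq μ.1 hm him h, contentSum_addBox, rowNode]
    ring
  · rw [residue_eq_zero hq μ.1 him h, zero_mul, mul_zero]

end AddBoxWeight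

/-! ### Standard tableaux -/

section Tableaux

variable {n : ℕ}

/-- The box of the tableau `S` which contains `k`. -/
def boxOf {μ : Shape n} (S : StandardTableau μ) (k : ℕ) : ℕ × ℕ :=
  if h : k ∈ Finset.Icc 1 n then (S.1.symm ⟨k, h⟩ : μ.1.cells) else (0, 0)

theorem boxOf_eq {μ : Shape n} (S : StandardTableau μ) (b : μ.1.cells) :
    boxOf S (S.1 b : ℕ) = b := by
  rw [boxOf, dif_pos (S.1 b).2]
  simp

theorem lastBox_eq (hn : 1 ≤ n) {μ : Shape n} (S : StandardTableau μ) :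
    lastBox hn S = boxOf S n := by
  rw [boxOf, dif_pos (Finset.mem_Icc.mpr ⟨hn, le_rfl⟩), lastBox]

theorem prod_boxOf {R : Type*} [CommMonoid R] {μ : Shape n} (S : StandardTableau μ)
    (F : ℕ × ℕ → R) :
    ∏ k ∈ Finset.range n, F (boxOf S (k + 1)) = ∏ b ∈ μ.1.cells, F b := by
  have h1 : ∏ k ∈ Finset.range n, F (boxOf S (k + 1)) =
      ∏ k ∈ Finset.Icc 1 n, F (boxOf S k) := by
    rw [Finset.range_eq_Ico, Finset.prod_Ico_add' (fun k => F (boxOf S k)) 0 n 1]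
    rfl
  rw [h1, ← Finset.prod_coe_sort, ← Finset.prod_coe_sort μ.1.cells, ← Equiv.prod_comp S.1]
  exact Finset.prod_congr rfl fun b _ => by rw [boxOf_eq]

theorem boxOf_mem {μ : Shape n} (S : StandardTableau μ) {k : ℕ} (hk : k ∈ Finset.Icc 1 n) :
    boxOf S k ∈ μ.1.cells := by
  rw [boxOf, dif_pos hk]
  exact (S.1.symm ⟨k, hk⟩).2

theorem card_sdiff_shape {μ : Shape n} {ν : Shape (n + 1)} (h : μ.1 ≤ ν.1) :
    (ν.1.cells \ μ.1.cells).card = 1 := by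
  rw [Finset.card_sdiff_of_subset h]
  have h1 : ν.1.cells.card = n + 1 := ν.2
  have h2 : μ.1.cells.card = n := μ.2
  omega

theorem eq_of_mem_sdiff_shape {μ : Shape n} {ν : Shape (n + 1)} (h : μ.1 ≤ ν.1) {b c : ℕ × ℕ}
    (hb : b ∈ ν.1.cells) (hb' : b ∉ μ.1.cells) (hc : c ∈ ν.1.cells) (hc' : c ∉ μ.1.cells) :
    b = c :=
  Finset.card_le_one.mp (card_sdiff_shape h).le b (Finset.mem_sdiff.mpr ⟨hb, hb'⟩) c
    (Finset.mem_sdiff.mpr ⟨hc, hc'⟩)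

open Classical in
/-- Putting `n + 1` into the box of `ν` which does not belong to `μ`. -/
noncomputable def extendFun {μ : Shape n} {ν : Shape (n + 1)} (S : StandardTableau μ)
    (b : ν.1.cells) : Finset.Icc 1 (n + 1) :=
  if h : b.1 ∈ μ.1.cells then ⟨S.1 ⟨b.1, h⟩, by
    have := Finset.mem_Icc.mp (S.1 ⟨b.1, h⟩).2
    exact Finset.mem_Icc.mpr ⟨this.1, by omega⟩⟩
  else ⟨n + 1, Finset.mem_Icc.mpr ⟨by omega, le_rfl⟩⟩

theorem extendFun_of_mem {μ : Shape n} {ν : Shape (n + 1)} (S : StandardTableau μ)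
    (b : ν.1.cells) (h : b.1 ∈ μ.1.cells) :
    (extendFun S b : ℕ) = S.1 ⟨b.1, h⟩ := by
  rw [extendFun, dif_pos h]

theorem extendFun_of_notMem {μ : Shape n} {ν : Shape (n + 1)} (S : StandardTableau μ)
    (b : ν.1.cells) (h : b.1 ∉ μ.1.cells) : (extendFun S b : ℕ) = n + 1 := by
  rw [extendFun, dif_neg h]

theorem extendFun_bijective {μ : Shape n} {ν : Shape (n + 1)} (hle : μ.1 ≤ ν.1)
    (S : StandardTableau μ) : Function.Bijective (extendFun (ν := ν) S) := by
  rw [Fintype.bijective_iff_injective_and_card]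
  constructor
  · intro b c hbc
    have hbc' : (extendFun S b : ℕ) = extendFun S c := by rw [hbc]
    by_cases hb : b.1 ∈ μ.1.cells <;> by_cases hc : c.1 ∈ μ.1.cells
    · rw [extendFun_of_mem S b hb, extendFun_of_mem S c hc] at hbc'
      have := S.1.injective (Subtype.ext hbc')
      exact Subtype.ext (Subtype.mk.inj this)
    · rw [extendFun_of_mem S b hb, extendFun_of_notMem S c hc] at hbc'
      have := (Finset.mem_Icc.mp (S.1 ⟨b.1, hb⟩).2).2
      omega
    · rw [extendFun_of_notMem S b hb, extendFun_of_mem S c hc] at hbc'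
      have := (Finset.mem_Icc.mp (S.1 ⟨c.1, hc⟩).2).2
      omega
    · exact Subtype.ext (eq_of_mem_sdiff_shape hle b.2 hb c.2 hc)
  · have h1 : ν.1.cells.card = n + 1 := ν.2
    simp [h1]

theorem extendFun_lt {μ : Shape n} {ν : Shape (n + 1)} (hle : μ.1 ≤ ν.1)
    (S : StandardTableau μ) (b c : ν.1.cells) (hbc : b.1 ≤ c.1) (hne : b.1 ≠ c.1)
    (hS : ∀ hb : b.1 ∈ μ.1.cells, ∀ hc : c.1 ∈ μ.1.cells,
      (S.1 ⟨b.1, hb⟩ : ℕ) < S.1 ⟨c.1, hc⟩) : (extendFun S b : ℕ) < extendFun S c := by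
  by_cases hc : c.1 ∈ μ.1.cells
  · have hb : b.1 ∈ μ.1.cells := μ.1.isLowerSet hbc hc
    rw [extendFun_of_mem S b hb, extendFun_of_mem S c hc]
    exact hS hb hc
  · have hb : b.1 ∈ μ.1.cells := by
      by_contra hb
      exact hne (eq_of_mem_sdiff_shape hle b.2 hb c.2 hc)
    rw [extendFun_of_mem S b hb, extendFun_of_notMem S c hc]
    have := (Finset.mem_Icc.mp (S.1 ⟨b.1, hb⟩).2).2
    omega

/-- The extension of a standard tableau by one box. -/
noncomputable def extendTableau {μ : Shape n} {ν : Shape (n + 1)} (hle : μ.1 ≤ ν.1)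
    (S : StandardTableau μ) : StandardTableau ν :=
  ⟨Equiv.ofBijective _ (extendFun_bijective hle S), by
    constructor
    · intro b c h1 h2
      exact extendFun_lt hle S b c ⟨h1.le, h2.le⟩ (fun h => by rw [h] at h2; exact lt_irrefl _ h2)
        fun hb hc => S.2.1 _ _ h1 h2
    · intro b c h1 h2
      exact extendFun_lt hle S b c ⟨h2.le, h1.le⟩ (fun h => by rw [h] at h2; exact lt_irrefl _ h2)
        fun hb hc => S.2.2 _ _ h1 h2⟩

theorem boxOf_extendTableau {μ : Shape n} {ν : Shape (n + 1)} (hle : μ.1 ≤ ν.1)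
    (S : StandardTableau μ) {k : ℕ} (hk : k ∈ Finset.Icc 1 n) :
    boxOf (extendTableau hle S) k = boxOf S k := by
  have hm := boxOf_mem S hk
  have hb : boxOf S k ∈ ν.1.cells := hle hm
  have : ((extendTableau hle S).1 ⟨boxOf S k, hb⟩ : ℕ) = k := by
    change (extendFun S ⟨boxOf S k, hb⟩ : ℕ) = k
    rw [extendFun_of_mem S _ hm]
    have e : (⟨boxOf S k, hm⟩ : μ.1.cells) = S.1.symm ⟨k, hk⟩ := by
      apply Subtype.ext
      simp only [boxOf, dif_pos hk]
    rw [e]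
    simp
  have h2 := boxOf_eq (extendTableau hle S) ⟨boxOf S k, hb⟩
  rw [this] at h2
  exact h2

theorem content_boxOf_extendTableau {μ : Shape n} {ν : Shape (n + 1)} (hle : μ.1 ≤ ν.1)
    (S : StandardTableau μ) :
    content (boxOf (extendTableau hle S) (n + 1)) = contentSum ν.1 - contentSum μ.1 := by
  obtain ⟨b, hb⟩ := Finset.card_eq_one.mp (card_sdiff_shape hle)
  have hmem : b ∈ ν.1.cells \ μ.1.cells := by rw [hb]; exact Finset.mem_singleton_self b
  obtain ⟨h1, h2⟩ := Finset.mem_sdiff.mp hmem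
  have : ((extendTableau hle S).1 ⟨b, h1⟩ : ℕ) = n + 1 := extendFun_of_notMem S _ h2
  have h3 := boxOf_eq (extendTableau hle S) ⟨b, h1⟩
  rw [this] at h3
  rw [h3, contentSum, contentSum, ← Finset.sum_sdiff (show μ.1.cells ⊆ ν.1.cells from hle), hb,
    Finset.sum_singleton]
  ring

/-- The inverse deletes the box of the largest entry, which is a corner because nothing can follow
it in its row or column. -/
theorem extendTableau_bijective (ν : Shape (n + 1)) :
    Function.Bijective (fun x : (Σ μ : {μ : Shape n // μ.1 ≤ ν.1}, StandardTableau μ.1) =>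
      extendTableau x.1.2 x.2) := by
  constructor
  · rintro ⟨⟨μ, hμ⟩, S⟩ ⟨⟨μ', hμ'⟩, S'⟩ h
    have hf : ∀ b : ν.1.cells, (extendFun S b : ℕ) = extendFun S' b := fun b => by
      have := congrArg (fun T : StandardTableau ν => (T.1 b : ℕ)) h
      exact this
    have hsub : ∀ {μ μ' : Shape n} (_ : μ.1 ≤ ν.1) (S : StandardTableau μ)
        (S' : StandardTableau μ'), (∀ b : ν.1.cells, (extendFun S b : ℕ) = extendFun S' b) →
        μ.1.cells ⊆ μ'.1.cells := by
      intro μ μ' hμ S S' hf b hb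
      by_contra hb'
      have := hf ⟨b, hμ hb⟩
      rw [extendFun_of_mem S _ hb, extendFun_of_notMem S' _ hb'] at this
      have h2 : (S.1 ⟨b, hb⟩ : ℕ) ≤ n := (Finset.mem_Icc.mp (S.1 ⟨b, hb⟩).2).2
      dsimp only at this h2
      omega
    have hcells : μ.1.cells = μ'.1.cells :=
      Finset.Subset.antisymm (hsub hμ S S' hf) (hsub hμ' S' S fun b => (hf b).symm)
    obtain rfl : μ = μ' := Subtype.ext (YoungDiagram.ext hcells)
    congr 1
    apply Subtype.ext
    apply Equiv.ext
    intro b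
    apply Subtype.ext
    have := hf ⟨b.1, hμ b.2⟩
    rwa [extendFun_of_mem S _ b.2, extendFun_of_mem S' _ b.2] at this
  · intro T
    set b0 := boxOf T (n + 1) with hb0
    have hn : n + 1 ∈ Finset.Icc 1 (n + 1) := Finset.mem_Icc.mpr ⟨by omega, le_rfl⟩
    have hb0m : b0 ∈ ν.1.cells := boxOf_mem T hn
    have hT0 : (T.1 ⟨b0, hb0m⟩ : ℕ) = n + 1 := by
      have e : (⟨b0, hb0m⟩ : ν.1.cells) = T.1.symm ⟨n + 1, hn⟩ := by
        apply Subtype.ext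
        simp only [hb0, boxOf, dif_pos hn]
      rw [e]
      simp
    have hTeq : ∀ b : ν.1.cells, b.1 = b0 → (T.1 b : ℕ) = n + 1 := fun b hb =>
      (congrArg (fun c => (T.1 c : ℕ)) (show b = ⟨b0, hb0m⟩ from Subtype.ext hb)).trans hT0
    have hle : ∀ b : ν.1.cells, (T.1 b : ℕ) ≤ n + 1 := fun b => (Finset.mem_Icc.mp (T.1 b).2).2
    let μ : YoungDiagram := ⟨ν.1.cells.erase b0, by
      rintro ⟨a1, a2⟩ ⟨c1, c2⟩ hca ha
      obtain ⟨h1, h2⟩ : c1 ≤ a1 ∧ c2 ≤ a2 := hca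
      rw [Finset.mem_coe, Finset.mem_erase] at ha ⊢
      have hc : (c1, c2) ∈ ν.1.cells := ν.1.up_left_mem h1 h2 ha.2
      refine ⟨fun hcb => ?_, hc⟩
      -- the box of the largest entry has no boxes below it or to its right
      have hmid : (c1, a2) ∈ ν.1.cells := ν.1.up_left_mem h1 le_rfl ha.2
      have hTc : (T.1 ⟨(c1, c2), hc⟩ : ℕ) = n + 1 := hTeq _ hcb
      rcases Nat.lt_or_ge c2 a2 with h3 | h3
      · have := T.2.1 ⟨(c1, c2), hc⟩ ⟨(c1, a2), hmid⟩ rfl h3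
        have := hle ⟨(c1, a2), hmid⟩
        omega
      · obtain rfl : c2 = a2 := le_antisymm h2 h3
        rcases Nat.lt_or_ge c1 a1 with h4 | h4
        · have := T.2.2 ⟨(c1, c2), hc⟩ ⟨(a1, c2), ha.2⟩ rfl h4
          have := hle ⟨(a1, c2), ha.2⟩
          omega
        · obtain rfl : c1 = a1 := le_antisymm h1 h4
          exact ha.1 hcb⟩
    have hμcard : μ.card = n := by
      have h1 : ν.1.cells.card = n + 1 := ν.2
      have h2 : μ.card = ν.1.cells.card - 1 := Finset.card_erase_of_mem hb0m
      omega
    have hμν : μ ≤ ν.1 := Finset.erase_subset _ _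
    have hlt : ∀ b (hb : b ∈ μ.cells), (T.1 ⟨b, hμν hb⟩ : ℕ) ∈ Finset.Icc 1 n := by
      intro b hb
      have h1 := Finset.mem_Icc.mp (T.1 ⟨b, hμν hb⟩).2
      refine Finset.mem_Icc.mpr ⟨h1.1, ?_⟩
      have h2 : (T.1 ⟨b, hμν hb⟩ : ℕ) ≠ n + 1 := by
        intro h
        have := T.1.injective (Subtype.ext (h.trans hT0.symm))
        exact (Finset.mem_erase.mp hb).1 (Subtype.mk.inj this)
      omega
    let f : μ.cells → Finset.Icc 1 n := fun b => ⟨T.1 ⟨b.1, hμν b.2⟩, hlt b.1 b.2⟩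
    have hf : Function.Bijective f := by
      rw [Fintype.bijective_iff_injective_and_card]
      refine ⟨fun b c hbc => ?_, ?_⟩
      · have h1 : (T.1 ⟨b.1, hμν b.2⟩ : ℕ) = T.1 ⟨c.1, hμν c.2⟩ :=
          congrArg (fun x : Finset.Icc 1 n => (x : ℕ)) hbc
        have := T.1.injective (Subtype.ext h1)
        exact Subtype.ext (Subtype.mk.inj this)
      · have h1 : μ.cells.card = n := hμcard
        simp [h1]
    let S : StandardTableau (⟨μ, hμcard⟩ : Shape n) := ⟨Equiv.ofBijective f hf,
      fun b c h1 h2 => T.2.1 ⟨b.1, hμν b.2⟩ ⟨c.1, hμν c.2⟩ h1 h2,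
      fun b c h1 h2 => T.2.2 ⟨b.1, hμν b.2⟩ ⟨c.1, hμν c.2⟩ h1 h2⟩
    refine ⟨⟨⟨⟨μ, hμcard⟩, hμν⟩, S⟩, ?_⟩
    apply Subtype.ext
    apply Equiv.ext
    intro b
    apply Subtype.ext
    change (extendFun S b : ℕ) = T.1 b
    by_cases hb : b.1 ∈ μ.cells
    · rw [extendFun_of_mem S b hb]
      rfl
    · rw [extendFun_of_notMem S b hb]
      have : b.1 = b0 := by
        by_contra h
        exact hb (Finset.mem_erase.mpr ⟨h, b.2⟩)
      exact (hTeq b this).symm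

open Classical in
/-- Sums over standard tableaux, by the position of the largest entry. -/
theorem sum_tableaux_succ {R : Type*} [AddCommMonoid R] (ν : Shape (n + 1))
    (f : StandardTableau ν → R) :
    ∑ T : StandardTableau ν, f T =
      ∑ μ : Shape n, if h : μ.1 ≤ ν.1 then ∑ S : StandardTableau μ, f (extendTableau h S)
        else 0 := by
  rw [← Equiv.sum_comp (Equiv.ofBijective _ (extendTableau_bijective ν)) f, Fintype.sum_sigma,
    ← Finset.sum_filter_add_sum_filter_not Finset.univ (fun μ : Shape n => μ.1 ≤ ν.1),
    Finset.sum_eq_zero (s := Finset.filter (fun μ : Shape n => ¬ μ.1 ≤ ν.1) _)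
      (fun i hi => dif_neg (Finset.mem_filter.mp hi).2), add_zero]
  rw [← Finset.sum_subtype_of_mem (p := fun μ : Shape n => μ.1 ≤ ν.1)
    (fun μ : Shape n => if h : μ.1 ≤ ν.1 then ∑ S : StandardTableau μ, f (extendTableau h S)
        else 0) (fun x hx => (Finset.mem_filter.mp hx).2)]
  have : Finset.subtype (fun μ : Shape n => μ.1 ≤ ν.1)
      (Finset.filter (fun μ : Shape n => μ.1 ≤ ν.1) Finset.univ) = Finset.univ := by
    ext μ
    simp [μ.2]
  rw [this]
  refine Finset.sum_congr rfl fun μ _ => ?_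
  rw [dif_pos μ.2]
  rfl

/-- The vector of the numbers `q^c`, for the contents `c` of the boxes of a tableau. -/
noncomputable def contentVec (q : ℝ) {μ : Shape n} (S : StandardTableau μ) (k : ℕ) : ℝ :=
  q ^ content (boxOf S (k + 1))

end Tableaux

/-! ### The joint distribution of the Jucys–Murphy elements -/

section Spectral
open PowerSeries

theorem polysUpTo_succ_le (n : ℕ) {f : MvPolynomial ℕ ℝ} (hf : f ∈ polysUpTo (n + 1)) :
    f ∈ Submodule.span ℝ {x | ∃ g ∈ polysUpTo n, ∃ m : ℕ, x = g * MvPolynomial.X n ^ m} := by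
  set B := {x | ∃ g ∈ polysUpTo n, ∃ m : ℕ, x = g * (MvPolynomial.X n : MvPolynomial ℕ ℝ) ^ m}
  induction hf using Algebra.adjoin_induction with
  | mem y hy =>
    obtain ⟨j, hj, rfl⟩ := hy
    have hj' : j < n + 1 := hj
    apply Submodule.subset_span
    rcases Nat.lt_or_ge j n with h | h
    · exact ⟨_, X_mem_polysUpTo h, 0, by simp⟩
    · obtain rfl : j = n := by omega
      exact ⟨1, one_mem _, 1, by simp⟩
  | algebraMap c =>
    exact Submodule.subset_span ⟨_, algebraMap_mem _ c, 0, by simp⟩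
  | add a b _ _ ha hb => exact add_mem ha hb
  | mul a b _ _ ha hb =>
    have h := Submodule.mul_mem_mul ha hb
    rw [Submodule.span_mul_span] at h
    refine Submodule.span_mono ?_ h
    rintro _ ⟨_, ⟨g, hg, m, rfl⟩, _, ⟨g', hg', m', rfl⟩, rfl⟩
    exact ⟨g * g', mul_mem hg hg', m + m', by ring⟩

theorem eval_congr_polysUpTo {n : ℕ} {f : MvPolynomial ℕ ℝ} (hf : f ∈ polysUpTo n)
    {y z : ℕ → ℝ} (h : ∀ k < n, y k = z k) :
    MvPolynomial.eval y f = MvPolynomial.eval z f := by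
  induction hf using Algebra.adjoin_induction with
  | mem x hx =>
    obtain ⟨j, hj, rfl⟩ := hx
    rw [MvPolynomial.eval_X, MvPolynomial.eval_X, h j hj]
  | algebraMap c => simp
  | add a b _ _ ha hb => rw [map_add, map_add, ha, hb]
  | mul a b _ _ ha hb => rw [map_mul, map_mul, ha, hb]

theorem eval_momentSeries_mul (p : ℝ) (y : ℕ → ℝ) (n : ℕ) :
    PowerSeries.map (MvPolynomial.eval y) (momentSeries p n) *
      (lin 1 * ∏ k ∈ Finset.range n, (lin (p * y k) * lin (p⁻¹ * y k))) =
    X * ∏ k ∈ Finset.range n, lin (y k) ^ 2 := by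
  induction n with
  | zero =>
    rw [momentSeries, map_mul, map_geom, PowerSeries.map_X, map_one]
    simp only [Finset.range_zero, Finset.prod_empty, mul_one]
    rw [mul_assoc, mul_comm (geom 1), lin_mul_geom, mul_one]
  | succ n ih =>
    have h := congrArg (PowerSeries.map (MvPolynomial.eval y)) (momentSeries_succ_mul (p := p) n)
    simp only [map_mul, map_pow, map_sub, map_one, PowerSeries.map_X, PowerSeries.map_C,
      MvPolynomial.smul_eval, MvPolynomial.eval_X] at h
    rw [Finset.prod_range_succ, Finset.prod_range_succ]
    simp only [← map_mul] at h
    change _ * (lin (p * y n) * lin (p⁻¹ * y n)) = _ * (lin (y n)) ^ 2 at h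
    calc _ = (PowerSeries.map (MvPolynomial.eval y) (momentSeries p (n + 1)) *
          (lin (p * y n) * lin (p⁻¹ * y n))) *
          (lin 1 * ∏ k ∈ Finset.range n, (lin (p * y k) * lin (p⁻¹ * y k))) := by ring
      _ = (PowerSeries.map (MvPolynomial.eval y) (momentSeries p n) *
          (lin 1 * ∏ k ∈ Finset.range n, (lin (p * y k) * lin (p⁻¹ * y k)))) *
            lin (y n) ^ 2 := by rw [h]; ring
      _ = _ := by rw [ih]; ring

theorem contentVec_extendTableau (q : ℝ) {n : ℕ} {μ : Shape n} {ν : Shape (n + 1)}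
    (hle : μ.1 ≤ ν.1) (S : StandardTableau μ) :
    (∀ k < n, contentVec q (extendTableau hle S) k = contentVec q S k) ∧
    contentVec q (extendTableau hle S) n = q ^ (contentSum ν.1 - contentSum μ.1) := by
  constructor
  · intro k hk
    rw [contentVec, contentVec, boxOf_extendTableau hle S (Finset.mem_Icc.mpr ⟨by omega, hk⟩)]
  · rw [contentVec, content_boxOf_extendTableau]

theorem card_shape_zero (μ : Shape 0) : μ.1 = ⊥ := by
  apply YoungDiagram.ext
  exact Finset.card_eq_zero.mp μ.2

instance : Unique (Shape 0) where
  default := ⟨⊥, rfl⟩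
  uniq μ := Subtype.ext (card_shape_zero μ)

instance (μ : Shape 0) : Unique (StandardTableau μ) :=
  have hE : IsEmpty μ.1.cells := by
    rw [card_shape_zero μ]
    exact ⟨fun b => YoungDiagram.notMem_bot _ b.2⟩
  have hE' : IsEmpty (Finset.Icc 1 0) := ⟨fun b => absurd b.2 (by simp)⟩
  { default := ⟨Equiv.equivOfIsEmpty _ _, fun b => hE.elim b, fun b => hE.elim b⟩
    uniq := fun S => Subtype.ext (Equiv.ext fun b => hE.elim b) }

theorem shapeWeight_bot (q : ℝ) : shapeWeight q ⊥ = 1 := by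
  have h : ∀ i, (⊥ : YoungDiagram).rowLen i = 0 := fun i => by
    by_contra h0
    exact YoungDiagram.notMem_bot _ (YoungDiagram.mem_iff_lt_rowLen.mpr (Nat.pos_of_ne_zero h0))
  simp [shapeWeight, nStat, h]

variable {A : Type*} [Ring A] [Algebra ℝ A] {p : ℝ} {M : ℕ} {t : ℕ → A}

/-- Multiplying by earlier elements keeps the complement stable, and τ vanishes on it. Hence under τ
a power of J_k can be replaced by its conditional moment, even next to a polynomial in the earlier
Jucys–Murphy elements. -/
theorem map_complement_eq_zero {τ : A →ₗ[ℝ] ℝ}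
    (hτ : ∀ k < M, ∀ a ∈ parabolic t k, ∀ b ∈ parabolic t k, τ (a * t k * b) = 0)
    {k : ℕ} (hk : k ≤ M) {a w : A} (ha : a ∈ parabolic t (k - 1)) (hw : w ∈ complement t k) :
    τ (a * w) = 0 := by
  cases k with
  | zero =>
    have : w = 0 := by simpa [complement] using hw
    simp [this]
  | succ k =>
    have h := mul_complement w hw a ha
    clear hw
    generalize a * w = x at h
    induction h using Submodule.span_induction with
    | mem x hx =>
      obtain ⟨b, hb, c, hc, rfl⟩ := hx
      exact hτ k hk b hb c hc
    | zero => simp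
    | add x y _ _ hx hy => rw [map_add, hx, hy, add_zero]
    | smul c x _ hx => rw [map_smul, hx, smul_zero]

/-- Induction on the number of variables. A power X_n^m is replaced by its conditional moment, a
polynomial in the earlier variables to which the induction hypothesis applies. On a tableau of shape
μ this moment is the sum of q^{mc} over the boxes that can be added, weighted by w(ν)/w(μ); these
boxes are the ways to extend the tableau. The condition p < 1 makes q > 1, so that the nodes are
distinct. -/
theorem HeckeRel.trace_eval (h : HeckeRel p M t) (hp0 : 0 < p) (hp1 : p < 1)
    {φ : MvPolynomial ℕ ℝ →ₐ[ℝ] A} (hφ : ∀ k ≤ M, φ (MvPolynomial.X k) = jucysMurphy p t k)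
    {τ : A →ₗ[ℝ] ℝ} (hτ1 : τ 1 = 1)
    (hτ : ∀ k < M, ∀ a ∈ parabolic t k, ∀ b ∈ parabolic t k, τ (a * t k * b) = 0) :
    ∀ n ≤ M + 1, ∀ f ∈ polysUpTo n, τ (φ f) = ∑ μ : Shape n, shapeWeight p⁻¹ μ.1 *
      ∑ S : StandardTableau μ, MvPolynomial.eval (contentVec p⁻¹ S) f := by
  classical
  have hq : 1 < p⁻¹ := (one_lt_inv₀ hp0).mpr hp1
  intro n
  induction n with
  | zero =>
    intro _ f hf
    have : polysUpTo 0 = ⊥ := by simp [polysUpTo]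
    rw [this, Algebra.mem_bot] at hf
    obtain ⟨c, rfl⟩ := hf
    rw [AlgHom.commutes, Algebra.algebraMap_eq_smul_one, map_smul, hτ1]
    simp only [Fintype.sum_unique]
    rw [card_shape_zero, shapeWeight_bot]
    simp
  | succ n ih =>
    intro hn f hf
    have hlin := polysUpTo_succ_le n hf
    clear hf
    induction hlin using Submodule.span_induction with
    | zero => simp
    | add x y _ _ hx hy =>
      rw [map_add, map_add, hx, hy, ← Finset.sum_add_distrib]
      refine Finset.sum_congr rfl fun ν _ => ?_
      rw [← mul_add, ← Finset.sum_add_distrib]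
      simp only [map_add]
    | smul c x _ hx =>
      rw [map_smul, map_smul, hx, smul_eq_mul, Finset.mul_sum]
      refine Finset.sum_congr rfl fun ν _ => ?_
      rw [mul_left_comm, ← smul_eq_mul c, Finset.smul_sum]
      simp only [MvPolynomial.smul_eval, smul_eq_mul]
    | mem x hx =>
      obtain ⟨g, hg, m, rfl⟩ := hx
      have hn' : n ≤ M := by omega
      have hres := h.geom_sub_moment_mem hp0.ne' hφ n hn' m
      set Γ := momentSeries p n with hΓ
      have hc : coeff m (1 + Γ) ∈ polysUpTo n := by
        have : CoeffsIn (polysUpTo n).toSubmodule (1 + Γ) :=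
          CoeffsIn.one.add (momentSeries_mem p n)
        exact this m
      have h1 : τ (φ (g * MvPolynomial.X n ^ m)) = τ (φ (g * coeff m (1 + Γ))) := by
        have e : jucysMurphy p t n ^ m - φ (coeff m (1 + Γ)) ∈ complement t n := by
          convert hres using 1
          rw [map_sub, map_sub, coeff_geom, coeff_map, map_add, map_add, coeff_one, coeff_one,
            sub_sub]
          congr 2
          split_ifs <;> simp
        have := map_complement_eq_zero hτ hn' (map_polysUpTo_mem hφ (by omega) hg) e
        rw [mul_sub, map_sub, sub_eq_zero] at this
        rw [map_mul, map_pow, hφ n hn', this, ← map_mul φ]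
      rw [h1, ih (by omega) _ (mul_mem hg hc)]
      have h2 : ∀ ν : Shape (n + 1), ∑ T : StandardTableau ν,
          MvPolynomial.eval (contentVec p⁻¹ T) (g * MvPolynomial.X n ^ m) =
          ∑ μ : Shape n, if μ.1 ≤ ν.1 then
            (∑ S : StandardTableau μ, MvPolynomial.eval (contentVec p⁻¹ S) g) *
              (p⁻¹ ^ (contentSum ν.1 - contentSum μ.1)) ^ m else 0 := by
        intro ν
        rw [sum_tableaux_succ]
        refine Finset.sum_congr rfl fun μ _ => ?_
        split_ifs with hle
        · rw [Finset.sum_mul]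
          refine Finset.sum_congr rfl fun S _ => ?_
          obtain ⟨e1, e2⟩ := contentVec_extendTableau p⁻¹ hle S
          rw [map_mul, map_pow, MvPolynomial.eval_X, e2, eval_congr_polysUpTo hg e1]
        · rfl
      simp only [h2, Finset.mul_sum]
      rw [Finset.sum_comm]
      refine Finset.sum_congr rfl fun μ _ => ?_
      -- The evaluated moment series is a product over the boxes of S, so it depends on the shape μ
      -- and not on the order of filling.
      have h3 : ∀ S : StandardTableau μ,
          MvPolynomial.eval (contentVec p⁻¹ S) (coeff m (1 + Γ)) * shapeWeight p⁻¹ μ.1 =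
          ∑ ν : Shape (n + 1) with μ.1 ≤ ν.1,
            shapeWeight p⁻¹ ν.1 * (p⁻¹ ^ (contentSum ν.1 - contentSum μ.1)) ^ m := by
        intro S
        have hmul := eval_momentSeries_mul p (contentVec p⁻¹ S) n
        have hprod := prod_boxOf S (fun b => lin (p⁻¹ ^ (content b - 1)) *
          lin (p⁻¹ ^ (content b + 1)))
        have hprod' := prod_boxOf S (fun b => lin (p⁻¹ ^ content b) ^ 2)
        have hpi : p⁻¹ ≠ 0 := inv_ne_zero hp0.ne'
        have e1 : ∀ k, p * contentVec p⁻¹ S k = p⁻¹ ^ (content (boxOf S (k + 1)) - 1) :=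
          fun k => by rw [contentVec, zpow_sub_one₀ hpi, inv_inv, mul_comm]
        have e2 : ∀ k, p⁻¹ * contentVec p⁻¹ S k = p⁻¹ ^ (content (boxOf S (k + 1)) + 1) :=
          fun k => by rw [contentVec, zpow_add_one₀ hpi, mul_comm]
        simp only [e1, e2] at hmul
        rw [hprod] at hmul
        simp only [contentVec] at hmul
        rw [hprod'] at hmul
        rw [sum_covers_pow hq μ hmul m, mul_comm]
        congr 1
        rw [← coeff_map, map_add, map_one]
      simp only [map_mul]
      have h4 : ∀ S : StandardTableau μ, shapeWeight p⁻¹ μ.1 *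
          (MvPolynomial.eval (contentVec p⁻¹ S) g *
            MvPolynomial.eval (contentVec p⁻¹ S) (coeff m (1 + Γ))) =
          MvPolynomial.eval (contentVec p⁻¹ S) g * ∑ ν : Shape (n + 1) with μ.1 ≤ ν.1,
            shapeWeight p⁻¹ ν.1 * (p⁻¹ ^ (contentSum ν.1 - contentSum μ.1)) ^ m := by
        intro S
        rw [← h3 S]
        ring
      rw [Finset.sum_congr rfl fun S _ => h4 S, ← Finset.sum_mul, Finset.sum_filter,
        Finset.mul_sum]
      refine Finset.sum_congr rfl fun ν _ => ?_
      split_ifs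
      · ring
      · simp

/-- The distribution of the last Jucys–Murphy element. -/
theorem HeckeRel.trace_jucysMurphy_pow (h : HeckeRel p M t) (hp0 : 0 < p) (hp1 : p < 1)
    {τ : A →ₗ[ℝ] ℝ} (hτ1 : τ 1 = 1)
    (hτ : ∀ k < M, ∀ a ∈ parabolic t k, ∀ b ∈ parabolic t k, τ (a * t k * b) = 0) (m : ℕ) :
    τ (jucysMurphy p t M ^ m) = ∑ μ : Shape (M + 1), shapeWeight p⁻¹ μ.1 *
      ∑ S : StandardTableau μ, (p⁻¹ ^ content (boxOf S (M + 1))) ^ m := by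
  obtain ⟨φ, hφ⟩ := h.exists_eval
  have key := h.trace_eval hp0 hp1 hφ hτ1 hτ (M + 1) le_rfl (MvPolynomial.X M ^ m)
    (pow_mem (X_mem_polysUpTo (Nat.lt_succ_self M)) m)
  rw [map_pow, hφ M le_rfl] at key
  rw [key]
  simp only [map_pow, MvPolynomial.eval_X, contentVec]

end Spectral

/-! ### Inversions and length -/

section Inversions

variable {n : ℕ}

/-- The smaller letter moved by the simple transposition. -/
def lo (i : Fin (n - 1)) : Fin n := ⟨i, by omega⟩

/-- The larger letter moved by the simple transposition. -/
def hi (i : Fin (n - 1)) : Fin n := ⟨i + 1, by omega⟩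

theorem simpleRefl_eq (i : Fin (n - 1)) : simpleRefl n i = Equiv.swap (lo i) (hi i) := rfl

theorem simpleRefl_val (i : Fin (n - 1)) (v : Fin n) :
    (simpleRefl n i v : ℕ) =
      if (v : ℕ) = i then (i : ℕ) + 1 else if (v : ℕ) = i + 1 then (i : ℕ) else v := by
  rw [simpleRefl, Equiv.swap_apply_def]
  simp only [Fin.ext_iff]
  split_ifs <;> rfl

theorem simpleRefl_mul_self (i : Fin (n - 1)) : simpleRefl n i * simpleRefl n i = 1 :=
  Equiv.swap_mul_self _ _

theorem simpleRefl_inv (i : Fin (n - 1)) : (simpleRefl n i)⁻¹ = simpleRefl n i :=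
  Equiv.swap_inv _ _

theorem simpleRefl_mul_cancel (i : Fin (n - 1)) (x : Equiv.Perm (Fin n)) :
    simpleRefl n i * (simpleRefl n i * x) = x := by
  rw [← mul_assoc, simpleRefl_mul_self, one_mul]

theorem mul_simpleRefl_cancel (i : Fin (n - 1)) (x : Equiv.Perm (Fin n)) :
    x * simpleRefl n i * simpleRefl n i = x := by
  rw [mul_assoc, simpleRefl_mul_self, mul_one]

theorem simpleRefl_lt {i : Fin (n - 1)} {u v : Fin n} (huv : u < v)
    (h : ¬ (u = lo i ∧ v = hi i)) : simpleRefl n i u < simpleRefl n i v := by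
  rw [Fin.lt_def, simpleRefl_val, simpleRefl_val]
  rw [Fin.lt_def] at huv
  simp only [Fin.ext_iff, lo, hi] at h
  split_ifs <;> omega

/-- The letter `i` stands to the left of the letter `i + 1`. -/
def Up (i : Fin (n - 1)) (x : Equiv.Perm (Fin n)) : Prop := x⁻¹ (lo i) < x⁻¹ (hi i)

instance (i : Fin (n - 1)) (x : Equiv.Perm (Fin n)) : Decidable (Up i x) :=
  inferInstanceAs (Decidable (_ < _))

theorem inv_simpleRefl_mul_apply (i : Fin (n - 1)) (x : Equiv.Perm (Fin n)) (v : Fin n) :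
    (simpleRefl n i * x)⁻¹ v = x⁻¹ (simpleRefl n i v) := by
  rw [mul_inv_rev, simpleRefl_inv, Equiv.Perm.mul_apply]

theorem simpleRefl_lo (i : Fin (n - 1)) : simpleRefl n i (lo i) = hi i :=
  Equiv.swap_apply_left _ _

theorem simpleRefl_hi (i : Fin (n - 1)) : simpleRefl n i (hi i) = lo i :=
  Equiv.swap_apply_right _ _

theorem lo_lt_hi (i : Fin (n - 1)) : lo i < hi i := by
  rw [Fin.lt_def]; exact Nat.lt_succ_self _

theorem up_simpleRefl_mul (i : Fin (n - 1)) (x : Equiv.Perm (Fin n)) :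
    Up i (simpleRefl n i * x) ↔ ¬ Up i x := by
  rw [Up, Up, inv_simpleRefl_mul_apply, inv_simpleRefl_mul_apply, simpleRefl_lo, simpleRefl_hi,
    not_lt]
  refine ⟨le_of_lt, fun h => lt_of_le_of_ne h fun h' => ?_⟩
  exact (lo_lt_hi i).ne' (x⁻¹.injective h')

theorem up_one (i : Fin (n - 1)) : Up i (1 : Equiv.Perm (Fin n)) := by
  rw [Up, inv_one]; exact lo_lt_hi i

/-- The pairs of letters which stand in the wrong order. -/
def inversions (x : Equiv.Perm (Fin n)) : Finset (Fin n × Fin n) :=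
  Finset.univ.filter fun p => p.1 < p.2 ∧ x⁻¹ p.2 < x⁻¹ p.1

/-- The number of inversions. -/
def invCount (x : Equiv.Perm (Fin n)) : ℕ := (inversions x).card

theorem invCount_one : invCount (1 : Equiv.Perm (Fin n)) = 0 := by
  rw [invCount, Finset.card_eq_zero, inversions, Finset.filter_eq_empty_iff]
  rintro ⟨u, v⟩ _ ⟨h1, h2⟩
  rw [inv_one] at h2
  exact lt_asymm h1 h2

/-- The simple transposition preserves the order of every pair of letters except its own. It
therefore maps the old inversions injectively to new ones, and the pair (i, i+1) is the only one
added. -/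
theorem invCount_up {i : Fin (n - 1)} {x : Equiv.Perm (Fin n)} (h : Up i x) :
    invCount (simpleRefl n i * x) = invCount x + 1 := by
  set s := simpleRefl n i with hs
  have hss : ∀ v, s (s v) = v := fun v => by
    rw [← Equiv.Perm.mul_apply, hs, simpleRefl_mul_self]; rfl
  have hinj : Function.Injective (fun p : Fin n × Fin n => (s p.1, s p.2)) := by
    rintro ⟨a, b⟩ ⟨c, d⟩ hab
    obtain ⟨h1, h2⟩ := Prod.mk.inj hab
    exact Prod.ext (s.injective h1) (s.injective h2)
  have hne : ∀ u v, (u, v) ∈ inversions x → ¬ (u = lo i ∧ v = hi i) := by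
    rintro u v huv ⟨rfl, rfl⟩
    exact lt_asymm h (Finset.mem_filter.mp huv).2.2
  have e : inversions (s * x) =
      insert (lo i, hi i) ((inversions x).image fun p => (s p.1, s p.2)) := by
    ext ⟨u, v⟩
    rw [Finset.mem_insert, Finset.mem_image]
    constructor
    · intro huv
      obtain ⟨h1, h2⟩ := (Finset.mem_filter.mp huv).2
      dsimp only at h1 h2
      rw [inv_simpleRefl_mul_apply, inv_simpleRefl_mul_apply] at h2
      by_cases h3 : u = lo i ∧ v = hi i
      · left; rw [h3.1, h3.2]
      · right
        exact ⟨(s u, s v), Finset.mem_filter.mpr ⟨Finset.mem_univ _, simpleRefl_lt h1 h3, h2⟩,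
          by rw [hss, hss]⟩
    · rintro (huv | ⟨⟨a, b⟩, hab, huv⟩)
      · obtain ⟨rfl, rfl⟩ := Prod.mk.inj huv
        refine Finset.mem_filter.mpr ⟨Finset.mem_univ _, lo_lt_hi i, ?_⟩
        dsimp only
        rw [inv_simpleRefl_mul_apply, inv_simpleRefl_mul_apply, simpleRefl_lo, simpleRefl_hi]
        exact h
      · obtain ⟨rfl, rfl⟩ := Prod.mk.inj huv
        have h1 := (Finset.mem_filter.mp hab).2
        refine Finset.mem_filter.mpr ⟨Finset.mem_univ _, simpleRefl_lt h1.1 (hne a b hab), ?_⟩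
        dsimp only
        rw [inv_simpleRefl_mul_apply, inv_simpleRefl_mul_apply]
        change x⁻¹ (s (s b)) < x⁻¹ (s (s a))
        rw [hss, hss]
        exact h1.2
  rw [invCount, e, Finset.card_insert_of_notMem, Finset.card_image_of_injective _ hinj, invCount]
  rw [Finset.mem_image]
  rintro ⟨⟨a, b⟩, hab, h1⟩
  obtain ⟨h2, h3⟩ := Prod.mk.inj h1
  have h4 := (Finset.mem_filter.mp hab).2.1
  dsimp only at h2 h3 h4
  have ha : a = hi i := by rw [← hss a, h2, hs, simpleRefl_lo]
  have hb : b = lo i := by rw [← hss b, h3, hs, simpleRefl_hi]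
  rw [ha, hb] at h4
  exact lt_asymm h4 (lo_lt_hi i)

theorem invCount_down {i : Fin (n - 1)} {x : Equiv.Perm (Fin n)} (h : ¬ Up i x) :
    invCount x = invCount (simpleRefl n i * x) + 1 := by
  have := invCount_up ((up_simpleRefl_mul i x).mpr h)
  rwa [simpleRefl_mul_cancel] at this

theorem exists_not_up {x : Equiv.Perm (Fin n)} (hx : x ≠ 1) : ∃ i, ¬ Up i x := by
  by_contra hcon
  push Not at hcon
  apply hx
  rw [← inv_inj, inv_one]
  have hmono : StrictMono (x⁻¹ : Equiv.Perm (Fin n)) := by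
    rcases n with _ | n
    · intro a; exact a.elim0
    · rw [Fin.strictMono_iff_lt_succ]
      intro i
      exact hcon i
  apply Equiv.ext
  intro v
  have := Subsingleton.elim (hmono.orderIsoOfSurjective _ x⁻¹.surjective) (OrderIso.refl _)
  exact congrArg (fun e : Fin n ≃o Fin n => e v) this

/-- Each factor of a word changes the number of inversions by one, so no word is shorter than the
inversion count. Conversely, a non-identity permutation has adjacent letters in the wrong order, and
exchanging them removes exactly one inversion. -/
theorem length_eq_invCount (x : Equiv.Perm (Fin n)) : length x = invCount x := by
  have lower : ∀ l : List (Fin (n - 1)), invCount (l.map (simpleRefl n)).prod ≤ l.length := by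
    intro l
    induction l with
    | nil => simp [invCount_one]
    | cons i l ih =>
      rw [List.map_cons, List.prod_cons, List.length_cons]
      by_cases h : Up i (l.map (simpleRefl n)).prod
      · rw [invCount_up h]; omega
      · have := invCount_down h; omega
  have upper : ∀ k, ∀ x : Equiv.Perm (Fin n), invCount x = k →
      ∃ l : List (Fin (n - 1)), l.length = k ∧ (l.map (simpleRefl n)).prod = x := by
    intro k
    induction k with
    | zero =>
      intro x hx
      have : x = 1 := by
        by_contra h
        obtain ⟨i, hi⟩ := exists_not_up h
        have := invCount_down hi
        omega
      exact ⟨[], rfl, by simp [this]⟩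
    | succ k ih =>
      intro x hx
      have : x ≠ 1 := by
        rintro rfl
        rw [invCount_one] at hx
        omega
      obtain ⟨i, hi⟩ := exists_not_up this
      have hd := invCount_down hi
      obtain ⟨l, hl, hl'⟩ := ih (simpleRefl n i * x) (by omega)
      exact ⟨i :: l, by simp [hl], by
        rw [List.map_cons, List.prod_cons, hl', simpleRefl_mul_cancel]⟩
  apply le_antisymm
  · exact Nat.sInf_le (upper _ x rfl)
  · refine le_csInf ⟨_, upper _ x rfl⟩ ?_
    rintro k ⟨l, rfl, rfl⟩
    exact lower l

theorem length_lt_iff_up (i : Fin (n - 1)) (x : Equiv.Perm (Fin n)) :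
    length x < length (simpleRefl n i * x) ↔ Up i x := by
  rw [length_eq_invCount, length_eq_invCount]
  by_cases h : Up i x
  · rw [invCount_up h]; simp [h]
  · have := invCount_down h
    simp only [h, iff_false]
    omega

theorem length_gt_iff_not_up (i : Fin (n - 1)) (x : Equiv.Perm (Fin n)) :
    length (simpleRefl n i * x) < length x ↔ ¬ Up i x := by
  rw [length_eq_invCount, length_eq_invCount]
  by_cases h : Up i x
  · rw [invCount_up h]; simp [h]
  · have := invCount_down h
    simp only [h, not_false_eq_true, iff_true]
    omega

theorem simpleRefl_mul_ne (i : Fin (n - 1)) (x : Equiv.Perm (Fin n)) :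
    simpleRefl n i * x ≠ x := by
  intro h
  have := up_simpleRefl_mul i x
  rw [h] at this
  exact iff_not_self this

end Inversions

/-! ### The Metropolis chains as a representation of the Hecke algebra -/

section Matrices
open Matrix

variable {n : ℕ} {θ : ℝ}

theorem metropolis_up {i : Fin (n - 1)} {x : Equiv.Perm (Fin n)} (h : Up i x)
    (y : Equiv.Perm (Fin n)) :
    metropolis n θ i x y = if y = simpleRefl n i * x then 1 else 0 := by
  rw [metropolis, of_apply]
  have h1 := (length_lt_iff_up i x).mpr h
  have h2 := (length_gt_iff_not_up i x).not.mpr (not_not.mpr h)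
  by_cases hy : y = simpleRefl n i * x
  · subst hy; simp [h1]
  · simp [hy, h2]

theorem metropolis_down {i : Fin (n - 1)} {x : Equiv.Perm (Fin n)} (h : ¬ Up i x)
    (y : Equiv.Perm (Fin n)) :
    metropolis n θ i x y =
      (if y = simpleRefl n i * x then θ else 0) + if y = x then 1 - θ else 0 := by
  rw [metropolis, of_apply]
  have h1 := (length_lt_iff_up i x).not.mpr h
  have h2 := (length_gt_iff_not_up i x).mpr h
  have h3 := simpleRefl_mul_ne i x
  by_cases hy : y = simpleRefl n i * x
  · subst hy; simp [h1, h2, h3]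
  · simp [hy, h2]

theorem metropolis_mulVec (i : Fin (n - 1)) (f : Equiv.Perm (Fin n) → ℝ)
    (x : Equiv.Perm (Fin n)) :
    (metropolis n θ i *ᵥ f) x = if Up i x then f (simpleRefl n i * x)
      else θ * f (simpleRefl n i * x) + (1 - θ) * f x := by
  rw [mulVec, dotProduct]
  split_ifs with h
  · simp [metropolis_up h]
  · simp [metropolis_down h, add_mul, Finset.sum_add_distrib]

theorem metropolis_mul_up {i : Fin (n - 1)} {x : Equiv.Perm (Fin n)} (h : Up i x)
    (B : Matrix (Equiv.Perm (Fin n)) (Equiv.Perm (Fin n)) ℝ) (y : Equiv.Perm (Fin n)) :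
    (metropolis n θ i * B) x y = B (simpleRefl n i * x) y := by
  have := metropolis_mulVec (θ := θ) i (fun z => B z y) x
  rw [if_pos h] at this
  exact this

/-- The chain which acts on positions instead of letters. -/
noncomputable def rightMetropolis (n : ℕ) (θ : ℝ) (j : Fin (n - 1)) :
    Matrix (Equiv.Perm (Fin n)) (Equiv.Perm (Fin n)) ℝ :=
  of fun x y => metropolis n θ j x⁻¹ y⁻¹

theorem rightMetropolis_mulVec (j : Fin (n - 1)) (f : Equiv.Perm (Fin n) → ℝ)
    (x : Equiv.Perm (Fin n)) :
    (rightMetropolis n θ j *ᵥ f) x = if Up j x⁻¹ then f (x * simpleRefl n j)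
      else θ * f (x * simpleRefl n j) + (1 - θ) * f x := by
  have h := metropolis_mulVec (θ := θ) j (fun z => f z⁻¹) x⁻¹
  rw [_root_.mul_inv_rev, inv_inv, simpleRefl_inv] at h
  rw [← h, mulVec, mulVec, dotProduct, dotProduct, ← Equiv.sum_comp (Equiv.inv _)]
  exact Finset.sum_congr rfl fun y _ => by simp [rightMetropolis]

theorem rightMetropolis_mul_up {j : Fin (n - 1)} {x : Equiv.Perm (Fin n)} (h : Up j x⁻¹)
    (B : Matrix (Equiv.Perm (Fin n)) (Equiv.Perm (Fin n)) ℝ) (y : Equiv.Perm (Fin n)) :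
    (rightMetropolis n θ j * B) x y = B (x * simpleRefl n j) y := by
  have := rightMetropolis_mulVec (θ := θ) j (fun z => B z y) x
  rw [if_pos h] at this
  exact this

theorem simpleRefl_mul_eq_of_apply {i j : Fin (n - 1)} {x : Equiv.Perm (Fin n)}
    (h : (x (lo j) = lo i ∧ x (hi j) = hi i) ∨ (x (hi j) = lo i ∧ x (lo j) = hi i)) :
    simpleRefl n i * x = x * simpleRefl n j := by
  rw [simpleRefl_eq, simpleRefl_eq, Equiv.mul_swap_eq_swap_mul]
  rcases h with ⟨h1, h2⟩ | ⟨h1, h2⟩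
  · rw [h1, h2]
  · rw [h1, h2, Equiv.swap_comm]

theorem up_inv_iff (j : Fin (n - 1)) (x : Equiv.Perm (Fin n)) :
    Up j x⁻¹ ↔ x (lo j) < x (hi j) := by
  rw [Up, inv_inv]

theorem up_inv_simpleRefl_mul {i j : Fin (n - 1)} {x : Equiv.Perm (Fin n)}
    (h : simpleRefl n i * x ≠ x * simpleRefl n j) :
    Up j (simpleRefl n i * x)⁻¹ ↔ Up j x⁻¹ := by
  rw [up_inv_iff, up_inv_iff, Equiv.Perm.mul_apply, Equiv.Perm.mul_apply]
  constructor
  · intro h1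
    by_contra h2
    have h3 : x (hi j) < x (lo j) := lt_of_le_of_ne (not_lt.mp h2)
      fun h' => (lo_lt_hi j).ne' (x.injective h')
    by_cases h4 : x (hi j) = lo i ∧ x (lo j) = hi i
    · exact h (simpleRefl_mul_eq_of_apply (Or.inr h4))
    · exact lt_asymm h1 (simpleRefl_lt h3 h4)
  · intro h1
    refine simpleRefl_lt h1 fun h4 => h (simpleRefl_mul_eq_of_apply (Or.inl h4))

theorem up_inv_iff_up {i j : Fin (n - 1)} {x : Equiv.Perm (Fin n)}
    (h : simpleRefl n i * x = x * simpleRefl n j) : Up j x⁻¹ ↔ Up i x := by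
  have hsw : Equiv.swap (lo i) (hi i) = Equiv.swap (x (lo j)) (x (hi j)) := by
    have : simpleRefl n i = x * simpleRefl n j * x⁻¹ := by rw [← h, mul_inv_cancel_right]
    rw [← simpleRefl_eq, this, simpleRefl_eq, Equiv.mul_swap_eq_swap_mul, mul_inv_cancel_right]
  have hlo : x (lo j) = lo i ∨ x (lo j) = hi i := by
    by_contra hcon
    push Not at hcon
    have h1 := congrArg (fun σ => σ (x (lo j))) hsw
    simp only [Equiv.swap_apply_of_ne_of_ne hcon.1 hcon.2, Equiv.swap_apply_left] at h1
    exact (lo_lt_hi j).ne (x.injective h1)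
  rw [up_inv_iff, Up]
  have h1 := congrArg (fun σ => σ (x (lo j))) hsw
  simp only [Equiv.swap_apply_left] at h1
  have hinv : ∀ a, x⁻¹ (x a) = a := fun a => x.symm_apply_apply a
  rcases hlo with h2 | h2
  · rw [h2, Equiv.swap_apply_left] at h1
    exact iff_of_true (by rw [h2, ← h1]; exact lo_lt_hi i)
      (by rw [h1, ← h2, hinv, hinv]; exact lo_lt_hi j)
  · rw [h2, Equiv.swap_apply_right] at h1
    refine iff_of_false (by rw [h2, ← h1]; exact (lo_lt_hi i).not_gt)
      (by rw [h1, ← h2, hinv, hinv]; exact (lo_lt_hi j).not_gt)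

/-- If s_i x ≠ x s_j, multiplication on one side does not change whether the step on the other side
goes up, and the two updates commute term by term. If s_i x = x s_j, both chains live on the same
two-point set {x, s_i x} and coincide there. -/
theorem metropolis_commute_right (i j : Fin (n - 1)) :
    metropolis n θ i * rightMetropolis n θ j = rightMetropolis n θ j * metropolis n θ i := by
  apply Matrix.toLin'.injective
  apply LinearMap.ext
  intro f
  rw [toLin'_apply, toLin'_apply, ← mulVec_mulVec, ← mulVec_mulVec]
  funext x
  by_cases h : simpleRefl n i * x = x * simpleRefl n j
  · set y := simpleRefl n i * x with hy
    have hyx : simpleRefl n i * y = x := simpleRefl_mul_cancel i x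
    have hyx' : y * simpleRefl n j = x := by rw [h, mul_simpleRefl_cancel]
    have h' : simpleRefl n i * y = y * simpleRefl n j := by rw [hyx, hyx']
    have ex : ∀ g, (rightMetropolis n θ j *ᵥ g) x = (metropolis n θ i *ᵥ g) x := fun g => by
      rw [rightMetropolis_mulVec, metropolis_mulVec, ← hy, ← h]
      simp only [up_inv_iff_up h]
    have ey : ∀ g, (rightMetropolis n θ j *ᵥ g) y = (metropolis n θ i *ᵥ g) y := fun g => by
      rw [rightMetropolis_mulVec, metropolis_mulVec, ← h']
      simp only [up_inv_iff_up h']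
    rw [ex (metropolis n θ i *ᵥ f), metropolis_mulVec i (rightMetropolis n θ j *ᵥ f),
      metropolis_mulVec i (metropolis n θ i *ᵥ f), ← hy, ex f, ey f]
  · have h2 : simpleRefl n j * x⁻¹ ≠ x⁻¹ * simpleRefl n i := by
      intro h3
      apply h
      have := congrArg (·⁻¹) h3
      simp only [_root_.mul_inv_rev, inv_inv, simpleRefl_inv] at this
      exact this.symm
    have u1 := up_inv_simpleRefl_mul h
    have u2 := up_inv_simpleRefl_mul h2
    rw [_root_.mul_inv_rev, inv_inv, simpleRefl_inv] at u2
    simp only [metropolis_mulVec, rightMetropolis_mulVec, u1, u2, mul_assoc]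
    split_ifs <;> ring

/-- A matrix in the commutant of the right chains is determined by its first row. -/
theorem eq_of_first_row {a b : Matrix (Equiv.Perm (Fin n)) (Equiv.Perm (Fin n)) ℝ}
    (ha : ∀ j, a * rightMetropolis n θ j = rightMetropolis n θ j * a)
    (hb : ∀ j, b * rightMetropolis n θ j = rightMetropolis n θ j * b)
    (h : ∀ y, a 1 y = b 1 y) : a = b := by
  have key : ∀ k, ∀ x : Equiv.Perm (Fin n), invCount x⁻¹ = k → ∀ y, a x y = b x y := by
    intro k
    induction k with
    | zero =>
      intro x hx
      have : x = 1 := by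
        by_contra h
        obtain ⟨i, hi⟩ := exists_not_up (inv_ne_one.mpr h)
        have := invCount_down hi
        omega
      rw [this]
      exact h
    | succ k ih =>
      intro x hx y
      have : x⁻¹ ≠ 1 := by
        intro h
        rw [h, invCount_one] at hx
        omega
      -- Undo a descent on positions. From x s_j the right chain moves to x with certainty, so row x
      -- of `a` is row x s_j of R_j a = a R_j, where R_j is that right chain, and this depends only
      -- on the shorter row x s_j of `a`.
      obtain ⟨j, hj⟩ := exists_not_up this
      have hd := invCount_down hj
      have hu := (up_simpleRefl_mul j x⁻¹).mpr hj
      have e : simpleRefl n j * x⁻¹ = (x * simpleRefl n j)⁻¹ := by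
        rw [_root_.mul_inv_rev, simpleRefl_inv]
      rw [e] at hd hu
      have r1 := rightMetropolis_mul_up (θ := θ) hu a y
      have r2 := rightMetropolis_mul_up (θ := θ) hu b y
      rw [mul_simpleRefl_cancel] at r1 r2
      rw [← r1, ← r2, ← ha, ← hb, mul_apply, mul_apply]
      exact Finset.sum_congr rfl fun z _ => by rw [ih _ (by omega) z]
  ext x y
  exact key _ x rfl y

end Matrices

/-! ### Hecke relations of the chains, and the entry at the identity -/

section Relations
open Matrix

variable {n : ℕ} {θ : ℝ}

theorem mul_commute_right {a b : Matrix (Equiv.Perm (Fin n)) (Equiv.Perm (Fin n)) ℝ}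
    (ha : ∀ j, a * rightMetropolis n θ j = rightMetropolis n θ j * a)
    (hb : ∀ j, b * rightMetropolis n θ j = rightMetropolis n θ j * b) (j : Fin (n - 1)) :
    a * b * rightMetropolis n θ j = rightMetropolis n θ j * (a * b) := by
  rw [mul_assoc, hb, ← mul_assoc, ha, mul_assoc]

theorem metropolis_sq (i : Fin (n - 1)) :
    metropolis n θ i * metropolis n θ i = (1 - θ) • metropolis n θ i + θ • 1 := by
  have c := fun j => metropolis_commute_right (θ := θ) i j
  refine eq_of_first_row (mul_commute_right c c) (fun j => ?_) (fun y => ?_) (θ := θ)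
  · rw [add_mul, mul_add, smul_mul_assoc, smul_mul_assoc, mul_smul_comm, mul_smul_comm, c,
      one_mul, mul_one]
  · have h1 := up_one i
    have h2 : ¬ Up i (simpleRefl n i * 1) := by rw [up_simpleRefl_mul]; exact not_not.mpr h1
    rw [metropolis_mul_up h1, metropolis_down h2, simpleRefl_mul_cancel, Matrix.add_apply, Matrix.smul_apply,
      Matrix.smul_apply, metropolis_up h1, one_apply, smul_eq_mul, smul_eq_mul]
    simp only [eq_comm (a := (1 : Equiv.Perm (Fin n)))]
    split_ifs <;> ring

theorem simpleRefl_apply_of_ne {i : Fin (n - 1)} {v : Fin n} (h1 : v ≠ lo i) (h2 : v ≠ hi i) :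
    simpleRefl n i v = v := Equiv.swap_apply_of_ne_of_ne h1 h2

theorem up_mul_one_iff (i j : Fin (n - 1)) :
    Up j (simpleRefl n i * 1) ↔ simpleRefl n i (lo j) < simpleRefl n i (hi j) := by
  rw [Up, inv_simpleRefl_mul_apply, inv_simpleRefl_mul_apply]
  rfl

theorem up_mul_mul_one_iff (i j k : Fin (n - 1)) :
    Up k (simpleRefl n j * (simpleRefl n i * 1)) ↔
      simpleRefl n i (simpleRefl n j (lo k)) < simpleRefl n i (simpleRefl n j (hi k)) := by
  rw [Up, inv_simpleRefl_mul_apply, inv_simpleRefl_mul_apply, inv_simpleRefl_mul_apply,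
    inv_simpleRefl_mul_apply]
  rfl

/-- Both sides commute with the right chains, so only their rows at the identity have to be
compared. From there every step of either word goes up and is deterministic, which leaves the braid
relation between the permutations. -/
theorem metropolis_braid {i j : Fin (n - 1)} (hij : (j : ℕ) = i + 1) :
    metropolis n θ i * metropolis n θ j * metropolis n θ i =
      metropolis n θ j * metropolis n θ i * metropolis n θ j := by
  have c := fun i j => metropolis_commute_right (n := n) (θ := θ) i j
  refine eq_of_first_row (mul_commute_right (mul_commute_right (c i) (c j)) (c i))
    (mul_commute_right (mul_commute_right (c j) (c i)) (c j)) (fun y => ?_) (θ := θ)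
  have hlo : lo j = hi i := Fin.ext hij
  have h12 : lo i < hi i := lo_lt_hi i
  have h23 : hi i < hi j := hlo ▸ lo_lt_hi j
  have i3 : simpleRefl n i (hi j) = hi j :=
    simpleRefl_apply_of_ne (h12.trans h23).ne' h23.ne'
  have j1 : simpleRefl n j (lo i) = lo i :=
    simpleRefl_apply_of_ne (by rw [hlo]; exact h12.ne) (h12.trans h23).ne
  have j2 : simpleRefl n j (hi i) = hi j := by rw [← hlo, simpleRefl_lo]
  have j3 : simpleRefl n j (hi j) = hi i := by rw [← hlo, simpleRefl_hi]
  have u1 : Up j (simpleRefl n i * 1) := by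
    rw [up_mul_one_iff, hlo, simpleRefl_hi, i3]; exact h12.trans h23
  have u2 : Up i (simpleRefl n j * (simpleRefl n i * 1)) := by
    rw [up_mul_mul_one_iff, j1, j2, i3, simpleRefl_lo]; exact h23
  have u3 : Up i (simpleRefl n j * 1) := by
    rw [up_mul_one_iff, j1, j2]; exact h12.trans h23
  have u4 : Up j (simpleRefl n i * (simpleRefl n j * 1)) := by
    rw [up_mul_mul_one_iff, hlo, simpleRefl_hi, i3, j1, j3]; exact h12
  have e : simpleRefl n i * (simpleRefl n j * (simpleRefl n i * 1)) =
      simpleRefl n j * (simpleRefl n i * (simpleRefl n j * 1)) := by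
    have e1 := Equiv.swap_mul_swap_mul_swap h23.ne' (h12.trans h23).ne'
    have e2 := Equiv.swap_mul_swap_mul_swap h12.ne (h12.trans h23).ne
    rw [mul_one, mul_one, ← mul_assoc, ← mul_assoc, simpleRefl_eq, simpleRefl_eq, hlo, e2,
      Equiv.swap_comm (lo i) (hi i), Equiv.swap_comm (hi i) (hi j), e1, Equiv.swap_comm]
  rw [mul_assoc, mul_assoc, metropolis_mul_up (up_one i), metropolis_mul_up u1, metropolis_up u2,
    metropolis_mul_up (up_one j), metropolis_mul_up u3, metropolis_up u4, e]

theorem metropolis_comm {i j : Fin (n - 1)} (hij : (i : ℕ) + 1 < j) :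
    metropolis n θ i * metropolis n θ j = metropolis n θ j * metropolis n θ i := by
  have c := fun i j => metropolis_commute_right (n := n) (θ := θ) i j
  refine eq_of_first_row (mul_commute_right (c i) (c j)) (mul_commute_right (c j) (c i))
    (fun y => ?_) (θ := θ)
  have h : hi i < lo j := Fin.lt_def.mpr hij
  have h1 := lo_lt_hi i
  have h2 := lo_lt_hi j
  have i1 : simpleRefl n i (lo j) = lo j := simpleRefl_apply_of_ne (h1.trans h).ne' h.ne'
  have i2 : simpleRefl n i (hi j) = hi j :=
    simpleRefl_apply_of_ne ((h1.trans h).trans h2).ne' (h.trans h2).ne'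
  have j1 : simpleRefl n j (lo i) = lo i :=
    simpleRefl_apply_of_ne (h1.trans h).ne ((h1.trans h).trans h2).ne
  have j2 : simpleRefl n j (hi i) = hi i := simpleRefl_apply_of_ne h.ne (h.trans h2).ne
  have u1 : Up j (simpleRefl n i * 1) := by rw [up_mul_one_iff, i1, i2]; exact h2
  have u2 : Up i (simpleRefl n j * 1) := by rw [up_mul_one_iff, j1, j2]; exact h1
  have e : simpleRefl n j * (simpleRefl n i * 1) = simpleRefl n i * (simpleRefl n j * 1) := by
    rw [mul_one, mul_one]
    conv_lhs => rw [simpleRefl_eq i, Equiv.mul_swap_eq_swap_mul, j1, j2, ← simpleRefl_eq]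
  rw [metropolis_mul_up (up_one i), metropolis_up u1, metropolis_mul_up (up_one j),
    metropolis_up u2, e]

/-- The generators in reverse order: `revGen n θ k = K_{n-1-k}` for `k < n - 1`. -/
noncomputable def revGen (n : ℕ) (θ : ℝ) (k : ℕ) :
    Matrix (Equiv.Perm (Fin n)) (Equiv.Perm (Fin n)) ℝ :=
  if h : k < n - 1 then metropolis n θ ⟨n - 2 - k, by omega⟩ else 1

theorem revGen_of_lt {k : ℕ} (h : k < n - 1) :
    revGen n θ k = metropolis n θ ⟨n - 2 - k, by omega⟩ := dif_pos h

theorem heckeRel_revGen (n : ℕ) (θ : ℝ) : HeckeRel θ (n - 1) (revGen n θ) where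
  quad k hk := by rw [revGen_of_lt hk, metropolis_sq]
  braid k hk := by
    rw [revGen_of_lt hk, revGen_of_lt (show k < n - 1 by omega)]
    exact (metropolis_braid (by dsimp only; omega)).symm
  comm j k hjk hk := by
    rw [revGen_of_lt hk, revGen_of_lt (show j < n - 1 by omega)]
    exact (metropolis_comm (by dsimp only; omega)).symm

theorem palindrome_list {A : Type*} [Ring A] (m : ℕ) (f : Fin m → A) (t : ℕ → A)
    (ht : ∀ i : Fin m, f i = t (m - 1 - i)) :
    (List.ofFn f).prod * (List.ofFn f).reverse.prod = palindrome t m := by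
  induction m with
  | zero => simp [palindrome]
  | succ m ih =>
    have h := ih (fun i => f i.succ) (fun i => by
      rw [ht]; congr 1; simp only [Fin.val_succ]; omega)
    have h0 : f 0 = t m := by rw [ht]; simp
    rw [List.ofFn_succ, List.prod_cons, List.reverse_cons, List.prod_append, List.prod_singleton,
      palindrome, ← h, h0]
    simp only [mul_assoc]

theorem shortScan_eq_palindrome (n : ℕ) (θ : ℝ) :
    shortScan n θ = palindrome (revGen n θ) (n - 1) := by
  rw [shortScan]
  apply palindrome_list
  intro i
  rw [revGen_of_lt (by omega)]
  congr 1
  apply Fin.ext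
  dsimp only
  omega

/-- The matrices of chains which do not move the letters up to `j`. -/
def fixingLetters (n j : ℕ) : Subalgebra ℝ (Matrix (Equiv.Perm (Fin n)) (Equiv.Perm (Fin n)) ℝ) where
  carrier := {a | ∀ x y, a x y ≠ 0 → ∀ v : Fin n, (v : ℕ) ≤ j → y⁻¹ v = x⁻¹ v}
  mul_mem' := by
    intro a b ha hb x y hxy v hv
    rw [mul_apply] at hxy
    obtain ⟨z, _, hz⟩ := Finset.exists_ne_zero_of_sum_ne_zero hxy
    rw [hb z y (right_ne_zero_of_mul hz) v hv, ha x z (left_ne_zero_of_mul hz) v hv]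
  add_mem' := by
    intro a b ha hb x y hxy v hv
    by_cases h : a x y = 0
    · refine hb x y (fun h' => hxy ?_) v hv
      rw [Matrix.add_apply, h, h', add_zero]
    · exact ha x y h v hv
  algebraMap_mem' := by
    intro c x y hxy v hv
    have : x = y := by
      by_contra h
      exact hxy (by rw [algebraMap_matrix_apply, if_neg h])
    rw [this]

theorem metropolis_support {i : Fin (n - 1)} {x y : Equiv.Perm (Fin n)}
    (h : metropolis n θ i x y ≠ 0) : y = simpleRefl n i * x ∨ (y = x ∧ ¬ Up i x) := by
  by_cases hu : Up i x
  · rw [metropolis_up hu] at h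
    left
    by_contra hy
    exact h (if_neg hy)
  · rw [metropolis_down hu] at h
    by_contra hy
    push Not at hy
    refine h ?_
    rw [if_neg hy.1, if_neg (fun h' => absurd (hy.2 h') hu), add_zero]

theorem simpleRefl_apply_of_lt {i : Fin (n - 1)} {v : Fin n} (h : (v : ℕ) < i) :
    simpleRefl n i v = v := by
  apply Fin.ext
  rw [simpleRefl_val]
  split_ifs <;> omega

theorem metropolis_mem_fixingLetters {i : Fin (n - 1)} {j : ℕ} (h : j < i) :
    metropolis n θ i ∈ fixingLetters n j := by
  intro x y hxy v hv
  rcases metropolis_support hxy with rfl | ⟨rfl, _⟩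
  · rw [inv_simpleRefl_mul_apply, simpleRefl_apply_of_lt (by omega)]
  · rfl

theorem parabolic_le_fixingLetters {k : ℕ} (hk : k < n - 1) :
    parabolic (revGen n θ) k ≤ fixingLetters n (n - 2 - k) := by
  refine Algebra.adjoin_le ?_
  rintro _ ⟨j, hj, rfl⟩
  have hj' : j < k := hj
  rw [revGen_of_lt (by omega)]
  exact metropolis_mem_fixingLetters (by dsimp only; omega)

/-- The entry of a matrix at the identity. -/
def entryOne (n : ℕ) : Matrix (Equiv.Perm (Fin n)) (Equiv.Perm (Fin n)) ℝ →ₗ[ℝ] ℝ where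
  toFun a := a 1 1
  map_add' _ _ := rfl
  map_smul' _ _ := rfl

theorem entryOne_apply (a : Matrix (Equiv.Perm (Fin n)) (Equiv.Perm (Fin n)) ℝ) :
    entryOne n a = a 1 1 := rfl

/-- Follow a path from the identity back to itself. With i = n - 2 - k, the factors `a` and `b` do
not move the letters up to i. When the middle factor acts, letter i is therefore at home with letter
i + 1 to its right. The step then goes up and must exchange them, and `b` cannot bring letter i
back. -/
theorem entryOne_mul_gen_mul {k : ℕ} (hk : k < n - 1)
    {a b : Matrix (Equiv.Perm (Fin n)) (Equiv.Perm (Fin n)) ℝ}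
    (ha : a ∈ parabolic (revGen n θ) k) (hb : b ∈ parabolic (revGen n θ) k) :
    entryOne n (a * revGen n θ k * b) = 0 := by
  by_contra hne
  rw [entryOne_apply, mul_apply] at hne
  obtain ⟨y, _, hy⟩ := Finset.exists_ne_zero_of_sum_ne_zero hne
  have hy1 := left_ne_zero_of_mul hy
  rw [mul_apply] at hy1
  obtain ⟨x, _, hx⟩ := Finset.exists_ne_zero_of_sum_ne_zero hy1
  have h1 := parabolic_le_fixingLetters hk ha 1 x (left_ne_zero_of_mul hx)
  have h2 := parabolic_le_fixingLetters hk hb y 1 (right_ne_zero_of_mul hy)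
  have h3 := right_ne_zero_of_mul hx
  rw [revGen_of_lt hk] at h3
  set i : Fin (n - 1) := ⟨n - 2 - k, by omega⟩ with hi'
  simp only [inv_one, Equiv.Perm.one_apply] at h1 h2
  have hxlo : x⁻¹ (lo i) = lo i := h1 _ le_rfl
  have hxhi : lo i < x⁻¹ (hi i) := by
    by_contra hcon
    have hle : ((x⁻¹ (hi i) : Fin n) : ℕ) ≤ n - 2 - k := not_lt.mp hcon
    have h4 := h1 _ hle
    have h5 := x⁻¹.injective h4
    rw [h5] at hcon
    exact hcon (lo_lt_hi i)
  have hup : Up i x := by rw [Up, hxlo]; exact hxhi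
  rcases metropolis_support h3 with rfl | ⟨rfl, h4⟩
  · have h4 := h2 (lo i) le_rfl
    rw [inv_simpleRefl_mul_apply, simpleRefl_lo] at h4
    rw [← h4] at hxhi
    exact lt_irrefl _ hxhi
  · exact h4 hup

end Relations

/-! ### The law of the scan at the identity -/

section ScanTrace
open Matrix

variable {n : ℕ}

/-- The exponent `n - 1 - c(S(n))` of a tableau. -/
def scanExponent {μ : Shape n} (S : StandardTableau μ) : ℕ :=
  ((n : ℤ) - 1 - content (boxOf S n)).toNat

theorem content_bounds {μ : Shape n} {b : ℕ × ℕ} (hb : b ∈ μ.1.cells) :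
    content b ≤ (n : ℤ) - 1 ∧ 1 - (n : ℤ) ≤ content b := by
  have h1 := YoungDiagram.mem_iff_lt_rowLen.mp (show (b.1, b.2) ∈ μ.1 from hb)
  have h2 := YoungDiagram.mem_iff_lt_colLen.mp (show (b.1, b.2) ∈ μ.1 from hb)
  have hr : μ.1.rowLen b.1 ≤ n := by
    rw [YoungDiagram.rowLen_eq_card]
    exact (Finset.card_le_card (Finset.filter_subset _ _)).trans μ.2.le
  have hc : μ.1.colLen b.2 ≤ n := by
    rw [YoungDiagram.colLen_eq_card]
    exact (Finset.card_le_card (Finset.filter_subset _ _)).trans μ.2.le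
  rw [content]
  omega

theorem scanExponent_cast (hn : 1 ≤ n) {μ : Shape n} (S : StandardTableau μ) :
    (scanExponent S : ℤ) = (n : ℤ) - 1 - content (lastBox hn S) := by
  have := content_bounds (boxOf_mem S (Finset.mem_Icc.mpr ⟨hn, le_rfl⟩))
  rw [scanExponent, lastBox_eq]
  omega

theorem scanExponent_lt (hn : 1 ≤ n) {μ : Shape n} (S : StandardTableau μ) :
    scanExponent S < 2 * n - 1 := by
  have := content_bounds (boxOf_mem S (Finset.mem_Icc.mpr ⟨hn, le_rfl⟩))
  rw [scanExponent]
  omega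

theorem jucysMurphy_eq {θ : ℝ} (hθ : θ ≠ 0) (k : ℕ) :
    palindrome (revGen n θ) k = θ ^ k • jucysMurphy θ (revGen n θ) k := by
  rw [jucysMurphy, smul_smul, mul_inv_cancel₀ (pow_ne_zero _ hθ), one_smul]

theorem shortScan_pow_entryOne_of_lt {θ : ℝ} (h0 : 0 < θ) (h1 : θ < 1) (hn : 1 ≤ n) (m : ℕ) :
    (shortScan n θ ^ m) 1 1 = ∑ μ : Shape n, shapeWeight θ⁻¹ μ.1 *
      ∑ S : StandardTableau μ, (θ ^ scanExponent S) ^ m := by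
  obtain ⟨M, rfl⟩ : ∃ M, n = M + 1 := ⟨n - 1, by omega⟩
  have key := (heckeRel_revGen (M + 1) θ).trace_jucysMurphy_pow h0 h1 (τ := entryOne (M + 1))
    (by simp [entryOne_apply]) (fun k hk a ha b hb => entryOne_mul_gen_mul hk ha hb) m
  have key' : (jucysMurphy θ (revGen (M + 1) θ) (M + 1 - 1) ^ m) 1 1 = _ := key
  rw [shortScan_eq_palindrome, jucysMurphy_eq h0.ne', smul_pow, Matrix.smul_apply,
    key', smul_eq_mul, Finset.mul_sum]
  refine Finset.sum_congr rfl fun μ _ => ?_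
  rw [mul_left_comm, Finset.mul_sum]
  congr 1
  refine Finset.sum_congr rfl fun S _ => ?_
  rw [← mul_pow]
  congr 1
  rw [← zpow_natCast, ← zpow_natCast, scanExponent_cast hn, lastBox_eq, _root_.inv_zpow', ← zpow_add₀ h0.ne']
  congr 1
  change (M : ℤ) + -content (boxOf S (M + 1)) = ((M + 1 : ℕ) : ℤ) - 1 - content (boxOf S (M + 1))
  push_cast
  ring

/-! ### Continuity in the parameter -/

theorem continuous_metropolis (i : Fin (n - 1)) : Continuous fun θ : ℝ => metropolis n θ i := by
  refine continuous_matrix fun x y => ?_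
  simp only [metropolis, of_apply]
  split_ifs <;> fun_prop

theorem continuous_revGen (k : ℕ) : Continuous fun θ : ℝ => revGen n θ k := by
  unfold revGen
  split_ifs
  · exact continuous_metropolis _
  · exact continuous_const

theorem continuous_palindrome (k : ℕ) : Continuous fun θ : ℝ => palindrome (revGen n θ) k := by
  induction k with
  | zero => exact continuous_const
  | succ k ih => exact ((continuous_revGen k).matrix_mul ih).matrix_mul (continuous_revGen k)

theorem continuous_shortScan : Continuous fun θ : ℝ => shortScan n θ := by
  simp only [shortScan_eq_palindrome]
  exact continuous_palindrome _

theorem continuousOn_shapeWeight (μ : YoungDiagram) :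
    ContinuousOn (fun θ : ℝ => shapeWeight θ⁻¹ μ) (Set.Ioc 0 1) := by
  have hinv : ContinuousOn (fun θ : ℝ => θ⁻¹) (Set.Ioc 0 1) :=
    continuousOn_inv₀.mono fun θ hθ => hθ.1.ne'
  refine ContinuousOn.div (hinv.pow _) ?_ fun θ hθ => ?_
  · refine continuousOn_finsetProd _ fun b _ => ?_
    exact continuousOn_finsetSum _ fun i _ => hinv.pow i
  · exact (prod_qInt_hooks_pos (inv_pos.mpr hθ.1) μ).ne'

theorem eqOn_Ioc_of_eqOn_Ioo {f g : ℝ → ℝ} (hf : ContinuousOn f (Set.Ioc 0 1))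
    (hg : ContinuousOn g (Set.Ioc 0 1)) (h : ∀ θ, 0 < θ → θ < 1 → f θ = g θ) :
    ∀ θ, 0 < θ → θ ≤ 1 → f θ = g θ := by
  intro θ h0 h1
  refine Set.EqOn.of_subset_closure (s := Set.Ioo 0 1) (t := Set.Ioc 0 1) ?_ hf hg
    Set.Ioo_subset_Ioc_self ?_ ⟨h0, h1⟩
  · exact fun x hx => h x hx.1 hx.2
  · rw [closure_Ioo (by norm_num)]
    exact Set.Ioc_subset_Icc_self

theorem continuousOn_tableauxSum {F : (μ : Shape n) → StandardTableau μ → ℝ → ℝ}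
    (hF : ∀ μ S, ContinuousOn (F μ S) (Set.Ioc 0 1)) :
    ContinuousOn (fun θ : ℝ => ∑ μ : Shape n, shapeWeight θ⁻¹ μ.1 *
      ∑ S : StandardTableau μ, F μ S θ) (Set.Ioc 0 1) :=
  continuousOn_finsetSum _ fun μ _ => (continuousOn_shapeWeight μ.1).mul
    (continuousOn_finsetSum _ fun S _ => hF μ S)

/-- The case θ = 1, where the nodes of the partial fractions collide, is reached by continuity. -/
theorem shortScan_pow_entryOne (hn : 1 ≤ n) (m : ℕ) :
    ∀ θ, 0 < θ → θ ≤ 1 → (shortScan n θ ^ m) 1 1 = ∑ μ : Shape n, shapeWeight θ⁻¹ μ.1 *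
      ∑ S : StandardTableau μ, (θ ^ scanExponent S) ^ m := by
  apply eqOn_Ioc_of_eqOn_Ioo
  · exact ((continuous_shortScan.pow m).matrix_elem 1 1).continuousOn
  · exact continuousOn_tableauxSum fun μ S => by fun_prop
  · exact fun θ h0 h1 => shortScan_pow_entryOne_of_lt h0 h1 hn m

/-! ### Reversibility -/

/-- The unnormalized Mallows weight. -/
noncomputable def mallowsWeight (θ : ℝ) (x : Equiv.Perm (Fin n)) : ℝ := θ⁻¹ ^ invCount x

theorem mallowsWeight_pos {θ : ℝ} (h0 : 0 < θ) (x : Equiv.Perm (Fin n)) :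
    0 < mallowsWeight θ x := by unfold mallowsWeight; positivity

/-- The matrices `a` and `b` are adjoint to each other in the Mallows inner product. -/
def AdjointPair (θ : ℝ) (a b : Matrix (Equiv.Perm (Fin n)) (Equiv.Perm (Fin n)) ℝ) : Prop :=
  ∀ x y, mallowsWeight θ x * a x y = mallowsWeight θ y * b y x

theorem AdjointPair.mul {θ : ℝ} {a b c d : Matrix (Equiv.Perm (Fin n)) (Equiv.Perm (Fin n)) ℝ}
    (h : AdjointPair θ a b) (h' : AdjointPair θ c d) : AdjointPair θ (a * c) (d * b) := by
  intro x y
  rw [mul_apply, mul_apply, Finset.mul_sum, Finset.mul_sum]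
  refine Finset.sum_congr rfl fun z _ => ?_
  rw [← mul_assoc, h x z, mul_right_comm, h' z y]
  ring

theorem AdjointPair.add {θ : ℝ} {a b c d : Matrix (Equiv.Perm (Fin n)) (Equiv.Perm (Fin n)) ℝ}
    (h : AdjointPair θ a b) (h' : AdjointPair θ c d) : AdjointPair θ (a + c) (b + d) := by
  intro x y
  rw [Matrix.add_apply, Matrix.add_apply, mul_add, mul_add, h, h']

theorem AdjointPair.smul {θ : ℝ} (c : ℝ)
    {a b : Matrix (Equiv.Perm (Fin n)) (Equiv.Perm (Fin n)) ℝ}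
    (h : AdjointPair θ a b) : AdjointPair θ (c • a) (c • b) := by
  intro x y
  rw [Matrix.smul_apply, Matrix.smul_apply, mul_smul_comm, mul_smul_comm, h]

theorem AdjointPair.one {θ : ℝ} :
    AdjointPair θ (1 : Matrix (Equiv.Perm (Fin n)) (Equiv.Perm (Fin n)) ℝ) 1 := by
  intro x y
  by_cases h : x = y
  · rw [h]
  · rw [one_apply_ne h, one_apply_ne (Ne.symm h), mul_zero, mul_zero]

theorem AdjointPair.pow {θ : ℝ} {a : Matrix (Equiv.Perm (Fin n)) (Equiv.Perm (Fin n)) ℝ}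
    (h : AdjointPair θ a a) (m : ℕ) : AdjointPair θ (a ^ m) (a ^ m) := by
  induction m with
  | zero => rw [pow_zero]; exact AdjointPair.one
  | succ m ih =>
    have := ih.mul h
    rwa [← pow_succ, ← pow_succ'] at this

theorem AdjointPair.aeval {θ : ℝ} {a : Matrix (Equiv.Perm (Fin n)) (Equiv.Perm (Fin n)) ℝ}
    (h : AdjointPair θ a a) (P : Polynomial ℝ) :
    AdjointPair θ (Polynomial.aeval a P) (Polynomial.aeval a P) := by
  induction P using Polynomial.induction_on' with
  | add P Q hP hQ => rw [map_add]; exact hP.add hQ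
  | monomial k c =>
    rw [Polynomial.aeval_monomial, ← Algebra.smul_def]
    exact (h.pow k).smul c

theorem adjointPair_metropolis {θ : ℝ} (h0 : θ ≠ 0) (i : Fin (n - 1)) :
    AdjointPair θ (metropolis n θ i) (metropolis n θ i) := by
  have key : ∀ x, Up i x → mallowsWeight θ x * metropolis n θ i x (simpleRefl n i * x) =
      mallowsWeight θ (simpleRefl n i * x) * metropolis n θ i (simpleRefl n i * x) x := by
    intro x hx
    have hx' : ¬ Up i (simpleRefl n i * x) := by rw [up_simpleRefl_mul]; exact not_not.mpr hx
    rw [metropolis_up hx, metropolis_down hx', if_pos rfl, simpleRefl_mul_cancel, if_pos rfl,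
      if_neg (simpleRefl_mul_ne i x).symm, mallowsWeight, mallowsWeight, invCount_up hx, pow_succ]
    field_simp
    ring
  intro x y
  by_cases hxy : y = simpleRefl n i * x
  · subst hxy
    by_cases hx : Up i x
    · exact key x hx
    · have := key _ ((up_simpleRefl_mul i x).mpr hx)
      rw [simpleRefl_mul_cancel] at this
      exact this.symm
  · by_cases hyx : y = x
    · rw [hyx]
    · have e1 : metropolis n θ i x y = 0 := by
        by_contra h
        rcases metropolis_support h with h | ⟨h, _⟩
        exacts [hxy h, hyx h]
      have e2 : metropolis n θ i y x = 0 := by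
        by_contra h
        rcases metropolis_support h with h | ⟨h, _⟩
        · exact hxy (by rw [h, simpleRefl_mul_cancel])
        · exact hyx h.symm
      rw [e1, e2, mul_zero, mul_zero]

theorem adjointPair_revGen {θ : ℝ} (h0 : θ ≠ 0) (k : ℕ) :
    AdjointPair θ (revGen n θ k) (revGen n θ k) := by
  unfold revGen
  split_ifs
  · exact adjointPair_metropolis h0 _
  · exact AdjointPair.one

theorem adjointPair_palindrome {θ : ℝ} (h0 : θ ≠ 0) (k : ℕ) :
    AdjointPair θ (palindrome (revGen n θ) k) (palindrome (revGen n θ) k) := by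
  induction k with
  | zero => exact AdjointPair.one
  | succ k ih =>
    have h := ((adjointPair_revGen (n := n) h0 k).mul ih).mul (adjointPair_revGen h0 k)
    rw [← mul_assoc] at h
    exact h

/-- The matrices which commute with the chains acting on positions. -/
def leftAlgebra (n : ℕ) (θ : ℝ) :
    Subalgebra ℝ (Matrix (Equiv.Perm (Fin n)) (Equiv.Perm (Fin n)) ℝ) :=
  Subalgebra.centralizer ℝ (Set.range (rightMetropolis n θ))

theorem mem_leftAlgebra {θ : ℝ} {a : Matrix (Equiv.Perm (Fin n)) (Equiv.Perm (Fin n)) ℝ} :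
    a ∈ leftAlgebra n θ ↔ ∀ j, a * rightMetropolis n θ j = rightMetropolis n θ j * a := by
  rw [leftAlgebra, Subalgebra.mem_centralizer_iff]
  simp [eq_comm]

theorem revGen_mem_leftAlgebra {θ : ℝ} (k : ℕ) : revGen n θ k ∈ leftAlgebra n θ := by
  unfold revGen
  split_ifs
  · rw [mem_leftAlgebra]
    exact fun j => metropolis_commute_right _ j
  · exact one_mem _

/-- The functional `a ↦ a 1 1` is faithful on the commutant of the right chains. For self-adjoint
`a`, the entry of a² is a positively weighted sum of squares of the first row, and the first row
determines the matrix. -/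
theorem eq_zero_of_sq_entryOne {θ : ℝ} (h0 : 0 < θ)
    {a : Matrix (Equiv.Perm (Fin n)) (Equiv.Perm (Fin n)) ℝ} (ha : a ∈ leftAlgebra n θ)
    (had : AdjointPair θ a a) (h : (a * a) 1 1 = 0) : a = 0 := by
  refine eq_of_first_row (θ := θ) (mem_leftAlgebra.mp ha) (by simp) fun y => ?_
  have e : ∀ y, a 1 y * a y 1 = mallowsWeight θ (1 : Equiv.Perm (Fin n)) / mallowsWeight θ y * (a 1 y) ^ 2 := by
    intro y
    have h1 := had 1 y
    have h2 := (mallowsWeight_pos h0 y).ne'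
    field_simp
    linear_combination (-a 1 y) * h1
  rw [mul_apply] at h
  have h2 := (Finset.sum_eq_zero_iff_of_nonneg (fun y _ => by
    rw [e]
    have h1 := mallowsWeight_pos h0 y
    have h2 := mallowsWeight_pos h0 (1 : Equiv.Perm (Fin n))
    positivity)).mp h y (Finset.mem_univ y)
  rw [e] at h2
  have h1 := mallowsWeight_pos h0 y
  have h3 := mallowsWeight_pos h0 (1 : Equiv.Perm (Fin n))
  rcases mul_eq_zero.mp h2 with h4 | h4
  · exact absurd h4 (by positivity)
  · simpa using h4

end ScanTrace

/-! ### The trace of the powers of the scan -/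

section FullTrace
open Matrix

variable {n : ℕ}

/-- The matrices `D_k` with `palindrome k = 1 + (θ - 1) • D_k`. -/
noncomputable def derivScan (n : ℕ) (θ : ℝ) :
    ℕ → Matrix (Equiv.Perm (Fin n)) (Equiv.Perm (Fin n)) ℝ
  | 0 => 0
  | k + 1 => 1 - revGen n θ k + revGen n θ k * derivScan n θ k * revGen n θ k

/-- Follows from t² = 1 + (θ-1)(1 - t). At θ = 1 all eigenvalues θ^j of the scan merge, whereas
those of the divided difference, [j]_θ, stay apart. This is why the spectral projections are built
from `derivScan`. -/
theorem palindrome_eq_derivScan (θ : ℝ) (k : ℕ) (hk : k ≤ n - 1) :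
    palindrome (revGen n θ) k = 1 + (θ - 1) • derivScan n θ k := by
  induction k with
  | zero => rw [palindrome, derivScan, smul_zero, add_zero]
  | succ k ih =>
    rw [palindrome, ih (by omega), derivScan, mul_add, add_mul, mul_one,
      (heckeRel_revGen n θ).quad k (by omega), mul_smul_comm, smul_mul_assoc]
    module

theorem AdjointPair.sub {θ : ℝ} {a b c d : Matrix (Equiv.Perm (Fin n)) (Equiv.Perm (Fin n)) ℝ}
    (h : AdjointPair θ a b) (h' : AdjointPair θ c d) : AdjointPair θ (a - c) (b - d) := by
  intro x y
  rw [Matrix.sub_apply, Matrix.sub_apply, mul_sub, mul_sub, h, h']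

theorem adjointPair_derivScan {θ : ℝ} (h0 : θ ≠ 0) (k : ℕ) :
    AdjointPair θ (derivScan n θ k) (derivScan n θ k) := by
  induction k with
  | zero => intro x y; simp [derivScan]
  | succ k ih =>
    have h := ((adjointPair_revGen (n := n) h0 k).mul ih).mul (adjointPair_revGen h0 k)
    rw [← mul_assoc] at h
    exact (AdjointPair.one.sub (adjointPair_revGen h0 k)).add h

theorem derivScan_mem {θ : ℝ} {s : Subalgebra ℝ (Matrix (Equiv.Perm (Fin n)) (Equiv.Perm (Fin n)) ℝ)}
    (hs : ∀ k, revGen n θ k ∈ s) (k : ℕ) : derivScan n θ k ∈ s := by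
  induction k with
  | zero => exact zero_mem _
  | succ k ih =>
    exact add_mem (sub_mem (one_mem _) (hs k)) (mul_mem (mul_mem (hs k) ih) (hs k))

theorem continuous_derivScan (k : ℕ) : Continuous fun θ : ℝ => derivScan n θ k := by
  induction k with
  | zero => exact continuous_const
  | succ k ih =>
    exact (continuous_const.sub (continuous_revGen k)).add
      (((continuous_revGen k).matrix_mul ih).matrix_mul (continuous_revGen k))

theorem aeval_mem {A : Type*} [Ring A] [Algebra ℝ A] {s : Subalgebra ℝ A} {a : A} (ha : a ∈ s)
    (P : Polynomial ℝ) : Polynomial.aeval a P ∈ s := by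
  have := Polynomial.aeval_mem_adjoin_singleton ℝ a (p := P)
  exact Algebra.adjoin_le (Set.singleton_subset_iff.mpr ha) this

theorem aeval_shortScan_entryOne {θ : ℝ} (h0 : 0 < θ) (h1 : θ ≤ 1) (hn : 1 ≤ n)
    (P : Polynomial ℝ) :
    (Polynomial.aeval (shortScan n θ) P) 1 1 = ∑ μ : Shape n, shapeWeight θ⁻¹ μ.1 *
      ∑ S : StandardTableau μ, P.eval (θ ^ scanExponent S) := by
  induction P using Polynomial.induction_on' with
  | add P Q hP hQ =>
    rw [map_add, Matrix.add_apply, hP, hQ, ← Finset.sum_add_distrib]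
    simp only [Polynomial.eval_add, Finset.sum_add_distrib, mul_add]
  | monomial k c =>
    rw [Polynomial.aeval_monomial, ← Algebra.smul_def, Matrix.smul_apply,
      shortScan_pow_entryOne hn k θ h0 h1, smul_eq_mul, Finset.mul_sum]
    refine Finset.sum_congr rfl fun μ _ => ?_
    simp only [Polynomial.eval_monomial, ← Finset.mul_sum]
    ring

/-- The polynomial which turns the scan into its derivative. -/
noncomputable def scanLine (θ : ℝ) : Polynomial ℝ :=
  Polynomial.C (θ - 1)⁻¹ * (Polynomial.X - 1)

theorem derivScan_eq_aeval {θ : ℝ} (h1 : θ < 1) :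
    derivScan n θ (n - 1) = Polynomial.aeval (shortScan n θ) (scanLine θ) := by
  have h : θ - 1 ≠ 0 := by linarith
  rw [scanLine, map_mul, Polynomial.aeval_C, map_sub, Polynomial.aeval_X, map_one,
    ← Algebra.smul_def, shortScan_eq_palindrome, palindrome_eq_derivScan _ _ le_rfl,
    add_sub_cancel_left, smul_smul, inv_mul_cancel₀ h, one_smul]

theorem aeval_derivScan_entryOne {θ : ℝ} (h0 : 0 < θ) (h1 : θ < 1) (hn : 1 ≤ n)
    (P : Polynomial ℝ) :
    (Polynomial.aeval (derivScan n θ (n - 1)) P) 1 1 = ∑ μ : Shape n, shapeWeight θ⁻¹ μ.1 *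
      ∑ S : StandardTableau μ, P.eval (qInt θ (scanExponent S)) := by
  have h : θ - 1 ≠ 0 := by linarith
  rw [derivScan_eq_aeval h1, ← Polynomial.aeval_comp, aeval_shortScan_entryOne h0 h1.le hn]
  refine Finset.sum_congr rfl fun μ _ => ?_
  congr 1
  refine Finset.sum_congr rfl fun S _ => ?_
  rw [Polynomial.eval_comp]
  congr 1
  rw [scanLine, Polynomial.eval_mul, Polynomial.eval_C, Polynomial.eval_sub, Polynomial.eval_X,
    Polynomial.eval_one, ← qInt_mul_sub_one]
  field_simp

/-- P(D) is self-adjoint in the commutant, and the entry of P(D)² at the identity is a combination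
of the values P([j]_θ)², all zero. Faithfulness gives P(D) = 0, so D is annihilated by a polynomial
with the simple roots [j]_θ, j < 2n - 1. -/
theorem aeval_derivScan_eq_zero {θ : ℝ} (h0 : 0 < θ) (h1 : θ < 1) (hn : 1 ≤ n)
    (P : Polynomial ℝ) (hP : ∀ j < 2 * n - 1, P.eval (qInt θ j) = 0) :
    Polynomial.aeval (derivScan n θ (n - 1)) P = 0 := by
  refine eq_zero_of_sq_entryOne h0 (aeval_mem (derivScan_mem revGen_mem_leftAlgebra _) P)
    ((adjointPair_derivScan h0.ne' _).aeval P) ?_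
  rw [← map_mul, aeval_derivScan_entryOne h0 h1 hn]
  refine Finset.sum_eq_zero fun μ _ => ?_
  rw [Finset.sum_eq_zero fun S _ => ?_, mul_zero]
  rw [Polynomial.eval_mul, hP _ (scanExponent_lt hn S), zero_mul]

/-! ### The spectral projections -/

theorem qInt_strictMono {θ : ℝ} (h0 : 0 < θ) : StrictMono (qInt θ) := by
  refine strictMono_nat_of_lt_succ fun k => ?_
  rw [qInt, qInt, Finset.sum_range_succ]
  have := pow_pos h0 k
  linarith

/-- The polynomial which is `1` at the `j`-th eigenvalue of the derivative and `0` at the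
others. -/
noncomputable def nodePoly (n : ℕ) (θ : ℝ) (j : ℕ) : Polynomial ℝ :=
  Lagrange.basis (Finset.range (2 * n - 1)) (qInt θ) j

theorem eval_nodePoly {θ : ℝ} (h0 : 0 < θ) {i j : ℕ} (hi : i < 2 * n - 1) (hj : j < 2 * n - 1) :
    (nodePoly n θ j).eval (qInt θ i) = if i = j then 1 else 0 := by
  split_ifs with h
  · subst h
    exact Lagrange.eval_basis_self (qInt_strictMono h0).injective.injOn (Finset.mem_range.mpr hi)
  · exact Lagrange.eval_basis_of_ne (Ne.symm h) (Finset.mem_range.mpr hi)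

/-- The spectral projection of the scan onto the eigenvalue `θ ^ j`. -/
noncomputable def scanProj (n : ℕ) (θ : ℝ) (j : ℕ) :
    Matrix (Equiv.Perm (Fin n)) (Equiv.Perm (Fin n)) ℝ :=
  Polynomial.aeval (derivScan n θ (n - 1)) (nodePoly n θ j)

theorem scanProj_idempotent {θ : ℝ} (h0 : 0 < θ) (h1 : θ < 1) (hn : 1 ≤ n) {j : ℕ}
    (hj : j < 2 * n - 1) : IsIdempotentElem (scanProj n θ j) := by
  have h := aeval_derivScan_eq_zero h0 h1 hn (nodePoly n θ j * nodePoly n θ j - nodePoly n θ j)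
    (fun i hi => by
      rw [Polynomial.eval_sub, Polynomial.eval_mul, eval_nodePoly h0 hi hj]
      split_ifs <;> norm_num)
  rw [map_sub, map_mul] at h
  exact sub_eq_zero.mp h

theorem trace_idempotent {ι : Type*} [Fintype ι] [DecidableEq ι] {a : Matrix ι ι ℝ}
    (h : IsIdempotentElem a) : ∃ k : ℕ, a.trace = k := by
  have h' : IsIdempotentElem (toLin' a) := by
    rw [IsIdempotentElem, Module.End.mul_eq_comp, ← toLin'_mul, h.eq]
  have := (LinearMap.IsIdempotentElem.isProj_range _ h').trace
  rw [Matrix.trace_toLin'_eq] at this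
  exact ⟨_, this⟩

theorem continuous_qInt (k : ℕ) : Continuous fun θ : ℝ => qInt θ k :=
  continuous_finsetSum _ fun i _ => continuous_pow i

theorem continuousOn_scanProj (j : ℕ) :
    ContinuousOn (fun θ : ℝ => scanProj n θ j) (Set.Ioc 0 1) := by
  have key : ∀ s : Finset ℕ, j ∉ s → ContinuousOn (fun θ : ℝ =>
      Polynomial.aeval (derivScan n θ (n - 1))
        (∏ i ∈ s, Lagrange.basisDivisor (qInt θ j) (qInt θ i))) (Set.Ioc 0 1) := by
    intro s
    induction s using Finset.induction_on with
    | empty =>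
      intro _
      simp only [Finset.prod_empty, map_one]
      exact continuousOn_const
    | insert i s hi ih =>
      intro hj
      rw [Finset.mem_insert, not_or] at hj
      simp only [Finset.prod_insert hi, map_mul]
      refine ContinuousOn.mul ?_ (ih hj.2)
      simp only [Lagrange.basisDivisor, map_mul, map_sub, Polynomial.aeval_C, Polynomial.aeval_X,
        ← Algebra.smul_def]
      refine ContinuousOn.smul (ContinuousOn.inv₀ (f := fun θ => qInt θ j - qInt θ i) ?_ ?_)
        (ContinuousOn.sub ?_ ?_)
      · exact (Continuous.sub (continuous_qInt j) (continuous_qInt i)).continuousOn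
      · intro θ hθ h
        exact hj.1 ((qInt_strictMono hθ.1).injective (sub_eq_zero.mp h))
      · exact (continuous_derivScan _).continuousOn
      · simp only [Algebra.algebraMap_eq_smul_one]
        exact ((continuous_qInt i).smul continuous_const).continuousOn
  exact key ((Finset.range (2 * n - 1)).erase j) (Finset.notMem_erase _ _)

theorem continuousOn_trace_scanProj (j : ℕ) :
    ContinuousOn (fun θ : ℝ => (scanProj n θ j).trace) (Set.Ioc 0 1) := by
  simp only [trace, diag_apply]
  refine continuousOn_finsetSum _ fun x _ => ?_
  exact (continuous_apply_apply x x).comp_continuousOn (continuousOn_scanProj j)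

/-- For θ < 1 this trace is the rank of an idempotent. A continuous function from an interval to the
natural numbers is constant, and continuity extends the equality to θ = 1. -/
theorem trace_scanProj_eq (hn : 1 ≤ n) {j : ℕ} (hj : j < 2 * n - 1) :
    ∀ θ, 0 < θ → θ ≤ 1 → (scanProj n θ j).trace = (scanProj n 1 j).trace := by
  -- The naturals form a discrete subset of the reals; this is what makes a continuous
  -- integer-valued trace constant.
  have : DiscreteTopology (Set.range ((↑) : ℕ → ℝ)) :=
    (Nat.isClosedEmbedding_coe_real.isEmbedding.toHomeomorph.symm).isEmbedding.discreteTopology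
  have hc : ∀ θ, 0 < θ → θ < 1 → (scanProj n θ j).trace = (scanProj n (1 / 2) j).trace := by
    intro θ h0 h1
    refine (isPreconnected_Ioo (a := (0 : ℝ)) (b := 1)).constant_of_mapsTo
      (T := Set.range ((↑) : ℕ → ℝ)) ⟨this⟩
      ((continuousOn_trace_scanProj (n := n) j).mono Set.Ioo_subset_Ioc_self) ?_ ⟨h0, h1⟩
      ⟨by norm_num, by norm_num⟩
    intro x hx
    obtain ⟨k, hk⟩ := trace_idempotent (scanProj_idempotent hx.1 hx.2 hn hj)
    exact ⟨k, hk.symm⟩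
  have hc' := eqOn_Ioc_of_eqOn_Ioo (continuousOn_trace_scanProj (n := n) j) continuousOn_const hc
  intro θ h0 h1
  rw [hc' θ h0 h1, hc' 1 one_pos le_rfl]

/-! ### The scan at `θ = 1` -/

/-- The matrices which commute with right translations. -/
def translationInvariant (n : ℕ) :
    Subalgebra ℝ (Matrix (Equiv.Perm (Fin n)) (Equiv.Perm (Fin n)) ℝ) where
  carrier := {a | ∀ g x y, a (x * g) (y * g) = a x y}
  mul_mem' := by
    intro a b ha hb g x y
    rw [mul_apply, mul_apply, ← Equiv.sum_comp (Equiv.mulRight g)]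
    exact Finset.sum_congr rfl fun z _ => by
      rw [Equiv.coe_mulRight, ha, hb]
  add_mem' := by
    intro a b ha hb g x y
    rw [Matrix.add_apply, Matrix.add_apply, ha, hb]
  algebraMap_mem' := by
    intro c g x y
    simp only [algebraMap_matrix_apply, mul_left_inj]

theorem revGen_one_mem (k : ℕ) : revGen n 1 k ∈ translationInvariant n := by
  unfold revGen
  split_ifs
  · have h : ∀ i : Fin (n - 1), ∀ x y, metropolis n 1 i x y =
        if y = simpleRefl n i * x then 1 else 0 := by
      intro i x y
      by_cases hu : Up i x
      · exact metropolis_up hu y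
      · rw [metropolis_down hu]; simp
    intro g x y
    simp only [h, ← mul_assoc, mul_left_inj]
  · exact one_mem _

theorem trace_of_mem_translationInvariant
    {a : Matrix (Equiv.Perm (Fin n)) (Equiv.Perm (Fin n)) ℝ} (ha : a ∈ translationInvariant n) :
    a.trace = n.factorial * a 1 1 := by
  have : ∀ x, a x x = a 1 1 := fun x => by
    have := ha x 1 1
    rwa [one_mul] at this
  simp [trace, this, Fintype.card_perm]

/-- At θ = 1 the chains are deterministic left multiplications, so all diagonal entries agree with
the entry at the identity. That entry is the limit as θ tends to 1 of the law already found, which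
brings in the classical hook weights. -/
theorem trace_scanProj (hn : 1 ≤ n) {j : ℕ} (hj : j < 2 * n - 1) {θ : ℝ} (h0 : 0 < θ)
    (h1 : θ ≤ 1) : (scanProj n θ j).trace = n.factorial * ∑ μ : Shape n, shapeWeight 1 μ.1 *
      ∑ S : StandardTableau μ, if scanExponent S = j then 1 else 0 := by
  have hinv : scanProj n 1 j ∈ translationInvariant n :=
    aeval_mem (derivScan_mem revGen_one_mem _) _
  rw [trace_scanProj_eq hn hj θ h0 h1, trace_of_mem_translationInvariant hinv]
  congr 1
  have := eqOn_Ioc_of_eqOn_Ioo (f := fun θ => scanProj n θ j 1 1)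
    (g := fun θ => ∑ μ : Shape n, shapeWeight θ⁻¹ μ.1 *
      ∑ S : StandardTableau μ, if scanExponent S = j then 1 else 0)
    ((continuous_apply_apply 1 1).comp_continuousOn (continuousOn_scanProj j))
    (continuousOn_tableauxSum fun μ S => continuousOn_const) ?_ 1 one_pos le_rfl
  · simpa using this
  · intro θ h0 h1
    refine (aeval_derivScan_entryOne h0 h1 hn (nodePoly n θ j)).trans ?_
    refine Finset.sum_congr rfl fun μ _ => ?_
    congr 1
    exact Finset.sum_congr rfl fun S _ => eval_nodePoly h0 (scanExponent_lt hn S) hj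

theorem shortScan_pow_eq {θ : ℝ} (h0 : 0 < θ) (h1 : θ < 1) (hn : 1 ≤ n) (m : ℕ) :
    shortScan n θ ^ m = ∑ j ∈ Finset.range (2 * n - 1), (θ ^ j) ^ m • scanProj n θ j := by
  have h := aeval_derivScan_eq_zero h0 h1 hn
    ((1 + Polynomial.C (θ - 1) * Polynomial.X) ^ m -
      ∑ j ∈ Finset.range (2 * n - 1), Polynomial.C ((θ ^ j) ^ m) * nodePoly n θ j)
    (fun i hi => by
      rw [Polynomial.eval_sub, Polynomial.eval_finsetSum, sub_eq_zero]
      simp only [Polynomial.eval_pow, Polynomial.eval_add, Polynomial.eval_one,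
        Polynomial.eval_mul, Polynomial.eval_C, Polynomial.eval_X]
      rw [Finset.sum_eq_single i, eval_nodePoly h0 hi hi, if_pos rfl, mul_one, mul_comm (θ - 1),
        qInt_mul_sub_one, add_sub_cancel]
      · intro j hj hji
        rw [eval_nodePoly h0 hi (Finset.mem_range.mp hj), if_neg hji.symm, mul_zero]
      · intro h
        exact absurd (Finset.mem_range.mpr hi) h)
  rw [map_sub, sub_eq_zero, map_pow, map_add, map_one, map_mul, Polynomial.aeval_C,
    Polynomial.aeval_X, ← Algebra.smul_def, ← palindrome_eq_derivScan _ _ le_rfl,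
    ← shortScan_eq_palindrome, map_sum] at h
  rw [h]
  refine Finset.sum_congr rfl fun j _ => ?_
  rw [map_mul, Polynomial.aeval_C, ← Algebra.smul_def, scanProj]

theorem trace_shortScan_pow (hn : 1 ≤ n) (m : ℕ) :
    ∀ θ, 0 < θ → θ ≤ 1 → (shortScan n θ ^ m).trace = n.factorial * ∑ μ : Shape n,
      shapeWeight 1 μ.1 * ∑ S : StandardTableau μ, (θ ^ scanExponent S) ^ m := by
  apply eqOn_Ioc_of_eqOn_Ioo
  · exact ((continuous_shortScan.pow m).matrix_trace).continuousOn
  · fun_prop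
  · intro θ h0 h1
    rw [shortScan_pow_eq h0 h1 hn, trace_sum]
    have : ∀ j ∈ Finset.range (2 * n - 1), ((θ ^ j) ^ m • scanProj n θ j).trace =
        ∑ μ : Shape n, n.factorial * (shapeWeight 1 μ.1 *
          ∑ S : StandardTableau μ, if scanExponent S = j then (θ ^ j) ^ m else 0) := by
      intro j hj
      rw [trace_smul, trace_scanProj hn (Finset.mem_range.mp hj) h0 h1.le, smul_eq_mul,
        mul_left_comm, Finset.mul_sum, Finset.mul_sum]
      refine Finset.sum_congr rfl fun μ _ => ?_
      have e : ∀ S : StandardTableau μ, (if scanExponent S = j then (θ ^ j) ^ m else 0) =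
          (θ ^ j) ^ m * if scanExponent S = j then 1 else 0 := fun S => by
        rw [mul_ite, mul_one, mul_zero]
      simp only [e, ← Finset.mul_sum]
      ring
    rw [Finset.sum_congr rfl this, Finset.sum_comm, Finset.mul_sum]
    refine Finset.sum_congr rfl fun μ _ => ?_
    rw [← Finset.mul_sum, ← Finset.mul_sum, Finset.sum_comm]
    congr 2
    refine Finset.sum_congr rfl fun S _ => ?_
    rw [Finset.sum_ite_eq, if_pos (Finset.mem_range.mpr (scanExponent_lt hn S))]

end FullTrace

/-! ### The Poincaré polynomial -/

section Poincare

theorem invCount_inv {n : ℕ} (σ : Equiv.Perm (Fin n)) :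
    invCount σ⁻¹ = ∑ u, ∑ v, if u < v ∧ σ v < σ u then 1 else 0 := by
  rw [invCount, inversions, Finset.card_filter, ← Finset.univ_product_univ, Finset.sum_product]
  rfl

/-- The permutation which sends `0` to `p` and acts on the other letters like `e`. -/
def insertPerm {n : ℕ} (a : Fin (n + 1) × Equiv.Perm (Fin n)) : Equiv.Perm (Fin (n + 1)) :=
  a.1.cycleRange.symm * Equiv.Perm.decomposeFin.symm (0, a.2)

theorem insertPerm_zero {n : ℕ} (p : Fin (n + 1)) (e : Equiv.Perm (Fin n)) :
    insertPerm (p, e) 0 = p := by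
  simp [insertPerm]

theorem insertPerm_succ {n : ℕ} (p : Fin (n + 1)) (e : Equiv.Perm (Fin n)) (j : Fin n) :
    insertPerm (p, e) j.succ = p.succAbove (e j) := by
  simp [insertPerm]

theorem insertPerm_bijective (n : ℕ) : Function.Bijective (insertPerm (n := n)) := by
  rw [Fintype.bijective_iff_injective_and_card]
  constructor
  · rintro ⟨p, e⟩ ⟨p', e'⟩ h
    have h1 : p = p' := by rw [← insertPerm_zero p e, h, insertPerm_zero]
    subst h1
    have h2 : e = e' := by
      ext j
      have h3 := insertPerm_succ p e j
      rw [h, insertPerm_succ] at h3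
      rw [Fin.succAbove_right_injective h3]
    rw [h2]
  · rw [Fintype.card_prod, Fintype.card_perm, Fintype.card_perm, Fintype.card_fin,
      Fintype.card_fin, Nat.factorial_succ]

/-- The first position holds p and forms an inversion with each of the p smaller values. The other
positions are ordered as by `e`. -/
theorem invCount_insertPerm {n : ℕ} (p : Fin (n + 1)) (e : Equiv.Perm (Fin n)) :
    invCount (insertPerm (p, e))⁻¹ = p + invCount e⁻¹ := by
  rw [invCount_inv, invCount_inv, Fin.sum_univ_succ]
  congr 1
  · rw [Fin.sum_univ_succ]
    simp only [lt_self_iff_false, false_and, if_false, zero_add, Fin.succ_pos, true_and,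
      insertPerm_zero, insertPerm_succ, Fin.succAbove_lt_iff_castSucc_lt]
    rw [Equiv.sum_comp e (fun j => if j.castSucc < p then 1 else 0), Finset.sum_boole]
    simp only [Nat.cast_id, Fin.lt_def, Fin.val_castSucc]
    rw [Fin.card_filter_val_lt]
    have := p.2
    omega
  · refine Finset.sum_congr rfl fun u _ => ?_
    rw [Fin.sum_univ_succ]
    simp only [insertPerm_succ, Fin.succ_lt_succ_iff, Fin.succAbove_lt_succAbove_iff,
      Fin.not_lt_zero, false_and, if_false, zero_add]

theorem sum_pow_invCount (q : ℝ) (n : ℕ) :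
    ∑ x : Equiv.Perm (Fin n), q ^ invCount x = qFactorial q n := by
  rw [← Equiv.sum_comp (Equiv.inv _)]
  simp only [Equiv.inv_apply]
  induction n with
  | zero => simp [invCount_inv, qFactorial]
  | succ n ih =>
    rw [← (insertPerm_bijective n).sum_comp, ← Finset.univ_product_univ, Finset.sum_product]
    simp only [invCount_insertPerm, pow_add, ← Finset.mul_sum, ih]
    rw [← Finset.sum_mul, Fin.sum_univ_eq_sum_range (fun i => q ^ i) (n + 1), qFactorial,
      qFactorial, Finset.prod_Icc_succ_top (by omega), mul_comm]
    rfl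

theorem qFactorial_pos {q : ℝ} (hq : 0 < q) (n : ℕ) : 0 < qFactorial q n :=
  Finset.prod_pos fun _ hk => qInt_pos hq (Finset.mem_Icc.mp hk).1

theorem mallows_eq (n : ℕ) (θ : ℝ) (x : Equiv.Perm (Fin n)) :
    mallows n θ x = mallowsWeight θ x / qFactorial θ⁻¹ n := by
  have h : ∀ x : Equiv.Perm (Fin n), θ ^ (-(length x : ℤ)) = θ⁻¹ ^ invCount x := fun x => by
    rw [length_eq_invCount, zpow_neg, zpow_natCast, inv_pow]
  rw [mallows, h, ← sum_pow_invCount, mallowsWeight]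
  simp only [h]

theorem mallows_pos {n : ℕ} {θ : ℝ} (h0 : 0 < θ) (x : Equiv.Perm (Fin n)) :
    0 < mallows n θ x := by
  rw [mallows_eq]
  exact div_pos (mallowsWeight_pos h0 x) (qFactorial_pos (inv_pos.mpr h0) n)

theorem sum_mallows {n : ℕ} {θ : ℝ} (h0 : 0 < θ) : ∑ x, mallows n θ x = 1 := by
  simp only [mallows_eq, ← Finset.sum_div, mallowsWeight, sum_pow_invCount]
  exact div_self (qFactorial_pos (inv_pos.mpr h0) n).ne'

end Poincare

/-! ### The distance in `L²` -/

section Distance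
open Matrix

variable {n : ℕ} {θ : ℝ}

theorem revGen_mulVec_one (k : ℕ) : revGen n θ k *ᵥ 1 = 1 := by
  unfold revGen
  split_ifs
  · funext x
    rw [metropolis_mulVec]
    simp
  · exact one_mulVec _

theorem palindrome_mulVec_one (k : ℕ) : palindrome (revGen n θ) k *ᵥ 1 = 1 := by
  induction k with
  | zero => exact one_mulVec _
  | succ k ih =>
    rw [palindrome, ← mulVec_mulVec, ← mulVec_mulVec, revGen_mulVec_one, ih, revGen_mulVec_one]

theorem shortScan_pow_mulVec_one (m : ℕ) : shortScan n θ ^ m *ᵥ 1 = 1 := by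
  induction m with
  | zero => rw [pow_zero, one_mulVec]
  | succ m ih =>
    rw [pow_succ, ← mulVec_mulVec, shortScan_eq_palindrome, palindrome_mulVec_one,
      ← shortScan_eq_palindrome, ih]

theorem sum_shortScan_pow (m : ℕ) (x : Equiv.Perm (Fin n)) : ∑ y, (shortScan n θ ^ m) x y = 1 := by
  have := congrFun (shortScan_pow_mulVec_one (n := n) (θ := θ) m) x
  simpa [mulVec, dotProduct] using this

theorem adjointPair_shortScan (h0 : θ ≠ 0) : AdjointPair θ (shortScan n θ) (shortScan n θ) := by
  rw [shortScan_eq_palindrome]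
  exact adjointPair_palindrome h0 _

/-- By reversibility K^ℓ(x,y)²/π(y) = K^ℓ(x,y) K^ℓ(y,x)/π(x). Summed over y, this gives
K^{2ℓ}(x,x)/π(x); the cross term and the constant contribute -2 + 1. -/
theorem scanL2_eq (h0 : 0 < θ) (ℓ : ℕ) (x : Equiv.Perm (Fin n)) :
    scanL2 n θ ℓ x = (shortScan n θ ^ (2 * ℓ)) x x / mallows n θ x - 1 := by
  have hrev : ∀ y, mallows n θ x * (shortScan n θ ^ ℓ) x y =
      mallows n θ y * (shortScan n θ ^ ℓ) y x := fun y => by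
    have := (adjointPair_shortScan h0.ne').pow ℓ x y
    rw [mallows_eq, mallows_eq, div_mul_eq_mul_div, this, div_mul_eq_mul_div]
  have hx := (mallows_pos h0 x).ne'
  have e : ∀ y, ((shortScan n θ ^ ℓ) x y / mallows n θ y - 1) *
      ((shortScan n θ ^ ℓ) x y / mallows n θ y - 1) * mallows n θ y =
      (shortScan n θ ^ ℓ) x y * (shortScan n θ ^ ℓ) y x / mallows n θ x -
        2 * (shortScan n θ ^ ℓ) x y + mallows n θ y := by
    intro y
    have hy := (mallows_pos h0 y).ne'
    field_simp
    linear_combination (shortScan n θ ^ ℓ) x y * hrev y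
  rw [scanL2, l2NormSq, Finset.sum_congr rfl fun y _ => e y, Finset.sum_add_distrib,
    Finset.sum_sub_distrib, ← Finset.sum_div, ← Finset.mul_sum, sum_shortScan_pow, sum_mallows h0,
    two_mul ℓ, pow_add, mul_apply]
  ring

theorem mallows_one_eq : mallows n θ 1 = 1 / qFactorial θ⁻¹ n := by
  rw [mallows_eq, mallowsWeight, invCount_one, pow_zero]

theorem tableauSum_eq (hn : 1 ≤ n) (ℓ : ℕ) (μ : Shape n) :
    tableauSum hn θ ℓ μ = ∑ S : StandardTableau μ, (θ ^ scanExponent S) ^ (2 * ℓ) := by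
  refine Finset.sum_congr rfl fun S _ => ?_
  rw [← scanExponent_cast, ← pow_mul, ← zpow_natCast]
  congr 1
  push_cast
  ring

theorem qInt_one (k : ℕ) : qInt 1 k = k := by simp [qInt]

theorem dimConst_eq (μ : Shape n) : dimConst μ = n.factorial * shapeWeight 1 μ.1 := by
  rw [dimConst, shapeWeight, one_pow, mul_one_div]
  simp only [qInt_one]

theorem scanL2_one_eq (h0 : 0 < θ) (h1 : θ ≤ 1) (hn : 1 ≤ n) (ℓ : ℕ) :
    scanL2 n θ ℓ 1 = ∑ μ : Shape n, genericDegree θ⁻¹ μ * tableauSum hn θ ℓ μ - 1 := by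
  rw [scanL2_eq h0, shortScan_pow_entryOne hn _ θ h0 h1, mallows_one_eq, div_div_eq_mul_div,
    div_one, Finset.sum_mul]
  congr 1
  refine Finset.sum_congr rfl fun μ _ => ?_
  rw [genericDegree_eq, tableauSum_eq]
  ring

theorem sum_scanL2_eq (h0 : 0 < θ) (h1 : θ ≤ 1) (hn : 1 ≤ n) (ℓ : ℕ) :
    ∑ x : Equiv.Perm (Fin n), mallows n θ x * scanL2 n θ ℓ x =
      ∑ μ : Shape n, dimConst μ * tableauSum hn θ ℓ μ - 1 := by
  have e : ∀ x : Equiv.Perm (Fin n), mallows n θ x * scanL2 n θ ℓ x =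
      (shortScan n θ ^ (2 * ℓ)) x x - mallows n θ x := fun x => by
    have := (mallows_pos h0 x).ne'
    rw [scanL2_eq h0]
    field_simp
  have ht := trace_shortScan_pow hn (2 * ℓ) θ h0 h1
  simp only [trace, diag_apply] at ht
  simp only [e]
  rw [Finset.sum_sub_distrib, sum_mallows h0, ht, Finset.mul_sum]
  congr 1
  refine Finset.sum_congr rfl fun μ _ => ?_
  rw [dimConst_eq, tableauSum_eq]
  ring

end Distance

/-! ### The one-row diagram -/

section OneRow

/-- The partition `(n)`. -/
def oneRow (n : ℕ) : Shape n :=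
  ⟨{ cells := {0} ×ˢ Finset.range n
     isLowerSet := by
      rintro ⟨a, b⟩ ⟨c, d⟩ hle hab
      obtain ⟨h1, h2⟩ : c ≤ a ∧ d ≤ b := hle
      simp only [Finset.coe_product, Finset.coe_singleton, Set.mem_prod, Set.mem_singleton_iff,
        Finset.mem_coe, Finset.mem_range] at hab ⊢
      omega }, by simp [YoungDiagram.card]⟩

theorem mem_oneRow {n : ℕ} {b : ℕ × ℕ} : b ∈ (oneRow n).1.cells ↔ b.1 = 0 ∧ b.2 < n := by
  change b ∈ ({0} ×ˢ Finset.range n : Finset (ℕ × ℕ)) ↔ _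
  rw [Finset.mem_product, Finset.mem_singleton, Finset.mem_range]

theorem sum_oneRow {R : Type*} [AddCommMonoid R] (n : ℕ) (F : ℕ × ℕ → R) :
    ∑ b ∈ (oneRow n).1.cells, F b = ∑ c ∈ Finset.range n, F (0, c) := by
  rw [oneRow, Finset.sum_product, Finset.sum_singleton]

theorem prod_oneRow {R : Type*} [CommMonoid R] (n : ℕ) (F : ℕ × ℕ → R) :
    ∏ b ∈ (oneRow n).1.cells, F b = ∏ c ∈ Finset.range n, F (0, c) := by
  rw [oneRow, Finset.prod_product, Finset.prod_singleton]

theorem rowLen_oneRow (n : ℕ) : (oneRow n).1.rowLen 0 = n := by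
  apply eq_of_forall_lt_iff
  intro c
  rw [← YoungDiagram.mem_iff_lt_rowLen, ← YoungDiagram.mem_cells, mem_oneRow]
  simp

theorem colLen_oneRow {n c : ℕ} (hc : c < n) : (oneRow n).1.colLen c = 1 := by
  apply eq_of_forall_lt_iff
  intro i
  rw [← YoungDiagram.mem_iff_lt_colLen, ← YoungDiagram.mem_cells, mem_oneRow]
  dsimp only
  omega

theorem eq_oneRow_iff {n : ℕ} {μ : Shape n} : μ.1.rowLen 0 = n ↔ μ = oneRow n := by
  refine ⟨fun h => ?_, fun h => h ▸ rowLen_oneRow n⟩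
  have hsub : (oneRow n).1.cells ⊆ μ.1.cells := by
    rintro ⟨i, c⟩ hb
    obtain ⟨rfl, hc⟩ := mem_oneRow.mp hb
    rw [YoungDiagram.mem_cells, YoungDiagram.mem_iff_lt_rowLen, h]
    exact hc
  have h1 : μ.1.cells.card ≤ (oneRow n).1.cells.card :=
    (show μ.1.cells.card = n from μ.2).le.trans (oneRow n).2.ge
  exact Subtype.ext (YoungDiagram.ext (Finset.eq_of_subset_of_card_le hsub h1).symm)

theorem oneRow_le_succ (n : ℕ) : (oneRow n).1 ≤ (oneRow (n + 1)).1 := by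
  intro b hb
  obtain ⟨h1, h2⟩ := mem_oneRow.mp hb
  exact mem_oneRow.mpr ⟨h1, by omega⟩

theorem eq_oneRow_of_le {n : ℕ} {μ : Shape n} (h : μ.1 ≤ (oneRow (n + 1)).1) : μ = oneRow n := by
  have hsub : μ.1.cells ⊆ (oneRow (n + 1)).1.cells := h
  rw [← eq_oneRow_iff]
  have hrow : μ.1.rowLen 1 = 0 := by
    by_contra h0
    have hm := YoungDiagram.mem_iff_lt_rowLen.mpr (Nat.pos_of_ne_zero h0)
    exact absurd (mem_oneRow.mp (hsub hm)).1 (by norm_num)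
  have h1 := sum_cells μ.1 hrow (fun _ => 1)
  rw [Finset.sum_const, smul_eq_mul, mul_one] at h1
  have h2 : μ.1.cells.card = n := μ.2
  simpa [h2] using h1.symm

theorem sum_tableaux_oneRow_succ {R : Type*} [AddCommMonoid R] (n : ℕ)
    (f : StandardTableau (oneRow (n + 1)) → R) :
    ∑ T, f T = ∑ S : StandardTableau (oneRow n), f (extendTableau (oneRow_le_succ n) S) := by
  classical
  rw [sum_tableaux_succ, Finset.sum_eq_single (oneRow n)]
  · rw [dif_pos (oneRow_le_succ n)]
  · intro μ _ hμ
    exact dif_neg fun h => hμ (eq_oneRow_of_le h)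
  · intro h
    exact absurd (Finset.mem_univ _) h

theorem card_tableaux_oneRow (n : ℕ) : Fintype.card (StandardTableau (oneRow n)) = 1 := by
  induction n with
  | zero =>
    rw [Fintype.card_eq_one_iff_nonempty_unique]
    exact ⟨inferInstance⟩
  | succ n ih =>
    refine Eq.trans ?_ ih
    rw [Fintype.card_eq_sum_ones, Fintype.card_eq_sum_ones]
    exact sum_tableaux_oneRow_succ n fun _ => 1

theorem contentSum_oneRow (n : ℕ) : contentSum (oneRow n).1 = ∑ c ∈ Finset.range n, (c : ℤ) := by
  rw [contentSum, sum_oneRow]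
  simp [content]

theorem tableauSum_oneRow {n : ℕ} (hn : 1 ≤ n) (θ : ℝ) (ℓ : ℕ) :
    tableauSum hn θ ℓ (oneRow n) = 1 := by
  obtain ⟨m, rfl⟩ : ∃ m, n = m + 1 := ⟨n - 1, by omega⟩
  rw [tableauSum, sum_tableaux_oneRow_succ]
  have : ∀ S : StandardTableau (oneRow m),
      content (lastBox hn (extendTableau (oneRow_le_succ m) S)) = m := fun S => by
    rw [lastBox_eq, content_boxOf_extendTableau, contentSum_oneRow, contentSum_oneRow,
      Finset.sum_range_succ, add_sub_cancel_left]
  simp [this, card_tableaux_oneRow]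

theorem hookLength_oneRow {n c : ℕ} (hc : c < n) : hookLength (oneRow n).1 (0, c) = n - c := by
  rw [hookLength, rowLen_oneRow, colLen_oneRow hc]
  omega

theorem shapeWeight_oneRow (q : ℝ) (n : ℕ) :
    shapeWeight q (oneRow n).1 = 1 / qFactorial q n := by
  have h1 : nStat (oneRow n).1 = 0 := by
    rw [nStat_eq_sum_cells, sum_oneRow]
    simp
  rw [shapeWeight, h1, pow_zero, prod_oneRow, qFactorial,
    Finset.prod_congr rfl fun c hc => by rw [hookLength_oneRow (Finset.mem_range.mp hc)],
    Finset.range_eq_Ico, Finset.prod_Ico_reflect (fun k => qInt q k) 0 (Nat.le_succ n)]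
  rw [Nat.add_sub_cancel_left]
  rfl

theorem qFactorial_one (n : ℕ) : qFactorial 1 n = n.factorial := by
  simp only [qFactorial, qInt_one]
  induction n with
  | zero => simp
  | succ n ih =>
    rw [Finset.prod_Icc_succ_top (by omega), ih, Nat.factorial_succ]
    push_cast
    ring

theorem sum_shapes_sub_one {n : ℕ} (F : Shape n → ℝ) (h : F (oneRow n) = 1) :
    ∑ μ, F μ - 1 = ∑ μ : Shape n with μ.1.rowLen 0 ≠ n, F μ := by
  rw [← Finset.sum_filter_add_sum_filter_not Finset.univ (fun μ : Shape n => μ.1.rowLen 0 ≠ n)]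
  have : ({μ : Shape n | ¬ μ.1.rowLen 0 ≠ n} : Finset (Shape n)) = {oneRow n} := by
    ext μ
    simp [eq_oneRow_iff]
  rw [this, Finset.sum_singleton, h, add_sub_cancel_right]

theorem scanL2_one {n : ℕ} {θ : ℝ} (h0 : 0 < θ) (h1 : θ ≤ 1) (hn : 1 ≤ n) (ℓ : ℕ) :
    scanL2 n θ ℓ 1 =
      ∑ μ : Shape n with μ.1.rowLen 0 ≠ n, genericDegree θ⁻¹ μ * tableauSum hn θ ℓ μ := by
  rw [scanL2_one_eq h0 h1 hn]
  apply sum_shapes_sub_one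
  rw [tableauSum_oneRow, genericDegree_eq, shapeWeight_oneRow, mul_one,
    mul_one_div_cancel (qFactorial_pos (inv_pos.mpr h0) n).ne']

theorem sum_scanL2 {n : ℕ} {θ : ℝ} (h0 : 0 < θ) (h1 : θ ≤ 1) (hn : 1 ≤ n) (ℓ : ℕ) :
    ∑ x : Equiv.Perm (Fin n), mallows n θ x * scanL2 n θ ℓ x =
      ∑ μ : Shape n with μ.1.rowLen 0 ≠ n, dimConst μ * tableauSum hn θ ℓ μ := by
  rw [sum_scanL2_eq h0 h1 hn]
  apply sum_shapes_sub_one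
  rw [tableauSum_oneRow, dimConst_eq, shapeWeight_oneRow, mul_one, qFactorial_one,
    mul_one_div_cancel (by positivity)]

end OneRow

/-! ### Removing the first row: bounds for weights and numbers of tableaux -/

section Tail

theorem succRow_injective : Function.Injective fun b : ℕ × ℕ => (b.1 + 1, b.2) := by
  rintro ⟨a, b⟩ ⟨c, d⟩ h
  simpa using h

/-- The diagram without its first row. -/
noncomputable def tail (μ : YoungDiagram) : YoungDiagram where
  cells := μ.cells.preimage (fun b : ℕ × ℕ => (b.1 + 1, b.2)) succRow_injective.injOn
  isLowerSet := by
    rintro ⟨a, b⟩ ⟨c, d⟩ hle hab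
    obtain ⟨h1, h2⟩ : c ≤ a ∧ d ≤ b := hle
    rw [Finset.coe_preimage] at hab ⊢
    exact μ.isLowerSet (show (c + 1, d) ≤ (a + 1, b) from ⟨Nat.succ_le_succ h1, h2⟩) hab

theorem mem_tail {μ : YoungDiagram} {i c : ℕ} : (i, c) ∈ tail μ ↔ (i + 1, c) ∈ μ :=
  Finset.mem_preimage (f := fun b : ℕ × ℕ => (b.1 + 1, b.2)) (hf := succRow_injective.injOn)

theorem rowLen_tail (μ : YoungDiagram) (i : ℕ) : (tail μ).rowLen i = μ.rowLen (i + 1) := by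
  apply eq_of_forall_lt_iff
  intro c
  rw [← YoungDiagram.mem_iff_lt_rowLen, ← YoungDiagram.mem_iff_lt_rowLen, mem_tail]

theorem colLen_tail {μ : YoungDiagram} {c : ℕ} (hc : c < μ.rowLen 0) :
    μ.colLen c = (tail μ).colLen c + 1 := by
  apply eq_of_forall_lt_iff
  intro i
  rcases i with _ | i
  · rw [← lt_rowLen_iff_lt_colLen]
    exact iff_of_true hc (Nat.succ_pos _)
  · rw [Nat.succ_lt_succ_iff, ← YoungDiagram.mem_iff_lt_colLen, ← YoungDiagram.mem_iff_lt_colLen,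
      mem_tail]

theorem prod_cells_tail {R : Type*} [CommMonoid R] (μ : YoungDiagram) (F : ℕ × ℕ → R) :
    ∏ b ∈ μ.cells, F b =
      (∏ b ∈ (tail μ).cells, F (b.1 + 1, b.2)) * ∏ c ∈ Finset.range (μ.rowLen 0), F (0, c) := by
  have h1 := rowLen_eq_zero_of_le μ (rowLen_colLen_zero μ) (Nat.le_succ _)
  rw [prod_cells μ h1, prod_cells (tail μ) (L := μ.colLen 0) (by rw [rowLen_tail]; exact h1),
    Finset.prod_range_succ']
  simp only [rowLen_tail]

theorem sum_cells_tail {R : Type*} [AddCommMonoid R] (μ : YoungDiagram) (F : ℕ × ℕ → R) :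
    ∑ b ∈ μ.cells, F b =
      (∑ b ∈ (tail μ).cells, F (b.1 + 1, b.2)) + ∑ c ∈ Finset.range (μ.rowLen 0), F (0, c) :=
  prod_cells_tail (R := Multiplicative R) μ F

theorem card_tail (μ : YoungDiagram) : μ.card = (tail μ).card + μ.rowLen 0 := by
  have := sum_cells_tail μ (fun _ => 1)
  simpa using this

theorem nStat_tail (μ : YoungDiagram) : nStat μ = nStat (tail μ) + (tail μ).card := by
  rw [nStat_eq_sum_cells, nStat_eq_sum_cells, sum_cells_tail]
  simp [Finset.sum_add_distrib, YoungDiagram.card]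

theorem hookLength_tail {μ : YoungDiagram} {b : ℕ × ℕ} (hb : b ∈ (tail μ).cells) :
    hookLength μ (b.1 + 1, b.2) = hookLength (tail μ) b := by
  have h1 := YoungDiagram.mem_iff_lt_rowLen.mp
    (show (b.1, b.2) ∈ tail μ from hb)
  rw [rowLen_tail] at h1
  have h2 : b.2 < μ.rowLen 0 := h1.trans_le (μ.rowLen_anti _ _ (Nat.zero_le _))
  rw [hookLength, hookLength, rowLen_tail, colLen_tail h2]
  dsimp only
  omega

theorem hookLength_first_row {μ : YoungDiagram} {c : ℕ} (hc : c < μ.rowLen 0) :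
    hookLength μ (0, c) = (tail μ).colLen c + (μ.rowLen 0 - c) := by
  rw [hookLength, colLen_tail hc]
  dsimp only
  omega

theorem sum_colLen (μ : YoungDiagram) {r : ℕ} (hr : μ.rowLen 0 ≤ r) :
    ∑ c ∈ Finset.range r, μ.colLen c = μ.card := by
  rw [YoungDiagram.card, Finset.card_eq_sum_card_fiberwise (f := Prod.snd) (t := Finset.range r)]
  · exact Finset.sum_congr rfl fun c _ => YoungDiagram.colLen_eq_card μ
  · rintro ⟨i, c⟩ hb
    have h1 := YoungDiagram.mem_iff_lt_rowLen.mp (show (i, c) ∈ μ from hb)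
    have h2 := μ.rowLen_anti 0 i (Nat.zero_le _)
    rw [Finset.mem_coe, Finset.mem_range]
    dsimp only
    omega

theorem tail_mono {μ ν : YoungDiagram} (h : μ ≤ ν) : tail μ ≤ tail ν := by
  rintro ⟨i, c⟩ hb
  exact mem_tail.mpr (h (mem_tail.mp hb))

theorem rowLen_mono {μ ν : YoungDiagram} (h : μ ≤ ν) (i : ℕ) : μ.rowLen i ≤ ν.rowLen i := by
  by_contra hlt
  have := YoungDiagram.mem_iff_lt_rowLen.mp (h (YoungDiagram.mem_iff_lt_rowLen.mpr (not_le.mp hlt)))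
  omega

theorem eq_of_tail_eq {n : ℕ} {μ ν : Shape n} (h : tail μ.1 = tail ν.1) : μ = ν := by
  apply Subtype.ext
  apply ext_rowLen
  intro i
  rcases i with _ | i
  · have h1 := card_tail μ.1
    have h2 := card_tail ν.1
    rw [μ.2] at h1
    rw [ν.2, ← h] at h2
    omega
  · rw [← rowLen_tail, ← rowLen_tail, h]

/-! ### Bounds for the weights -/

theorem pow_mul_qInt_le {q : ℝ} (hq : 0 ≤ q) (r m : ℕ) : q ^ r * qInt q m ≤ qInt q (r + m) := by
  rw [qInt, qInt, Finset.sum_range_add, Finset.mul_sum]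
  simp only [← pow_add]
  have : 0 ≤ ∑ i ∈ Finset.range r, q ^ i := Finset.sum_nonneg fun i _ => by positivity
  linarith

theorem prod_range_qInt_sub (q : ℝ) (n : ℕ) :
    ∏ c ∈ Finset.range n, qInt q (n - c) = qFactorial q n := by
  rw [Finset.range_eq_Ico, Finset.prod_Ico_reflect (fun k => qInt q k) 0 (Nat.le_succ n),
    Nat.add_sub_cancel_left]
  rfl

/-- A hook of the first row is λ_1 - c plus a column of the tail. With [r+m]_q ≥ q^r [m]_q the first
row contributes at least q^{|tail|} [λ_1]_q!, and the power of q cancels the change of n(μ). -/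
theorem shapeWeight_le_tail {q : ℝ} (hq : 0 < q) (μ : YoungDiagram) :
    shapeWeight q μ ≤ shapeWeight q (tail μ) / qFactorial q (μ.rowLen 0) := by
  have h1 : q ^ (tail μ).card * qFactorial q (μ.rowLen 0) ≤
      ∏ c ∈ Finset.range (μ.rowLen 0), qInt q (hookLength μ (0, c)) := by
    rw [← sum_colLen (tail μ) (r := μ.rowLen 0)
      (by rw [rowLen_tail]; exact μ.rowLen_anti _ _ (Nat.zero_le _)), ← Finset.prod_pow_eq_pow_sum,
      ← prod_range_qInt_sub, ← Finset.prod_mul_distrib]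
    refine Finset.prod_le_prod (fun c hc => ?_) fun c hc => ?_
    · exact mul_nonneg (by positivity) (Finset.sum_nonneg fun i _ => by positivity)
    · rw [hookLength_first_row (Finset.mem_range.mp hc)]
      exact pow_mul_qInt_le hq.le _ _
  have h2 : ∏ b ∈ (tail μ).cells, qInt q (hookLength μ (b.1 + 1, b.2)) =
      ∏ b ∈ (tail μ).cells, qInt q (hookLength (tail μ) b) :=
    Finset.prod_congr rfl fun b hb => by rw [hookLength_tail hb]
  have h3 := prod_qInt_hooks_pos hq (tail μ)
  have h4 := qFactorial_pos hq (μ.rowLen 0)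
  rw [shapeWeight, shapeWeight, prod_cells_tail, h2, nStat_tail, pow_add, div_div]
  rw [div_le_div_iff₀ (mul_pos h3 (lt_of_lt_of_le (by positivity) h1)) (by positivity)]
  calc _ = q ^ nStat (tail μ) * (∏ b ∈ (tail μ).cells, qInt q (hookLength (tail μ) b)) *
      (q ^ (tail μ).card * qFactorial q (μ.rowLen 0)) := by ring
    _ ≤ q ^ nStat (tail μ) * (∏ b ∈ (tail μ).cells, qInt q (hookLength (tail μ) b)) *
      ∏ c ∈ Finset.range (μ.rowLen 0), qInt q (hookLength μ (0, c)) := by gcongr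
    _ = _ := by ring

theorem qInt_le {q : ℝ} (hq : 1 ≤ q) {k n : ℕ} (hk : k ≤ n) : qInt q k ≤ n * q ^ (n - 1) := by
  calc qInt q k ≤ ∑ i ∈ Finset.range k, q ^ (n - 1) :=
        Finset.sum_le_sum fun i hi => pow_le_pow_right₀ hq (by
          have := Finset.mem_range.mp hi
          omega)
    _ = k * q ^ (n - 1) := by simp
    _ ≤ n * q ^ (n - 1) := by gcongr

theorem qFactorial_add_le {q : ℝ} (hq : 1 ≤ q) {n r j : ℕ} (h : r + j ≤ n) :
    qFactorial q (r + j) ≤ qFactorial q r * (n * q ^ (n - 1)) ^ j := by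
  induction j with
  | zero => simp
  | succ j ih =>
    rw [← add_assoc, qFactorial, Finset.prod_Icc_succ_top (by omega), pow_succ, ← mul_assoc]
    have h1 := qInt_le hq h
    have h2 := qInt_pos (zero_lt_one.trans_le hq) (show 0 < r + j + 1 by omega)
    have h3 := qFactorial_pos (zero_lt_one.trans_le hq) r
    exact mul_le_mul (ih (by omega)) h1 h2.le (by positivity)

theorem qFactorial_mul_shapeWeight_le {q : ℝ} (hq : 1 ≤ q) {n : ℕ} (μ : Shape n) :
    qFactorial q n * shapeWeight q μ.1 ≤
      (n * q ^ (n - 1)) ^ (tail μ.1).card * shapeWeight q (tail μ.1) := by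
  have hq0 := zero_lt_one.trans_le hq
  have hc := card_tail μ.1
  rw [μ.2, add_comm] at hc
  have h1 := qFactorial_add_le hq hc.ge
  rw [← hc] at h1
  have h2 := shapeWeight_le_tail hq0 μ.1
  have h3 := qFactorial_pos hq0 (μ.1.rowLen 0)
  have h4 := shapeWeight_pos hq0 (tail μ.1)
  calc _ ≤ (qFactorial q (μ.1.rowLen 0) * (n * q ^ (n - 1)) ^ (tail μ.1).card) *
        (shapeWeight q (tail μ.1) / qFactorial q (μ.1.rowLen 0)) := by
        refine mul_le_mul h1 h2 (shapeWeight_pos hq0 _).le (by positivity)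
    _ = _ := by field_simp

/-! ### The number of standard tableaux -/

/-- The number of standard tableaux of shape `μ`. -/
noncomputable def numTableaux (μ : YoungDiagram) : ℕ :=
  Nat.card (StandardTableau (⟨μ, rfl⟩ : Shape μ.card))

theorem numTableaux_eq {n : ℕ} (μ : Shape n) :
    numTableaux μ.1 = Fintype.card (StandardTableau μ) := by
  rw [← Nat.card_eq_fintype_card]
  obtain ⟨μ, h⟩ := μ
  subst h
  rfl

open Classical in
theorem numTableaux_succ {n : ℕ} (ν : Shape (n + 1)) :
    numTableaux ν.1 = ∑ μ : Shape n with μ.1 ≤ ν.1, numTableaux μ.1 := by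
  rw [numTableaux_eq, Fintype.card_eq_sum_ones, sum_tableaux_succ, Finset.sum_filter]
  refine Finset.sum_congr rfl fun μ _ => ?_
  split_ifs with h
  · rw [numTableaux_eq, Fintype.card_eq_sum_ones]
  · rfl

theorem numTableaux_zero (μ : Shape 0) : numTableaux μ.1 = 1 := by
  rw [numTableaux_eq]
  exact Fintype.card_unique

/-- For a fixed number of boxes a shape is determined by its tail, so no tail is counted twice. -/
theorem sum_tail_le {R : Type*} [AddCommMonoid R] [PartialOrder R] [IsOrderedAddMonoid R]
    {n j : ℕ} (s : Finset (Shape n)) (t : Finset (Shape j))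
    (hs : ∀ μ ∈ s, ∃ κ ∈ t, κ.1 = tail μ.1) (f : YoungDiagram → R) (hf : ∀ μ, 0 ≤ f μ) :
    ∑ μ ∈ s, f (tail μ.1) ≤ ∑ κ ∈ t, f κ.1 := by
  classical
  rw [← Finset.sum_image (f := f) (s := s) (g := fun μ => tail μ.1)
      (fun μ _ ν _ h => eq_of_tail_eq h),
    ← Finset.sum_image (f := f) (s := t) (g := fun κ => κ.1) (fun μ _ ν _ h => Subtype.ext h)]
  refine Finset.sum_le_sum_of_subset_of_nonneg ?_ fun μ _ _ => hf μ
  intro κ hκ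
  obtain ⟨μ, hμ, rfl⟩ := Finset.mem_image.mp hκ
  obtain ⟨κ, hκ, h⟩ := hs μ hμ
  exact Finset.mem_image.mpr ⟨κ, hκ, h⟩

/-- A tableau is determined by the set of entries below the first row and their arrangement in the
tail. The induction removes the largest entry: either it lies in the first row and the tail is
unchanged, or it lies in the tail. The two cases match the two terms of Pascal's rule. -/
theorem numTableaux_le {n : ℕ} (μ : Shape n) :
    numTableaux μ.1 ≤ n.choose (tail μ.1).card * numTableaux (tail μ.1) := by
  classical
  induction n with
  | zero =>
    have h := card_tail μ.1
    rw [μ.2] at h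
    have h0 : (tail μ.1).card = 0 := by omega
    rw [numTableaux_zero, h0, numTableaux_zero ⟨tail μ.1, h0⟩]
    rfl
  | succ n ih =>
    have hc := card_tail μ.1
    rw [μ.2] at hc
    set ρ := tail μ.1 with hρ
    obtain ⟨A, B, hAB, hA, hB⟩ : ∃ A B : Finset (Shape n),
        numTableaux μ.1 = ∑ κ ∈ A, numTableaux κ.1 + ∑ κ ∈ B, numTableaux κ.1 ∧
        (∀ κ ∈ A, tail κ.1 = ρ) ∧ ∀ κ ∈ B, κ.1 ≤ μ.1 ∧ tail κ.1 ≠ ρ := by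
      refine ⟨Finset.univ.filter fun κ => κ.1 ≤ μ.1 ∧ tail κ.1 = ρ,
        Finset.univ.filter fun κ => κ.1 ≤ μ.1 ∧ tail κ.1 ≠ ρ, ?_,
        fun κ hκ => (Finset.mem_filter.mp hκ).2.2, fun κ hκ => (Finset.mem_filter.mp hκ).2⟩
      rw [numTableaux_succ, ← Finset.filter_filter, ← Finset.filter_filter,
        Finset.sum_filter_add_sum_filter_not]
    have h1 : ∑ κ ∈ A, numTableaux κ.1 ≤ n.choose ρ.card * numTableaux ρ := by
      calc _ ≤ ∑ κ ∈ A, n.choose ρ.card * numTableaux ρ := by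
            refine Finset.sum_le_sum fun κ hκ => ?_
            rw [← hA κ hκ]
            exact ih κ
        _ ≤ 1 • (n.choose ρ.card * numTableaux ρ) := by
            rw [Finset.sum_const]
            gcongr
            rw [Finset.card_le_one]
            exact fun a ha b hb => eq_of_tail_eq ((hA a ha).trans (hA b hb).symm)
        _ = _ := one_smul _ _
    have h2 : ∀ κ ∈ B, (tail κ.1).card + 1 = ρ.card := by
      intro κ hκ
      obtain ⟨hle, hne⟩ := hB κ hκ
      have hsub : (tail κ.1).cells ⊂ ρ.cells := by
        refine (Finset.ssubset_iff_subset_ne).mpr ⟨tail_mono hle, fun h => hne ?_⟩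
        exact YoungDiagram.ext h
      have h3 : (tail κ.1).card < ρ.card := Finset.card_lt_card hsub
      have h4 := card_tail κ.1
      rw [κ.2] at h4
      have h5 := rowLen_mono hle 0
      omega
    rw [hAB]
    rcases hj : ρ.card with _ | j
    · have h3 : ∑ κ ∈ B, numTableaux κ.1 = 0 :=
        Finset.sum_eq_zero fun κ hκ => absurd (h2 κ hκ) (by omega)
      rw [hj, Nat.choose_zero_right] at h1
      rw [h3, Nat.choose_zero_right, add_zero]
      exact h1
    · rw [hj] at h1
      have h3 : ∑ κ ∈ B, numTableaux (tail κ.1) ≤ numTableaux ρ := by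
        rw [numTableaux_succ (⟨ρ, hj⟩ : Shape (j + 1))]
        refine sum_tail_le B _ (fun κ hκ => ?_) numTableaux fun _ => Nat.zero_le _
        have := h2 κ hκ
        refine ⟨⟨tail κ.1, by omega⟩, Finset.mem_filter.mpr ⟨Finset.mem_univ _, ?_⟩, rfl⟩
        exact tail_mono (hB κ hκ).1
      have h4 : ∑ κ ∈ B, numTableaux κ.1 ≤ n.choose j * numTableaux ρ := by
        calc _ ≤ ∑ κ ∈ B, n.choose j * numTableaux (tail κ.1) := by
              refine Finset.sum_le_sum fun κ hκ => ?_
              have := h2 κ hκ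
              rw [hj] at this
              rw [← Nat.succ_injective this]
              exact ih κ
          _ ≤ _ := by
            rw [← Finset.mul_sum]
            exact Nat.mul_le_mul_left _ h3
      rw [Nat.choose_succ_succ, add_mul, add_comm]
      exact Nat.add_le_add h4 h1

/-- This is the total mass of the law, read off from the zeroth power of the scan at the identity.
-/
theorem sum_shapeWeight_mul_numTableaux {q : ℝ} (hq : 1 ≤ q) {n : ℕ} (hn : 1 ≤ n) :
    ∑ μ : Shape n, shapeWeight q μ.1 * numTableaux μ.1 = 1 := by
  have h := shortScan_pow_entryOne hn 0 q⁻¹ (inv_pos.mpr (zero_lt_one.trans_le hq))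
    (inv_le_one_of_one_le₀ hq)
  simp only [pow_zero, Matrix.one_apply_eq, inv_inv, Finset.sum_const, Finset.card_univ,
    nsmul_eq_mul, mul_one] at h
  rw [h]
  simp only [numTableaux_eq]

/-! ### The upper bound -/

/-- No content exceeds λ_1 - 1, so every exponent n - 1 - c(S(n)) is at least n - λ_1, the size of
the tail. -/
theorem tableauSum_le {θ : ℝ} (h0 : 0 < θ) (h1 : θ ≤ 1) {n : ℕ} (hn : 1 ≤ n) (ℓ : ℕ)
    (μ : Shape n) :
    tableauSum hn θ ℓ μ ≤ numTableaux μ.1 * (θ ^ (2 * ℓ)) ^ (tail μ.1).card := by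
  have h : ∀ S : StandardTableau μ, (θ ^ scanExponent S) ^ (2 * ℓ) ≤
      (θ ^ (2 * ℓ)) ^ (tail μ.1).card := fun S => by
    rw [← pow_mul, mul_comm, pow_mul]
    refine pow_le_pow_of_le_one (by positivity) (pow_le_one₀ h0.le h1) ?_
    have hb := boxOf_mem S (Finset.mem_Icc.mpr ⟨hn, le_rfl⟩)
    have h2 := YoungDiagram.mem_iff_lt_rowLen.mp (show ((boxOf S n).1, (boxOf S n).2) ∈ μ.1 from hb)
    have h3 := μ.1.rowLen_anti 0 (boxOf S n).1 (Nat.zero_le _)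
    have h4 := card_tail μ.1
    rw [μ.2] at h4
    rw [scanExponent, content]
    omega
  rw [tableauSum_eq]
  refine (Finset.sum_le_sum fun S _ => h S).trans ?_
  rw [Finset.sum_const, nsmul_eq_mul, numTableaux_eq, Finset.card_univ]

theorem sum_weights_tableauSum_le {q θ : ℝ} (hq : 1 ≤ q) (h0 : 0 < θ) (h1 : θ ≤ 1) {n : ℕ}
    (hn : 1 ≤ n) (ℓ : ℕ) :
    ∑ μ : Shape n with μ.1.rowLen 0 ≠ n,
      qFactorial q n * shapeWeight q μ.1 * tableauSum hn θ ℓ μ ≤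
      Real.exp (n ^ 2 * q ^ (n - 1) * θ ^ (2 * ℓ)) - 1 := by
  have hq0 := zero_lt_one.trans_le hq
  set Y : ℝ := n ^ 2 * q ^ (n - 1) * θ ^ (2 * ℓ) with hY
  have hY0 : 0 ≤ Y := by positivity
  have hterm : ∀ μ : Shape n, qFactorial q n * shapeWeight q μ.1 * tableauSum hn θ ℓ μ ≤
      Y ^ (tail μ.1).card / (tail μ.1).card.factorial *
        (shapeWeight q (tail μ.1) * numTableaux (tail μ.1)) := by
    intro μ
    set j := (tail μ.1).card
    have b1 := qFactorial_mul_shapeWeight_le hq μ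
    have b2 := tableauSum_le h0 h1 hn ℓ μ
    have b3 : (numTableaux μ.1 : ℝ) ≤ n ^ j / j.factorial * numTableaux (tail μ.1) := by
      calc (numTableaux μ.1 : ℝ) ≤ (n.choose j : ℝ) * numTableaux (tail μ.1) := by
            exact_mod_cast numTableaux_le μ
        _ ≤ _ := by
            gcongr
            exact Nat.choose_le_pow_div j n
    have b4 := shapeWeight_pos hq0 (tail μ.1)
    have b5 := shapeWeight_pos hq0 μ.1
    have b6 := qFactorial_pos hq0 n
    calc _ ≤ ((n * q ^ (n - 1)) ^ j * shapeWeight q (tail μ.1)) *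
          ((n ^ j / j.factorial * numTableaux (tail μ.1)) * (θ ^ (2 * ℓ)) ^ j) := by
          refine mul_le_mul b1 (b2.trans (by gcongr)) ?_ (by positivity)
          rw [tableauSum_eq]
          exact Finset.sum_nonneg fun S _ => by positivity
      _ = _ := by
          rw [hY, mul_pow, mul_pow, mul_pow, ← pow_mul]
          ring
  refine (Finset.sum_le_sum fun μ _ => hterm μ).trans ?_
  have hmaps : ∀ μ ∈ ({μ : Shape n | μ.1.rowLen 0 ≠ n} : Finset (Shape n)),
      (tail μ.1).card ∈ Finset.Ico 1 (n + 1) := by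
    intro μ hμ
    have h2 := (Finset.mem_filter.mp hμ).2
    have h4 := card_tail μ.1
    rw [μ.2] at h4
    rw [Finset.mem_Ico]
    omega
  rw [← Finset.sum_fiberwise_of_maps_to hmaps]
  have hj : ∀ j ∈ Finset.Ico 1 (n + 1),
      ∑ μ ∈ ({μ : Shape n | μ.1.rowLen 0 ≠ n} : Finset (Shape n)) with (tail μ.1).card = j,
        Y ^ (tail μ.1).card / (tail μ.1).card.factorial *
        (shapeWeight q (tail μ.1) * numTableaux (tail μ.1)) ≤ Y ^ j / j.factorial := by
    intro j hj
    calc _ = Y ^ j / j.factorial * ∑ μ ∈ ({μ : Shape n | μ.1.rowLen 0 ≠ n} : Finset (Shape n)) with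
          (tail μ.1).card = j, shapeWeight q (tail μ.1) * numTableaux (tail μ.1) := by
          rw [Finset.mul_sum]
          refine Finset.sum_congr rfl fun μ hμ => ?_
          rw [(Finset.mem_filter.mp hμ).2]
      _ ≤ Y ^ j / j.factorial * ∑ κ : Shape j, shapeWeight q κ.1 * numTableaux κ.1 := by
          gcongr
          refine sum_tail_le (f := fun κ => shapeWeight q κ * numTableaux κ) _ _
            (fun μ hμ => ⟨⟨tail μ.1, (Finset.mem_filter.mp hμ).2⟩, Finset.mem_univ _, rfl⟩)
            fun κ => mul_nonneg (shapeWeight_pos hq0 κ).le (Nat.cast_nonneg _)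
      _ = _ := by
          -- The tails of size j are distinct diagrams with j boxes, whose total mass is 1; hence
          -- the j-th group contributes at most Y^j/j!.
          rw [sum_shapeWeight_mul_numTableaux hq (Finset.mem_Ico.mp hj).1, mul_one]
  refine (Finset.sum_le_sum hj).trans ?_
  have hexp := Real.sum_le_exp_of_nonneg hY0 (n + 1)
  rw [Finset.range_eq_Ico, Finset.sum_eq_sum_Ico_succ_bot (by omega)] at hexp
  simp only [pow_zero, Nat.factorial_zero, Nat.cast_one, div_one] at hexp
  linarith

end Tail

/-! ### Total variation -/

section TotalVariation

theorem le_tvDist {X : Type*} [Fintype X] (μ ν : X → ℝ) (A : Finset X) :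
    |∑ y ∈ A, (μ y - ν y)| ≤ tvDist μ ν :=
  le_ciSup (f := fun A : Finset X => |∑ y ∈ A, (μ y - ν y)|) (Set.finite_range _).bddAbove A

variable {n : ℕ} {θ : ℝ}

/-- Cauchy–Schwarz on each event, whose π-mass is at most 1. -/
theorem scanTV_sq_le (h0 : 0 < θ) (ℓ : ℕ) : scanTV n θ ℓ ^ 2 ≤ scanL2 n θ ℓ 1 := by
  have hL : 0 ≤ scanL2 n θ ℓ 1 :=
    Finset.sum_nonneg fun y _ => mul_nonneg (mul_self_nonneg _) (mallows_pos h0 y).le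
  have key : ∀ A : Finset (Equiv.Perm (Fin n)),
      |∑ y ∈ A, ((shortScan n θ ^ ℓ) 1 y - mallows n θ y)| ≤ Real.sqrt (scanL2 n θ ℓ 1) := by
    intro A
    refine Real.le_sqrt_of_sq_le ?_
    rw [sq_abs]
    refine (Finset.sum_sq_le_sum_mul_sum_of_sq_le_mul A
      (f := fun y => ((shortScan n θ ^ ℓ) 1 y / mallows n θ y - 1) *
        ((shortScan n θ ^ ℓ) 1 y / mallows n θ y - 1) * mallows n θ y)
      (g := mallows n θ) (fun y _ => mul_nonneg (mul_self_nonneg _) (mallows_pos h0 y).le)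
      (fun y _ => (mallows_pos h0 y).le) (fun y _ => ?_)).trans ?_
    · have := (mallows_pos h0 y).ne'
      apply le_of_eq
      field_simp
    · have h1 : ∑ y ∈ A, mallows n θ y ≤ 1 := by
        rw [← sum_mallows h0]
        exact Finset.sum_le_sum_of_subset_of_nonneg (Finset.subset_univ _)
          fun y _ _ => (mallows_pos h0 y).le
      have h2 : ∑ y ∈ A, ((shortScan n θ ^ ℓ) 1 y / mallows n θ y - 1) *
          ((shortScan n θ ^ ℓ) 1 y / mallows n θ y - 1) * mallows n θ y ≤ scanL2 n θ ℓ 1 :=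
        Finset.sum_le_sum_of_subset_of_nonneg (Finset.subset_univ _)
          fun y _ _ => mul_nonneg (mul_self_nonneg _) (mallows_pos h0 y).le
      refine (mul_le_mul h2 h1 (Finset.sum_nonneg fun y _ => (mallows_pos h0 y).le) hL).trans ?_
      rw [mul_one]
  have h1 : scanTV n θ ℓ ≤ Real.sqrt (scanL2 n θ ℓ 1) := ciSup_le key
  have h2 : 0 ≤ scanTV n θ ℓ := (abs_nonneg _).trans (le_tvDist _ _ ∅)
  calc _ ≤ Real.sqrt (scanL2 n θ ℓ 1) ^ 2 := pow_le_pow_left₀ h2 h1 2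
    _ = _ := Real.sq_sqrt hL

theorem log_scan_factor {a L : ℝ} (hL : L ≠ 0) {ℓ : ℝ} (b : ℝ) (hℓ : ℓ = b - a / L) :
    ℓ * L = b * L - a := by
  rw [hℓ]; field_simp

/-- The prescribed number of scans is the one for which θ^{2ℓ} = n⁻² θ^{n+2c}; multiplied by n²
θ^{-(n-1)} this is θ^{2c+1}. -/
theorem scan_factor_eq (h0 : 0 < θ) (h1 : θ < 1) (hn : 1 ≤ n) {ℓ : ℕ} {c : ℝ}
    (hℓ : (ℓ : ℝ) = (n : ℝ) / 2 - Real.log n / Real.log θ + c) :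
    (n : ℝ) ^ 2 * θ⁻¹ ^ (n - 1) * θ ^ (2 * ℓ) = θ ^ (2 * c + 1) := by
  have hL := Real.log_neg h0 h1
  have hn0 : (0 : ℝ) < n := by exact_mod_cast hn
  have h := log_scan_factor hL.ne (a := Real.log n) ((n : ℝ) / 2 + c) (ℓ := ℓ) (by rw [hℓ]; ring)
  refine Real.log_injOn_pos (Set.mem_Ioi.mpr (by positivity)) (Set.mem_Ioi.mpr (by positivity)) ?_
  rw [Real.log_mul (by positivity) (by positivity), Real.log_mul (by positivity) (by positivity),
    Real.log_rpow h0, Real.log_pow, Real.log_pow, Real.log_pow, Real.log_inv, Nat.cast_sub hn]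
  push_cast
  linear_combination 2 * h

theorem scan_factor_one_eq (h0 : 0 < θ) (h1 : θ < 1) (hn : 1 ≤ n) {ℓ : ℕ} {c : ℝ}
    (hℓ : (ℓ : ℝ) = -(Real.log n / Real.log θ) + c) :
    (n : ℝ) ^ 2 * 1 ^ (n - 1) * θ ^ (2 * ℓ) = θ ^ (2 * c) := by
  have hL := Real.log_neg h0 h1
  have hn0 : (0 : ℝ) < n := by exact_mod_cast hn
  have h := log_scan_factor hL.ne (a := Real.log n) c (ℓ := ℓ) (by rw [hℓ]; ring)
  refine Real.log_injOn_pos (Set.mem_Ioi.mpr (by positivity)) (Set.mem_Ioi.mpr (by positivity)) ?_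
  rw [one_pow, mul_one, Real.log_mul (by positivity) (by positivity),
    Real.log_rpow h0, Real.log_pow, Real.log_pow]
  push_cast
  linear_combination 2 * h

theorem scanTV_upper (h0 : 0 < θ) (h1 : θ < 1) (hn : 1 ≤ n) {ℓ : ℕ} {c : ℝ}
    (hℓ : (ℓ : ℝ) = (n : ℝ) / 2 - Real.log n / Real.log θ + c) :
    scanTV n θ ℓ ^ 2 ≤ Real.exp (θ ^ (2 * c + 1)) - 1 := by
  refine (scanTV_sq_le h0 ℓ).trans ?_
  rw [scanL2_one h0 h1.le hn, ← scan_factor_eq h0 h1 hn hℓ]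
  simp only [genericDegree_eq]
  exact sum_weights_tableauSum_le ((one_le_inv₀ h0).mpr h1.le) h0 h1.le hn ℓ

theorem sum_scanL2_upper (h0 : 0 < θ) (h1 : θ < 1) (hn : 1 ≤ n) {ℓ : ℕ} {c : ℝ}
    (hℓ : (ℓ : ℝ) = -(Real.log n / Real.log θ) + c) :
    ∑ x : Equiv.Perm (Fin n), mallows n θ x * scanL2 n θ ℓ x ≤ Real.exp (θ ^ (2 * c)) - 1 := by
  rw [sum_scanL2 h0 h1.le hn, ← scan_factor_one_eq h0 h1 hn hℓ]
  simp only [dimConst_eq, ← qFactorial_one]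
  exact sum_weights_tableauSum_le le_rfl h0 h1.le hn ℓ

end TotalVariation

/-! ### The lower bound -/

section LowerBound
open Matrix

variable {n : ℕ} {θ : ℝ}

theorem metropolis_nonneg (h0 : 0 ≤ θ) (h1 : θ ≤ 1) (i : Fin (n - 1)) (x y) :
    0 ≤ metropolis n θ i x y := by
  rw [metropolis, of_apply]
  split_ifs <;> linarith

theorem matrix_mul_nonneg {ι : Type*} [Fintype ι] {a b : Matrix ι ι ℝ} (ha : ∀ x y, 0 ≤ a x y)
    (hb : ∀ x y, 0 ≤ b x y) (x y : ι) : 0 ≤ (a * b) x y := by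
  rw [mul_apply]
  exact Finset.sum_nonneg fun z _ => mul_nonneg (ha x z) (hb z y)

theorem matrix_one_nonneg {ι : Type*} [Fintype ι] [DecidableEq ι] (x y : ι) :
    0 ≤ (1 : Matrix ι ι ℝ) x y := by
  rw [one_apply]
  split_ifs <;> norm_num

theorem palindrome_nonneg (h0 : 0 ≤ θ) (h1 : θ ≤ 1) (k : ℕ) (x y) :
    0 ≤ palindrome (revGen n θ) k x y := by
  have hr : ∀ k x y, 0 ≤ revGen n θ k x y := fun k => by
    unfold revGen
    split_ifs
    · exact metropolis_nonneg h0 h1 _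
    · exact matrix_one_nonneg
  induction k generalizing x y with
  | zero => exact matrix_one_nonneg x y
  | succ k ih => exact matrix_mul_nonneg (matrix_mul_nonneg (hr k) ih) (hr k) x y

theorem shortScan_pow_nonneg (h0 : 0 ≤ θ) (h1 : θ ≤ 1) (m : ℕ) (x y) :
    0 ≤ (shortScan n θ ^ m) x y := by
  induction m generalizing x y with
  | zero => rw [pow_zero]; exact matrix_one_nonneg x y
  | succ m ih =>
    rw [pow_succ]
    refine matrix_mul_nonneg ih (fun x y => ?_) x y
    rw [shortScan_eq_palindrome]
    exact palindrome_nonneg h0 h1 _ x y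

theorem scanTV_le_one (h0 : 0 < θ) (h1 : θ ≤ 1) (ℓ : ℕ) : scanTV n θ ℓ ≤ 1 := by
  refine ciSup_le fun A => ?_
  rw [Finset.sum_sub_distrib, abs_le]
  have a1 : 0 ≤ ∑ y ∈ A, (shortScan n θ ^ ℓ) 1 y :=
    Finset.sum_nonneg fun y _ => shortScan_pow_nonneg h0.le h1 ℓ 1 y
  have a2 : ∑ y ∈ A, (shortScan n θ ^ ℓ) 1 y ≤ 1 := by
    rw [← sum_shortScan_pow (θ := θ) ℓ 1]
    exact Finset.sum_le_sum_of_subset_of_nonneg (Finset.subset_univ _)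
      fun y _ _ => shortScan_pow_nonneg h0.le h1 ℓ 1 y
  have b1 : 0 ≤ ∑ y ∈ A, mallows n θ y := Finset.sum_nonneg fun y _ => (mallows_pos h0 y).le
  have b2 : ∑ y ∈ A, mallows n θ y ≤ 1 := by
    rw [← sum_mallows h0]
    exact Finset.sum_le_sum_of_subset_of_nonneg (Finset.subset_univ _)
      fun y _ _ => (mallows_pos h0 y).le
  constructor <;> linarith

/-- The scan gives full mass to any set containing its support, so such a set separates it from π by
the π-mass of the complement. -/
theorem one_sub_le_scanTV (ℓ : ℕ) (A : Finset (Equiv.Perm (Fin n)))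
    (hA : ∀ y, (shortScan n θ ^ ℓ) 1 y ≠ 0 → y ∈ A) :
    1 - ∑ y ∈ A, mallows n θ y ≤ scanTV n θ ℓ := by
  refine le_trans ?_ ((le_abs_self _).trans (le_tvDist _ _ A))
  have h : ∑ y ∈ A, (shortScan n θ ^ ℓ) 1 y = 1 := by
    rw [← sum_shortScan_pow (θ := θ) ℓ 1]
    refine Finset.sum_subset (Finset.subset_univ _) fun y _ hy => ?_
    by_contra h
    exact hy (hA y h)
  rw [Finset.sum_sub_distrib, h]

end LowerBound

/-! ### The number of small letters in the right part -/

section Displaced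
open Matrix

variable {n : ℕ} {θ : ℝ}

/-- The number of letters below `m` which stand at positions from `m` on. -/
def displaced (m : ℕ) (x : Equiv.Perm (Fin n)) : ℕ :=
  ∑ v ∈ Finset.univ.filter (fun v : Fin n => (v : ℕ) < m), if m ≤ (x⁻¹ v : ℕ) then 1 else 0

theorem displaced_one (m : ℕ) : displaced m (1 : Equiv.Perm (Fin n)) = 0 := by
  refine Finset.sum_eq_zero fun v hv => ?_
  have := (Finset.mem_filter.mp hv).2
  rw [inv_one, Equiv.Perm.one_apply, if_neg (by omega)]

theorem displaced_congr {m : ℕ} {x y : Equiv.Perm (Fin n)}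
    (h : ∀ v : Fin n, (v : ℕ) < m → y⁻¹ v = x⁻¹ v) : displaced m y = displaced m x :=
  Finset.sum_congr rfl fun v hv => by rw [h v (Finset.mem_filter.mp hv).2]

theorem displaced_mul_of_ne {m : ℕ} {i : Fin (n - 1)} (h : (i : ℕ) + 1 ≠ m)
    (x : Equiv.Perm (Fin n)) : displaced m (simpleRefl n i * x) = displaced m x := by
  rw [displaced, displaced]
  simp only [inv_simpleRefl_mul_apply]
  refine Finset.sum_equiv (simpleRefl n i) (fun v => ?_) fun v _ => rfl
  simp only [Finset.mem_filter, Finset.mem_univ, true_and, simpleRefl_val]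
  split_ifs <;> omega

theorem displaced_mul {i : Fin (n - 1)} (x : Equiv.Perm (Fin n)) :
    displaced (i + 1) (simpleRefl n i * x) + (if (i : ℕ) + 1 ≤ (x⁻¹ (lo i) : ℕ) then 1 else 0) =
      displaced (i + 1) x + if (i : ℕ) + 1 ≤ (x⁻¹ (hi i) : ℕ) then 1 else 0 := by
  have e : Finset.univ.filter (fun v : Fin n => (v : ℕ) < i + 1) =
      insert (lo i) (Finset.univ.filter fun v : Fin n => (v : ℕ) < i) := by
    ext v
    simp only [Finset.mem_filter, Finset.mem_univ, true_and, Finset.mem_insert, Fin.ext_iff, lo]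
    omega
  have hnot : lo i ∉ Finset.univ.filter fun v : Fin n => (v : ℕ) < i := by
    simp [lo]
  have e2 : ∀ v ∈ Finset.univ.filter (fun v : Fin n => (v : ℕ) < i),
      (if (i : ℕ) + 1 ≤ (x⁻¹ (simpleRefl n i v) : ℕ) then 1 else 0) =
        if (i : ℕ) + 1 ≤ (x⁻¹ v : ℕ) then 1 else 0 := fun v hv => by
    rw [simpleRefl_apply_of_lt (Finset.mem_filter.mp hv).2]
  rw [displaced, displaced, e, Finset.sum_insert hnot, Finset.sum_insert hnot]
  simp only [inv_simpleRefl_mul_apply, simpleRefl_lo]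
  rw [Finset.sum_congr rfl e2]
  ring

theorem displaced_first_step {i : Fin (n - 1)} {x y : Equiv.Perm (Fin n)}
    (h : metropolis n θ i x y ≠ 0) :
    displaced (i + 1) y ≤
      displaced (i + 1) x + if (i : ℕ) + 1 ≤ (y⁻¹ (lo i) : ℕ) then 1 else 0 := by
  rcases metropolis_support h with rfl | ⟨rfl, _⟩
  · rw [inv_simpleRefl_mul_apply, simpleRefl_lo]
    have := displaced_mul (i := i) x
    omega
  · exact Nat.le_add_right _ _

theorem displaced_second_step {i : Fin (n - 1)} {x y : Equiv.Perm (Fin n)}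
    (h : metropolis n θ i x y ≠ 0) :
    displaced (i + 1) y + (if (i : ℕ) + 1 ≤ (x⁻¹ (lo i) : ℕ) then 1 else 0) ≤
      displaced (i + 1) x + 1 := by
  rcases metropolis_support h with rfl | ⟨rfl, _⟩
  · rw [displaced_mul]
    split_ifs <;> omega
  · split_ifs <;> omega

theorem displaced_step_of_ne {m : ℕ} {i : Fin (n - 1)} (hi : (i : ℕ) + 1 ≠ m)
    {x y : Equiv.Perm (Fin n)} (h : metropolis n θ i x y ≠ 0) : displaced m y = displaced m x := by
  rcases metropolis_support h with rfl | ⟨rfl, _⟩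
  · exact displaced_mul_of_ne hi x
  · rfl

theorem exists_of_mul_ne_zero {ι : Type*} [Fintype ι] {a b c : Matrix ι ι ℝ} {x y : ι}
    (h : (a * b * c) x y ≠ 0) : ∃ z w, a x z ≠ 0 ∧ b z w ≠ 0 ∧ c w y ≠ 0 := by
  rw [mul_apply] at h
  obtain ⟨w, _, hw⟩ := Finset.exists_ne_zero_of_sum_ne_zero h
  have h1 := left_ne_zero_of_mul hw
  rw [mul_apply] at h1
  obtain ⟨z, _, hz⟩ := Finset.exists_ne_zero_of_sum_ne_zero h1
  exact ⟨z, w, left_ne_zero_of_mul hz, right_ne_zero_of_mul hz, right_ne_zero_of_mul hw⟩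

/-- Only the chain exchanging letters m - 1 and m (numbered from 0) can change the count, and a scan
uses it twice. Between the two uses the letters below m stand still. If the first use increases the
count, letter m - 1 has come to the right part; the second use, which could only replace it by
letter m - 1's successor, then cannot increase the count again. -/
theorem displaced_palindrome_le {m : ℕ} (hm : 0 < m) (hmn : m < n) :
    ∀ k ≤ n - 1, ∀ x y : Equiv.Perm (Fin n), palindrome (revGen n θ) k x y ≠ 0 →
      displaced m y ≤ displaced m x + 1 := by
  have fix : ∀ k ≤ n - 1 - m, ∀ x y : Equiv.Perm (Fin n), palindrome (revGen n θ) k x y ≠ 0 →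
      ∀ v : Fin n, (v : ℕ) < m → y⁻¹ v = x⁻¹ v := by
    intro k hk x y h v hv
    exact parabolic_le_fixingLetters (show k < n - 1 by omega) (palindrome_mem _ k) x y h v
      (by omega)
  intro k
  induction k with
  | zero =>
    intro _ x y h
    exact (displaced_congr (fix 0 (Nat.zero_le _) x y h)).le.trans (Nat.le_succ _)
  | succ k ih =>
    intro hk x y h
    obtain ⟨z, w, h1, h2, h3⟩ := exists_of_mul_ne_zero h
    rw [revGen_of_lt (by omega)] at h1 h3
    by_cases hkm : n - 2 - k + 1 = m
    · subst hkm
      set i : Fin (n - 1) := ⟨n - 2 - k, by omega⟩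
      have e := fix k (by omega) z w h2
      have a1 : displaced (n - 2 - k + 1) z ≤ displaced (n - 2 - k + 1) x +
        if n - 2 - k + 1 ≤ (z⁻¹ (lo i) : ℕ) then 1 else 0 := displaced_first_step h1
      have a2 : displaced (n - 2 - k + 1) y +
        (if n - 2 - k + 1 ≤ (w⁻¹ (lo i) : ℕ) then 1 else 0) ≤ displaced (n - 2 - k + 1) w + 1 :=
        displaced_second_step h3
      rw [displaced_congr e, e (lo i) (Nat.lt_succ_self _)] at a2
      omega
    · rw [displaced_step_of_ne hkm h3, ← displaced_step_of_ne hkm h1]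
      exact ih (by omega) z w h2

theorem displaced_shortScan_pow_le {m : ℕ} (hm : 0 < m) (hmn : m < n) (ℓ : ℕ) :
    ∀ y : Equiv.Perm (Fin n), (shortScan n θ ^ ℓ) 1 y ≠ 0 → displaced m y ≤ ℓ := by
  induction ℓ with
  | zero =>
    intro y h
    have : (1 : Equiv.Perm (Fin n)) = y := by
      by_contra h'
      exact h (by rw [pow_zero, one_apply_ne h'])
    rw [← this, displaced_one]
  | succ ℓ ih =>
    intro y h
    rw [pow_succ, mul_apply] at h
    obtain ⟨z, _, hz⟩ := Finset.exists_ne_zero_of_sum_ne_zero h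
    have h1 := ih z (left_ne_zero_of_mul hz)
    have h2 := right_ne_zero_of_mul hz
    rw [shortScan_eq_palindrome] at h2
    have := displaced_palindrome_le hm hmn _ le_rfl z y h2
    omega

/-! ### The Mallows measure of permutations with few displaced letters -/

/-- A letter below m at a position below m and a letter from m on at a position from m on are in the
right order. With d displaced letters there are m - d of the former and n - m - d of the latter. The
reversal inverts all pairs, so these pairs are missing from the inversions of `y`. -/
theorem invCount_le_revPerm (y : Equiv.Perm (Fin n)) {m : ℕ} (hmn : m ≤ n) :
    invCount y + (m - displaced m y) * (n - m - displaced m y) ≤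
      invCount (Fin.revPerm : Equiv.Perm (Fin n)) := by
  set A := Finset.univ.filter fun v : Fin n => (v : ℕ) < m ∧ ¬ m ≤ (y⁻¹ v : ℕ) with hA
  set B := Finset.univ.filter fun v : Fin n => m ≤ (y⁻¹ v : ℕ) ∧ ¬ (v : ℕ) < m with hB
  have hd : displaced m y =
      (Finset.univ.filter fun v : Fin n => (v : ℕ) < m ∧ m ≤ (y⁻¹ v : ℕ)).card := by
    rw [displaced, Finset.sum_boole, Finset.filter_filter, Nat.cast_id]
  have hAc : displaced m y + A.card = m := by
    rw [hd, hA, ← Finset.filter_filter, ← Finset.filter_filter,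
      Finset.card_filter_add_card_filter_not, Fin.card_filter_val_lt]
    omega
  have hBc : displaced m y + B.card = n - m := by
    have h1 : (Finset.univ.filter fun v : Fin n => m ≤ (y⁻¹ v : ℕ)).card = n - m := by
      have h2 : (Finset.univ.filter fun v : Fin n => m ≤ (y⁻¹ v : ℕ)).card =
          (Finset.univ.filter fun v : Fin n => ¬ (v : ℕ) < m).card := by
        refine Finset.card_equiv y⁻¹ fun v => ?_
        simp
      have h3 := Finset.card_filter_add_card_filter_not (s := (Finset.univ : Finset (Fin n)))
        (fun v : Fin n => (v : ℕ) < m)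
      rw [Fin.card_filter_val_lt, Finset.card_univ, Fintype.card_fin] at h3
      omega
    rw [hd, hB, ← h1]
    simp only [and_comm (a := (_ : Fin n).val < m)]
    rw [← Finset.filter_filter, ← Finset.filter_filter, Finset.card_filter_add_card_filter_not]
  have hsub : A ×ˢ B ∪ inversions y ⊆ inversions (Fin.revPerm : Equiv.Perm (Fin n)) := by
    have hrev : ∀ u v : Fin n, u < v →
        (u, v) ∈ inversions (Fin.revPerm : Equiv.Perm (Fin n)) := by
      intro u v huv
      refine Finset.mem_filter.mpr ⟨Finset.mem_univ _, huv, ?_⟩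
      change Fin.rev v < Fin.rev u
      exact Fin.rev_lt_rev.mpr huv
    rintro ⟨u, v⟩ huv
    rcases Finset.mem_union.mp huv with h | h
    · obtain ⟨h1, h2⟩ := Finset.mem_product.mp h
      have h3 := (Finset.mem_filter.mp h1).2
      have h4 := (Finset.mem_filter.mp h2).2
      exact hrev u v (Fin.lt_def.mpr (by dsimp only at h3 h4; omega))
    · exact hrev u v (Finset.mem_filter.mp h).2.1
  have hdisj : Disjoint (A ×ˢ B) (inversions y) := by
    rw [Finset.disjoint_left]
    rintro ⟨u, v⟩ h h'
    obtain ⟨h1, h2⟩ := Finset.mem_product.mp h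
    have h3 := (Finset.mem_filter.mp h1).2
    have h4 := (Finset.mem_filter.mp h2).2
    have h5 := Fin.lt_def.mp (Finset.mem_filter.mp h').2.2
    dsimp only at h3 h4 h5
    omega
  have := Finset.card_le_card hsub
  rw [Finset.card_union_of_disjoint hdisj, Finset.card_product] at this
  rw [show m - displaced m y = A.card by omega, show n - m - displaced m y = B.card by omega,
    invCount, invCount]
  omega

/-- The term of the reversal alone already makes the normalizing sum larger than the weight of `y`
by the factor θ^{-P}. -/
theorem mallows_le_pow (h0 : 0 < θ) (h1 : θ ≤ 1) (y : Equiv.Perm (Fin n)) {m : ℕ} (hmn : m ≤ n) :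
    mallows n θ y ≤ θ ^ ((m - displaced m y) * (n - m - displaced m y)) := by
  have hq : 1 ≤ θ⁻¹ := (one_le_inv₀ h0).mpr h1
  set P := (m - displaced m y) * (n - m - displaced m y)
  have h : θ⁻¹ ^ (invCount y + P) ≤ qFactorial θ⁻¹ n := by
    rw [← sum_pow_invCount]
    refine (pow_le_pow_right₀ hq (invCount_le_revPerm y hmn)).trans ?_
    exact Finset.single_le_sum (f := fun x : Equiv.Perm (Fin n) => θ⁻¹ ^ invCount x)
      (fun x _ => by positivity) (Finset.mem_univ _)
  rw [mallows_eq, mallowsWeight, div_le_iff₀ (qFactorial_pos (inv_pos.mpr h0) n)]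
  calc θ⁻¹ ^ invCount y = θ ^ P * θ⁻¹ ^ (invCount y + P) := by
        rw [pow_add, mul_left_comm, ← mul_pow, mul_inv_cancel₀ h0.ne', one_pow, mul_one]
    _ ≤ _ := by gcongr

/-- The event is that at most ℓ letters of the lower half are displaced; it contains the support of
the scan law. Each of its at most n! ≤ n^n elements has Mallows mass at most θ^{n²/32}. -/
theorem scanTV_lower_of_lt (h0 : 0 < θ) (h1 : θ < 1) {ℓ : ℕ} (hn : 4 ≤ n) (hℓ : 4 * ℓ ≤ n) :
    1 - ((n : ℝ) * (θ ^ (1 / 32 : ℝ)) ^ n) ^ n ≤ scanTV n θ ℓ := by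
  set r : ℝ := θ ^ (1 / 32 : ℝ) with hr
  have hr0 : 0 < r := by positivity
  have hr1 : r ≤ 1 := Real.rpow_le_one h0.le h1.le (by norm_num)
  have hr32 : r ^ 32 = θ := by
    rw [hr, ← Real.rpow_natCast, ← Real.rpow_mul h0.le]
    norm_num
  refine le_trans ?_ (one_sub_le_scanTV ℓ
    (Finset.univ.filter fun y : Equiv.Perm (Fin n) => displaced (n / 2) y ≤ ℓ) fun y hy => ?_)
  · have hle : ∀ y ∈ Finset.univ.filter (fun y : Equiv.Perm (Fin n) => displaced (n / 2) y ≤ ℓ),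
        mallows n θ y ≤ r ^ (n * n) := by
      intro y hy
      have hy' := (Finset.mem_filter.mp hy).2
      refine (mallows_le_pow h0 h1.le y (Nat.div_le_self n 2)).trans ?_
      rw [← hr32, ← pow_mul]
      refine pow_le_pow_of_le_one hr0.le hr1 ?_
      -- These bounds give 16ab ≥ n(n-2), and 2n(n-2) ≥ n² for n ≥ 4. That is the source of the
      -- exponent 1/32.
      have a1 : n ≤ 4 * (n / 2 - displaced (n / 2) y) + 2 := by omega
      have a2 : n ≤ 4 * (n - n / 2 - displaced (n / 2) y) := by omega
      generalize n / 2 - displaced (n / 2) y = a at *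
      generalize n - n / 2 - displaced (n / 2) y = b at *
      obtain ⟨k, rfl⟩ : ∃ k, n = k + 4 := ⟨n - 4, by omega⟩
      have a3 : (k + 2) * (k + 4) ≤ (4 * a) * (4 * b) := Nat.mul_le_mul (by omega) a2
      nlinarith
    have hcard : ((Finset.univ.filter fun y : Equiv.Perm (Fin n) =>
        displaced (n / 2) y ≤ ℓ).card : ℝ) ≤ (n : ℝ) ^ n := by
      have := (Finset.card_filter_le (Finset.univ : Finset (Equiv.Perm (Fin n)))
        (fun y => displaced (n / 2) y ≤ ℓ)).trans_eq (Finset.card_univ.trans Fintype.card_perm)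
      rw [Fintype.card_fin] at this
      exact_mod_cast this.trans (Nat.factorial_le_pow n)
    have := Finset.sum_le_card_nsmul _ _ _ hle
    rw [nsmul_eq_mul] at this
    have h2 := this.trans (mul_le_mul_of_nonneg_right hcard (by positivity))
    rw [mul_pow, ← pow_mul]
    linarith
  · exact Finset.mem_filter.mpr ⟨Finset.mem_univ _,
      displaced_shortScan_pow_le (by omega) (by omega) ℓ y hy⟩

theorem shortScan_one : shortScan n 1 = 1 := by
  rw [shortScan_eq_palindrome]
  have : ∀ k ≤ n - 1, palindrome (revGen n 1) k = 1 := by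
    intro k
    induction k with
    | zero => intro _; rfl
    | succ k ih =>
      intro hk
      rw [palindrome, ih (by omega), mul_one, (heckeRel_revGen n 1).quad k (by omega)]
      simp
  exact this _ le_rfl

theorem scanTV_lower_one (ℓ : ℕ) : 1 - 1 / (n.factorial : ℝ) ≤ scanTV n 1 ℓ := by
  refine le_trans ?_ (one_sub_le_scanTV ℓ {1} fun y hy => ?_)
  · rw [Finset.sum_singleton, mallows_one_eq, inv_one, qFactorial_one]
  · rw [shortScan_one, one_pow] at hy
    by_contra h
    exact hy (one_apply_ne fun h' => h (by rw [Finset.mem_singleton, h']))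

theorem tendsto_scanTV (h0 : 0 < θ) (h1 : θ ≤ 1) (L : ℕ → ℕ)
    (hL : ∀ᶠ n : ℕ in atTop, (L n : ℝ) ≤ (n : ℝ) / 4) :
    Tendsto (fun n : ℕ => scanTV n θ (L n)) atTop (𝓝 1) := by
  -- At θ = 1 the scan is the identity and π is uniform, so the distance is bounded below by 1 -
  -- 1/n!, whatever the number of scans.
  rcases h1.eq_or_lt with rfl | h1'
  · have h : Tendsto (fun n : ℕ => 1 - 1 / (n.factorial : ℝ)) atTop (𝓝 (1 - 0)) := by
      refine tendsto_const_nhds.sub ?_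
      exact tendsto_const_nhds.div_atTop (tendsto_natCast_atTop_atTop.comp
        (tendsto_atTop_mono Nat.self_le_factorial tendsto_id))
    rw [sub_zero] at h
    exact tendsto_of_tendsto_of_tendsto_of_le_of_le h tendsto_const_nhds
      (fun n => scanTV_lower_one _) (fun n => scanTV_le_one h0 h1 _)
  · have hr1 : θ ^ (1 / 32 : ℝ) < 1 := Real.rpow_lt_one h0.le h1' (by norm_num)
    have ht := tendsto_self_mul_const_pow_of_lt_one (show 0 ≤ θ ^ (1 / 32 : ℝ) by positivity) hr1
    have h : Tendsto (fun n : ℕ => 1 - (n : ℝ) * (θ ^ (1 / 32 : ℝ)) ^ n) atTop (𝓝 (1 - 0)) :=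
      tendsto_const_nhds.sub ht
    rw [sub_zero] at h
    refine tendsto_of_tendsto_of_tendsto_of_le_of_le' h tendsto_const_nhds ?_
      (Eventually.of_forall fun n => scanTV_le_one h0 h1 _)
    filter_upwards [hL, eventually_ge_atTop 4, ht.eventually (gt_mem_nhds zero_lt_one)]
      with n hn1 hn2 hn3
    have hℓ : 4 * L n ≤ n := by
      have : (4 * L n : ℝ) ≤ n := by linarith
      exact_mod_cast this
    refine le_trans ?_ (scanTV_lower_of_lt h0 h1' hn2 hℓ)
    have := pow_le_of_le_one (show 0 ≤ (n : ℝ) * (θ ^ (1 / 32 : ℝ)) ^ n by positivity) hn3.le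
      (show n ≠ 0 by omega)
    linarith

end Displaced

end MallowsScan

theorem theorem7p5 (θ : ℝ) (hθ0 : 0 < θ) (hθ1 : θ ≤ 1) :
    -- (a); the partitions other than `(n)` are those whose first row is not `n`
    (∀ (n : ℕ) (hn : 1 ≤ n) (ℓ : ℕ),
      scanL2 n θ ℓ 1 =
        ∑ μ : Shape n with μ.1.rowLen 0 ≠ n, genericDegree θ⁻¹ μ * tableauSum hn θ ℓ μ) ∧
    -- (a'), upper bound
    (θ < 1 → ∀ (n : ℕ), 1 ≤ n → ∀ (ℓ : ℕ) (c : ℝ), 0 < c →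
      (ℓ : ℝ) = (n : ℝ) / 2 - Real.log n / Real.log θ + c →
      scanTV n θ ℓ ^ 2 ≤
        (Real.exp (θ ^ (2 * c + 1)) - 1) +
          (n.factorial : ℝ) *
            θ ^ ((n : ℝ) ^ 2 / 8 - (n : ℝ) * Real.log n / Real.log θ + (n : ℝ) * (c + 1 / 4))) ∧
    -- (a'), lower bound
    (∀ L : ℕ → ℕ, (∀ᶠ n : ℕ in atTop, (L n : ℝ) ≤ (n : ℝ) / 4) →
      Tendsto (fun n : ℕ => scanTV n θ (L n)) atTop (𝓝 1)) ∧
    -- (b)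
    (∀ (n : ℕ) (hn : 1 ≤ n) (ℓ : ℕ),
      ∑ x : Equiv.Perm (Fin n), mallows n θ x * scanL2 n θ ℓ x =
        ∑ μ : Shape n with μ.1.rowLen 0 ≠ n, dimConst μ * tableauSum hn θ ℓ μ) ∧
    -- (b')
    (θ < 1 → ∀ (n : ℕ), 1 ≤ n → ∀ (ℓ : ℕ) (c : ℝ), 0 < c →
      (ℓ : ℝ) = -(Real.log n / Real.log θ) + c →
      ∑ x : Equiv.Perm (Fin n), mallows n θ x * scanL2 n θ ℓ x ≤
        (Real.exp (θ ^ (2 * c)) - 1) +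
          (θ ^ c / Real.exp 1) ^ n * Real.exp (1 / 12) * Real.sqrt (2 * Real.pi * n)) := by
  refine ⟨fun n hn ℓ => scanL2_one hθ0 hθ1 hn ℓ, fun h1 n hn ℓ c _ hℓ => ?_,
    tendsto_scanTV hθ0 hθ1, fun n hn ℓ => sum_scanL2 hθ0 hθ1 hn ℓ, fun h1 n hn ℓ c _ hℓ => ?_⟩
  -- The exponential term alone is already an upper bound here and in (b'); the second summand
  -- enters only through its nonnegativity.
  · exact (scanTV_upper hθ0 h1 hn hℓ).trans (le_add_of_nonneg_right (by positivity))
  · exact (sum_scanL2_upper hθ0 h1 hn hℓ).trans (le_add_of_nonneg_right (by positivity))
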